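/- **Notation.** Let $p>0$ and $q$ be coprime odd integers with $|q|<p$, put $d=(p-1)/2$, and for $1\le n\le d$ let $e_n=\operatorname{sign}(k_n)$, where $k_n\equiv nq \pmod{2p}$, $-p<k_n<p$, $k_n\neq 0$. The 2-bridge knot $K=K(p,q)$ has knot group $\pi=\langle a,b\mid aw=wb\rangle$, where $w=v\bar v$, $v=b^{e_1}a^{e_2}\cdots(a\text{ or }b)^{e_d}$, and $\bar v$ is $v$ written backwards with $a$ and $b$ interchanged. Its meridian is $a$ and its longitude is $l=w\tilde w a^{-4\sum e_n}$, where $\tilde w$ is $w$ written backwards. Let $$H=\mathbb C[\pi]/\langle [g,h+h^{-1}] : g,h\in\pi\rangle$$ be the Brumfiel–Hilden algebra, with the linear anti-involution $*$, $g^*=g^{-1}$, and $H^+=\{h\in H: h^*=h\}$. Let $X,Y\in H$ be the images of $a,l$ and $\delta=X-X^{-1}$ ($\delta^2$ is central). Define $x,i,j\in H$ by $a^{\pm1}=x\pm(i+j)/2$, $b^{\pm1}=x\mp(i-j)/2$, and put $I=i^2$, $J=j^2$, $k=ij$; the elements $x,I,J$ are central. The polynomial $Q\in\mathbb C[I,J]$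 of degree $d$ is the one, unique up to a nonzero scalar, such that $$H=H^+\oplus \bar H^+ i\oplus H^+ j\oplus\bar H^+ k,\qquad H^+=\frac{\mathbb C[x,I,J]}{\langle IQ,\;I+J-4(x^2-1)\rangle},\qquad \bar H^+=\frac{\mathbb C[x,I,J]}{\langle Q,\;I+J-4(x^2-1)\rangle}.$$ Let $H^+[X^{\pm1}]$ be the subalgebra of $H$ generated by $H^+$ and $X^{\pm1}$, and in the localization $H[\delta^{-1}]$ put $$M=H^+[X^{\pm1}]+H^+[X^{\pm1}]\,Q\delta^{-1},\qquad M_0=\mathbb C[X^{\pm1}]\,Q\delta^{-1}\subseteq M .$$ Let $s$ be the restriction to $M$ of the extension of $*$ to $H[\delta^{-1}]$; $X$ and $Y$ act by left multiplication. For $t_1,\dots,t_4\in\mathbb C^*$ let $\mathcal H_{q',t_1,t_2,t_3,t_4}$ be the $\mathbb C$-algebra generated by $T_0,T_0^\vee,T_1,T_1^\vee$ with relations $(T_0-t_1)(T_0+t_1^{-1})=0$, $(T_0^\vee-t_2)(T_0^\vee+t_2^{-1})=0$, $(T_1-t_3)(T_1+t_3^{-1})=0$, $(T_1^\vee-t_4)(T_1^\vee+t_4^{-1})=0$,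 $T_1^\vee T_1T_0T_0^\vee=q'$, and let $\mathcal H_{q',t_1,t_2}=\mathcal H_{q',t_1,t_2,1,1}$. Write $\bar t_i=t_i-t_i^{-1}$. **Theorem.** For every such $p,q$ the polynomial $Q$ exists, and for every such $Q$: 1. $YQ=Q$ in $H$. The subspace $M$ is stable under $X^{\pm1},Y^{\pm1},s$, and $s$ satisfies $s^2=1$, $sXs=X^{-1}$, $sYs=Y^{-1}$ on $M$, so $M$ is a module over $\mathbb C[X^{\pm1},Y^{\pm1}]\rtimes\mathbb Z_2$. The $s$-invariants of $M$ are the image of $H^+$. 2. For all $t_1,t_2\in\mathbb C^*$ the assignment $$T_0\mapsto -t_1sY+(\bar t_2-\bar t_1X^{-1})\delta^{-1}(1+sY),\quad T_0^\vee\mapsto -T_0^{-1}X^{-1},\quad T_1\mapsto s,\quad T_1^\vee\mapsto Xs$$ extends to an action of $\mathcal H_{-1,t_1,t_2}$ on $M$. So does the assignment $$T_0\mapsto -t_1sY+(\bar t_1X+\bar t_2)\delta^{-1}(1+sY),\quad T_0^\vee\mapsto T_0^{-1}X,\quad T_1\mapsto s,\quad T_1^\vee\mapsto -X^{-1}s.$$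 3. $M$ is free over $\mathbb C[X^{\pm1}]$ with basis $1,I,\dots,I^{d-1},Q\delta^{-1}$, and $\bar M=M/M_0$ is free with basis the classes of $1,I,\dots,I^{d-1}$. The subspace $M_0$ is a $\mathbb C[X^{\pm1},Y^{\pm1}]\rtimes\mathbb Z_2$-submodule of $M$ isomorphic to the sign representation, that is, to $\mathbb C[X^{\pm1}]$ with $Y\cdot f=f$ and $s\cdot f(X)=-f(X^{-1})$. 4. Let $\bar M^{\rm loc}$ be the localization of $\bar M$ at the nonzero Laurent polynomials in $X$, with the induced action of $X,Y,s$. Then $\bar M\to\bar M^{\rm loc}$ is injective, and for all $t_1,\dots,t_4\in\mathbb C^*$ the assignment $$T_0\mapsto -t_1sY+(\bar t_2-\bar t_1X^{-1})\delta^{-1}(1+sY),\quad T_0^\vee\mapsto -T_0^{-1}X^{-1},$$ $$T_1\mapsto t_3s+(\bar t_3X+\bar t_4)\delta^{-1}(1-s),\quad T_1^\vee\mapsto XT_1^{-1}$$ extends to an action of $\mathcal H_{-1,t_1,t_2,t_3,t_4}$ on $\bar M^{\rm loc}$ which preserves $\bar M$. The operator $-t_1sY+(\bar t_1X+\bar t_2)\delta^{-1}(1+sY)$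 on $\bar M^{\rm loc}$ preserves $\bar M$ too. -/

import Mathlib

open scoped LaurentPolynomial

noncomputable section

namespace TwoBridge

/-! ### The Brumfiel-Hilden algebra of a group -/

section BrumfielHilden

variable (G : Type*) [Group G]

/-- The relations `[g, h + h⁻¹] = 0` in the complex group algebra. -/
inductive BHRel : MonoidAlgebra ℂ G → MonoidAlgebra ℂ G → Prop
  | comm (g h : G) : BHRel
      (MonoidAlgebra.of ℂ G g * (MonoidAlgebra.of ℂ G h + MonoidAlgebra.of ℂ G h⁻¹))
      ((MonoidAlgebra.of ℂ G h + MonoidAlgebra.of ℂ G h⁻¹) * MonoidAlgebra.of ℂ G g)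

/-- The Brumfiel-Hilden algebra `ℂ[G] / ⟨[g, h + h⁻¹] : g, h ∈ G⟩`. -/
def BH : Type _ := RingQuot (BHRel G)

instance : Ring (BH G) := inferInstanceAs (Ring (RingQuot (BHRel G)))
instance : Algebra ℂ (BH G) := inferInstanceAs (Algebra ℂ (RingQuot (BHRel G)))

variable {G}

/-- The canonical projection `ℂ[G] → BH G`. -/
def BH.proj : MonoidAlgebra ℂ G →ₐ[ℂ] BH G := RingQuot.mkAlgHom ℂ (BHRel G)

/-- The image of a group element in the Brumfiel-Hilden algebra. -/
def BH.of : G →* BH G := (BH.proj (G := G)).toMonoidHom.comp (MonoidAlgebra.of ℂ G)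

theorem BH.comm_add_inv (g h : G) :
    BH.of g * (BH.of h + BH.of h⁻¹) = (BH.of h + BH.of h⁻¹) * BH.of g := by
  have h1 := RingQuot.mkAlgHom_rel ℂ (BHRel.comm g h)
  rw [map_mul, map_mul, map_add] at h1
  exact h1

theorem BH.proj_of (g : G) : BH.proj (MonoidAlgebra.of ℂ G g) = BH.of g := rfl

/-- The linear extension of `g ↦ g⁻¹`, as a homomorphism `ℂ[G] → (BH G)ᵐᵒᵖ`. -/
def BH.preStar : MonoidAlgebra ℂ G →ₐ[ℂ] (BH G)ᵐᵒᵖ :=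
  MonoidAlgebra.lift ℂ (BH G)ᵐᵒᵖ G
    { toFun := fun g => MulOpposite.op (BH.of g⁻¹)
      map_one' := by simp
      map_mul' := fun g h => by simp [← MulOpposite.op_mul, ← map_mul] }

theorem BH.preStar_of (g : G) :
    BH.preStar (MonoidAlgebra.of ℂ G g) = MulOpposite.op (BH.of g⁻¹) := by
  simp [BH.preStar]

/-- The canonical anti-involution of `BH G` as a homomorphism to the opposite algebra. -/
def BH.starHom : BH G →ₐ[ℂ] (BH G)ᵐᵒᵖ :=
  RingQuot.liftAlgHom ℂ ⟨BH.preStar, by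
    rintro _ _ ⟨g, h⟩
    simp only [map_mul, map_add, BH.preStar_of, ← MulOpposite.op_mul, ← MulOpposite.op_add]
    congr 1
    rw [add_comm, inv_inv, ← BH.comm_add_inv, add_comm]⟩

/-- The canonical anti-involution `*` of `BH G`: linear, with `g* = g⁻¹`. -/
def BH.conj (x : BH G) : BH G := (BH.starHom x).unop

theorem BH.conj_of (g : G) : BH.conj (BH.of g) = BH.of g⁻¹ := by
  unfold BH.conj BH.starHom
  have : BH.of g = RingQuot.mkAlgHom ℂ (BHRel G) (MonoidAlgebra.of ℂ G g) := rfl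
  rw [this]
  erw [RingQuot.liftAlgHom_mkAlgHom_apply]
  rw [BH.preStar_of]
  rfl

theorem BH.add_inv_mem_center (g : G) :
    BH.of g + BH.of g⁻¹ ∈ Subalgebra.center ℂ (BH G) := by
  rw [Subalgebra.mem_center_iff]
  intro x
  have hs : Function.Surjective (BH.proj (G := G)) := RingQuot.mkAlgHom_surjective ℂ (BHRel G)
  obtain ⟨y, rfl⟩ := hs x
  induction y using MonoidAlgebra.induction_on with
  | of h => exact BH.comm_add_inv h g
  | add x y hx hy => rw [map_add, add_mul, hx, hy, ← mul_add]
  | smul r x hx => rw [map_smul, smul_mul_assoc, mul_smul_comm, hx]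

end BrumfielHilden

/-! ### The 2-bridge knot `K(p, q)`, its group and its peripheral elements -/

section Knot

variable (p : ℕ) (q : ℤ)

/-- The exponent `e_n = sign k_n`, where `k_n ≡ n q (mod 2p)` and `-p < k_n < p`. (`Int.bmod`
returns the representative in `[-p, p)`; the values `-p` and `0` do not occur for
`1 ≤ n ≤ (p-1)/2` when `p`, `q` are odd and coprime.) -/
def expo (n : ℕ) : ℤ := (Int.bmod (n * q) (2 * p)).sign

/-- The word `v = b^{e_1} a^{e_2} ⋯ (a or b)^{e_d}`, `d = (p-1)/2`, as a list of syllables;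
the letter `0` is `a` and the letter `1` is `b`. -/
def vWord : List (Fin 2 × ℤ) :=
  (List.range ((p - 1) / 2)).map fun n => (if n % 2 = 0 then 1 else 0, expo p q (n + 1))

/-- The anti-involution of the free group that switches `a` and `b`, on words. -/
def switchRev (l : List (Fin 2 × ℤ)) : List (Fin 2 × ℤ) :=
  l.reverse.map fun c => (1 - c.1, c.2)

/-- The word `w = v v̄`. -/
def wWord : List (Fin 2 × ℤ) := vWord p q ++ switchRev (vWord p q)

/-- The element of the free group spelled by a word. -/
def spell (l : List (Fin 2 × ℤ)) : FreeGroup (Fin 2) :=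
  (l.map fun c => FreeGroup.of c.1 ^ c.2).prod

/-- The group `⟨a, b ∣ a w = w b⟩` of the 2-bridge knot `K(p, q)`. -/
def KnotGroup : Type :=
  PresentedGroup
    {FreeGroup.of (0 : Fin 2) * spell (wWord p q) * (spell (wWord p q) * FreeGroup.of 1)⁻¹}

instance : Group (KnotGroup p q) := inferInstanceAs (Group (PresentedGroup
  {FreeGroup.of (0 : Fin 2) * spell (wWord p q) * (spell (wWord p q) * FreeGroup.of 1)⁻¹}))

/-- The projection from the free group on `a`, `b`. -/
def toKnotGroup : FreeGroup (Fin 2) →* KnotGroup p q := PresentedGroup.mk _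

/-- The meridian `a`. -/
def genA : KnotGroup p q := toKnotGroup p q (FreeGroup.of 0)

/-- The other generator `b`. -/
def genB : KnotGroup p q := toKnotGroup p q (FreeGroup.of 1)

/-- The integer `s = 4 (e_1 + ⋯ + e_d)`. -/
def framing : ℤ := 4 * ∑ n ∈ Finset.range ((p - 1) / 2), expo p q (n + 1)

/-- The longitude `l = w w̃ a^{-s}`, where `w̃` is the word `w` written backwards. -/
def longitude : KnotGroup p q :=
  toKnotGroup p q (spell (wWord p q) * spell (wWord p q).reverse) *
    genA p q ^ (-framing p q)

/-- The relation `a w = w b`, in the form: `a` and `b` are conjugate. -/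
theorem exists_conj : ∃ w : KnotGroup p q, genA p q * w = w * genB p q := by
  refine ⟨toKnotGroup p q (spell (wWord p q)), ?_⟩
  have h := PresentedGroup.one_of_mem (rels :=
    {FreeGroup.of (0 : Fin 2) * spell (wWord p q) * (spell (wWord p q) * FreeGroup.of 1)⁻¹})
    (Set.mem_singleton _)
  change toKnotGroup p q _ = 1 at h
  rw [map_mul, map_inv, mul_inv_eq_one, map_mul, map_mul] at h
  exact h

/-! ### The Brumfiel-Hilden algebra of a 2-bridge knot -/

/-- `H = BH[π]` for the knot group `π` of `K(p, q)`. -/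
abbrev H : Type := BH (KnotGroup p q)

/-- `X ∈ H`, the image of the meridian. -/
def elX : H p q := BH.of (genA p q)

/-- `X⁻¹ ∈ H`. -/
def elXinv : H p q := BH.of (genA p q)⁻¹

/-- `Y ∈ H`, the image of the longitude. -/
def elY : H p q := BH.of (longitude p q)

/-- `δ = X - X⁻¹`. -/
def delta : H p q := elX p q - elXinv p q

/-- `b - b⁻¹`. -/
def deltaB : H p q := BH.of (genB p q) - BH.of (genB p q)⁻¹

/-- `x`, with `a^{±1} = x ± (i+j)/2` and `b^{±1} = x ∓ (i-j)/2`. -/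
def qx : H p q := (1 / 2 : ℂ) • (elX p q + elXinv p q)

/-- `i`, with `a^{±1} = x ± (i+j)/2` and `b^{±1} = x ∓ (i-j)/2`. -/
def qi : H p q := (1 / 2 : ℂ) • (delta p q - deltaB p q)

/-- `j`, with `a^{±1} = x ± (i+j)/2` and `b^{±1} = x ∓ (i-j)/2`. -/
def qj : H p q := (1 / 2 : ℂ) • (delta p q + deltaB p q)

theorem elX_mul_inv : elX p q * elXinv p q = 1 := by simp [elX, elXinv, ← map_mul]

theorem elXinv_mul : elXinv p q * elX p q = 1 := by simp [elX, elXinv, ← map_mul]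

/-- `a + a⁻¹ = b + b⁻¹` in `H`. -/
theorem trace_eq : elX p q + elXinv p q = BH.of (genB p q) + BH.of (genB p q)⁻¹ := by
  obtain ⟨w, hw⟩ := exists_conj p q
  have hA : genA p q = w * genB p q * w⁻¹ := by rw [← hw]; group
  have h1 : elX p q = BH.of w * BH.of (genB p q) * BH.of w⁻¹ := by
    rw [elX, hA, map_mul, map_mul]
  have h2 : elXinv p q = BH.of w * BH.of (genB p q)⁻¹ * BH.of w⁻¹ := by
    rw [elXinv, hA, ← map_mul, ← map_mul]; congr 1; group
  rw [h1, h2, ← add_mul, ← mul_add, BH.comm_add_inv, mul_assoc, ← map_mul]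
  simp

theorem qx_mem_center : qx p q ∈ Subalgebra.center ℂ (H p q) :=
  Subalgebra.smul_mem _ (BH.add_inv_mem_center _) _

theorem delta_sq : delta p q * delta p q =
    (elX p q + elXinv p q) * (elX p q + elXinv p q) - 4 • (1 : H p q) := by
  have h1 := elX_mul_inv p q
  have h2 := elXinv_mul p q
  simp only [delta, sub_mul, mul_sub, add_mul, mul_add, h1, h2]
  abel

theorem deltaB_sq : deltaB p q * deltaB p q = delta p q * delta p q := by
  rw [delta_sq, trace_eq]
  have h1 : BH.of (genB p q) * BH.of (genB p q)⁻¹ = 1 := by simp [← map_mul]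
  have h2 : BH.of (genB p q)⁻¹ * BH.of (genB p q) = 1 := by simp [← map_mul]
  simp only [deltaB, sub_mul, mul_sub, add_mul, mul_add, h1, h2]
  abel

theorem delta_sq_mem_center : delta p q * delta p q ∈ Subalgebra.center ℂ (H p q) := by
  rw [delta_sq]
  exact Subalgebra.sub_mem _
    (Subalgebra.mul_mem _ (BH.add_inv_mem_center _) (BH.add_inv_mem_center _))
    (Subalgebra.nsmul_mem _ (Subalgebra.one_mem _) _)

theorem cross_mem_center :
    delta p q * deltaB p q + deltaB p q * delta p q ∈ Subalgebra.center ℂ (H p q) := by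
  set a := genA p q
  set b := genB p q
  have key : delta p q * deltaB p q + deltaB p q * delta p q =
      (BH.of (a * b) + BH.of (a * b)⁻¹) + (BH.of (b * a) + BH.of (b * a)⁻¹)
        - (BH.of (a * b⁻¹) + BH.of (a * b⁻¹)⁻¹) - (BH.of (a⁻¹ * b) + BH.of (a⁻¹ * b)⁻¹) := by
    simp only [mul_inv_rev, inv_inv, map_mul, delta, deltaB, elX, elXinv, sub_mul, mul_sub]
    abel
  rw [key]
  exact Subalgebra.sub_mem _ (Subalgebra.sub_mem _ (Subalgebra.add_mem _
    (BH.add_inv_mem_center _) (BH.add_inv_mem_center _)) (BH.add_inv_mem_center _))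
    (BH.add_inv_mem_center _)

theorem qi_sq_mem_center : qi p q * qi p q ∈ Subalgebra.center ℂ (H p q) := by
  have key : qi p q * qi p q = (1 / 4 : ℂ) • (delta p q * delta p q + delta p q * delta p q
      - (delta p q * deltaB p q + deltaB p q * delta p q)) := by
    rw [qi, smul_mul_smul_comm, sub_mul, mul_sub, mul_sub, deltaB_sq]
    norm_num
    abel_nf
  rw [key]
  exact Subalgebra.smul_mem _ (Subalgebra.sub_mem _ (Subalgebra.add_mem _
    (delta_sq_mem_center p q) (delta_sq_mem_center p q)) (cross_mem_center p q)) _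

theorem qj_sq_mem_center : qj p q * qj p q ∈ Subalgebra.center ℂ (H p q) := by
  have key : qj p q * qj p q = (1 / 4 : ℂ) • (delta p q * delta p q + delta p q * delta p q
      + (delta p q * deltaB p q + deltaB p q * delta p q)) := by
    rw [qj, smul_mul_smul_comm, add_mul, mul_add, mul_add, deltaB_sq]
    norm_num
    abel_nf
  rw [key]
  exact Subalgebra.smul_mem _ (Subalgebra.add_mem _ (Subalgebra.add_mem _
    (delta_sq_mem_center p q) (delta_sq_mem_center p q)) (cross_mem_center p q)) _

/-- Evaluation `ℂ[x, I, J] → H` (with values in the centre) at `x`, `I = i²`, `J = j²`; the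
variables `0`, `1`, `2` are `x`, `I`, `J`. -/
def evalXIJ : MvPolynomial (Fin 3) ℂ →ₐ[ℂ] Subalgebra.center ℂ (H p q) :=
  MvPolynomial.aeval ![⟨qx p q, qx_mem_center p q⟩, ⟨qi p q * qi p q, qi_sq_mem_center p q⟩,
    ⟨qj p q * qj p q, qj_sq_mem_center p q⟩]

/-- A polynomial in `I`, `J` (the variables `0`, `1`) as a polynomial in `x`, `I`, `J`. -/
def toXIJ (Q : MvPolynomial (Fin 2) ℂ) : MvPolynomial (Fin 3) ℂ :=
  MvPolynomial.rename Fin.succ Q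

/-- The polynomial `I + J - 4 (x² - 1)`. -/
def relXIJ : MvPolynomial (Fin 3) ℂ :=
  MvPolynomial.X 1 + MvPolynomial.X 2 - 4 * (MvPolynomial.X 0 ^ 2 - 1)

/-- The ideal `⟨I Q, I + J - 4 (x² - 1)⟩`. -/
def idealIQ (Q : MvPolynomial (Fin 2) ℂ) : Ideal (MvPolynomial (Fin 3) ℂ) :=
  Ideal.span {MvPolynomial.X 1 * toXIJ Q, relXIJ}

/-- The ideal `⟨Q, I + J - 4 (x² - 1)⟩`. -/
def idealQ (Q : MvPolynomial (Fin 2) ℂ) : Ideal (MvPolynomial (Fin 3) ℂ) :=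
  Ideal.span {toXIJ Q, relXIJ}

/-- `Q(I, J)` is the defining polynomial of the Brumfiel-Hilden algebra of `K(p, q)`: it has
degree `(p-1)/2`, the `*`-invariants are `H⁺ = ℂ[x, I, J] / ⟨I Q, I + J - 4 (x² - 1)⟩`, and
`H = H⁺ ⊕ H̄⁺ i ⊕ H⁺ j ⊕ H̄⁺ k` with `k = i j` and
`H̄⁺ = ℂ[x, I, J] / ⟨Q, I + J - 4 (x² - 1)⟩`. This determines `Q` up to a nonzero scalar. -/
structure IsBHPolynomial (Q : MvPolynomial (Fin 2) ℂ) : Prop where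
  totalDegree_eq : Q.totalDegree = (p - 1) / 2
  invariants : ∀ h : H p q, BH.conj h = h ↔ ∃ f, (evalXIJ p q f : H p q) = h
  span : ∀ h : H p q, ∃ f₀ f₁ f₂ f₃, h = evalXIJ p q f₀ + evalXIJ p q f₁ * qi p q +
    evalXIJ p q f₂ * qj p q + evalXIJ p q f₃ * (qi p q * qj p q)
  relations : ∀ f₀ f₁ f₂ f₃, (evalXIJ p q f₀ : H p q) + evalXIJ p q f₁ * qi p q +
      evalXIJ p q f₂ * qj p q + evalXIJ p q f₃ * (qi p q * qj p q) = 0 ↔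
    f₀ ∈ idealIQ Q ∧ f₁ ∈ idealQ Q ∧ f₂ ∈ idealIQ Q ∧ f₃ ∈ idealQ Q

/-- The element of `H` given by a polynomial in `I`, `J`. -/
def elQ (Q : MvPolynomial (Fin 2) ℂ) : H p q := evalXIJ p q (toXIJ Q)

/-- The subalgebra `H⁺[X^{±1}]` of `H` generated by the `*`-invariants and `X^{±1}`. -/
def HplusX : Subalgebra ℂ (H p q) :=
  Algebra.adjoin ℂ ({h | BH.conj h = h} ∪ {elX p q, elXinv p q})

/-! ### The localization `H[δ⁻¹]` -/

theorem delta_pow_comm (n : ℕ) (r : H p q) :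
    delta p q ^ (n + n) * r = r * delta p q ^ (n + n) := by
  have h := (Subalgebra.center ℂ (H p q)).pow_mem (delta_sq_mem_center p q) n
  rw [← two_mul, pow_mul, pow_two]
  exact (Subalgebra.mem_center_iff.1 h r).symm

/-- The powers of `δ` form an Ore set, because `δ²` is central. -/
instance : OreLocalization.OreSet (Submonoid.powers (delta p q)) where
  ore_right_cancel r₁ r₂ s h := by
    obtain ⟨_, n, rfl⟩ := s
    refine ⟨⟨delta p q ^ (n + n), n + n, rfl⟩, ?_⟩
    change delta p q ^ (n + n) * r₁ = delta p q ^ (n + n) * r₂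
    change r₁ * delta p q ^ n = r₂ * delta p q ^ n at h
    rw [delta_pow_comm, delta_pow_comm, pow_add, ← mul_assoc, h, mul_assoc]
  oreNum r s := r * s
  oreDenom _ s := s * s
  ore_eq r s := by
    obtain ⟨_, n, rfl⟩ := s
    change (delta p q ^ n * delta p q ^ n) * r = r * delta p q ^ n * delta p q ^ n
    rw [← pow_add, delta_pow_comm, pow_add, mul_assoc]

/-- The localization `H[δ⁻¹]`. -/
def HLoc : Type := OreLocalization (Submonoid.powers (delta p q)) (H p q)

instance : Ring (HLoc p q) :=
  inferInstanceAs (Ring (OreLocalization (Submonoid.powers (delta p q)) (H p q)))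
instance : Algebra ℂ (HLoc p q) :=
  inferInstanceAs (Algebra ℂ (OreLocalization (Submonoid.powers (delta p q)) (H p q)))

/-- The canonical homomorphism `H → H[δ⁻¹]`. -/
def toLoc : H p q →ₐ[ℂ] HLoc p q where
  __ := (OreLocalization.numeratorRingHom :
    H p q →+* OreLocalization (Submonoid.powers (delta p q)) (H p q))
  commutes' _ := rfl

/-- `δ` as a unit of `H[δ⁻¹]`. -/
def deltaUnit : (HLoc p q)ˣ :=
  OreLocalization.numeratorUnit (⟨delta p q, Submonoid.mem_powers _⟩ :
    Submonoid.powers (delta p q))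

/-- `δ⁻¹ ∈ H[δ⁻¹]`. -/
def deltaInv : HLoc p q := ((deltaUnit p q)⁻¹ : (HLoc p q)ˣ)

theorem deltaInv_mul : deltaInv p q * toLoc p q (delta p q) = 1 := (deltaUnit p q).inv_mul

theorem mul_deltaInv : toLoc p q (delta p q) * deltaInv p q = 1 := (deltaUnit p q).mul_inv

theorem conj_delta : BH.starHom (delta p q) = -MulOpposite.op (delta p q) := by
  have h1 : BH.starHom (elX p q) = MulOpposite.op (elXinv p q) :=
    congrArg MulOpposite.op (BH.conj_of (genA p q))
  have h2 : BH.starHom (elXinv p q) = MulOpposite.op (elX p q) := by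
    have := congrArg MulOpposite.op (BH.conj_of (genA p q)⁻¹)
    rw [inv_inv] at this
    exact this
  rw [delta, map_sub, h1, h2, ← MulOpposite.op_sub, ← MulOpposite.op_neg, neg_sub]

/-- The anti-homomorphism `h ↦ h*` from `H` to `H[δ⁻¹]`. -/
def preStarLoc : H p q →+* (HLoc p q)ᵐᵒᵖ :=
  (toLoc p q).toRingHom.op.comp (BH.starHom (G := KnotGroup p q)).toRingHom

/-- `δ* = -δ` as a unit of the opposite ring. -/
def negDeltaUnit : ((HLoc p q)ᵐᵒᵖ)ˣ := -Units.opEquiv.symm (MulOpposite.op (deltaUnit p q))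

theorem preStarLoc_delta : preStarLoc p q (delta p q) = negDeltaUnit p q := by
  change MulOpposite.op (toLoc p q (BH.starHom (delta p q)).unop) = _
  rw [conj_delta, MulOpposite.unop_neg, map_neg]
  rfl

theorem isUnit_preStarLoc (s : Submonoid.powers (delta p q)) :
    IsUnit (preStarLoc p q s) := by
  obtain ⟨_, n, rfl⟩ := s
  change IsUnit (preStarLoc p q (delta p q ^ n))
  rw [map_pow, preStarLoc_delta]
  exact (negDeltaUnit p q).isUnit.pow n

/-- The extension of `*` to `H[δ⁻¹]`, as a homomorphism to the opposite ring. -/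
def starHomLoc : HLoc p q →+* (HLoc p q)ᵐᵒᵖ :=
  OreLocalization.universalHom (preStarLoc p q)
    (IsUnit.liftRight ((preStarLoc p q).toMonoidHom.comp (Submonoid.powers (delta p q)).subtype)
      (isUnit_preStarLoc p q)) (fun _ => rfl)

/-- The canonical anti-involution of `H[δ⁻¹]`, extending the one of `H`. -/
def conjLoc (z : HLoc p q) : HLoc p q := (starHomLoc p q z).unop

theorem conjLoc_toLoc (h : H p q) : conjLoc p q (toLoc p q h) = toLoc p q (BH.conj h) :=
  congrArg MulOpposite.unop (OreLocalization.universalHom_commutes (preStarLoc p q) _ _)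

/-! ### The fractional ideal `M` -/

/-- Evaluation `ℂ[X^{±1}] → H` of Laurent polynomials at `X`. -/
def evalX : ℂ[T;T⁻¹] →ₐ[ℂ] H p q :=
  AddMonoidAlgebra.lift ℂ (H p q) ℤ (BH.of.comp (zpowersHom _ (genA p q)))

/-- `ℂ[X^{±1}]` acts on `H[δ⁻¹]` by left multiplication. -/
instance : Module ℂ[T;T⁻¹] (HLoc p q) :=
  Module.compHom (HLoc p q) ((toLoc p q).comp (evalX p q)).toRingHom

theorem smul_def' (f : ℂ[T;T⁻¹]) (z : HLoc p q) : f • z = toLoc p q (evalX p q f) * z := rfl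

instance : IsScalarTower ℂ ℂ[T;T⁻¹] (HLoc p q) where
  smul_assoc c f z := by rw [smul_def', smul_def', map_smul, map_smul, smul_mul_assoc]

theorem evalX_T (n : ℤ) : evalX p q (LaurentPolynomial.T n) = BH.of (genA p q ^ n) := by
  simp only [evalX, LaurentPolynomial.T]
  rw [AddMonoidAlgebra.lift_single, one_smul]
  rfl

theorem evalX_mem (f : ℂ[T;T⁻¹]) : evalX p q f ∈ HplusX p q := by
  have hX : elX p q ∈ HplusX p q := Algebra.subset_adjoin (by simp)
  have hXi : elXinv p q ∈ HplusX p q := Algebra.subset_adjoin (by simp)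
  have hT : ∀ n : ℤ, evalX p q (LaurentPolynomial.T n) ∈ HplusX p q := by
    intro n
    rw [evalX_T]
    obtain ⟨m, rfl | rfl⟩ := n.eq_nat_or_neg
    · rw [zpow_natCast, map_pow]
      exact Subalgebra.pow_mem _ hX m
    · rw [zpow_neg, zpow_natCast, ← inv_pow, map_pow]
      exact Subalgebra.pow_mem _ hXi m
  induction f using LaurentPolynomial.induction_on' with
  | add f g hf hg => rw [map_add]; exact Subalgebra.add_mem _ hf hg
  | C_mul_T n a =>
    rw [← LaurentPolynomial.smul_eq_C_mul, map_smul]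
    exact Subalgebra.smul_mem _ (hT n) a

variable (Q : MvPolynomial (Fin 2) ℂ)

/-- `Q δ⁻¹ ∈ H[δ⁻¹]`. -/
def Qdelta : HLoc p q := toLoc p q (elQ p q Q) * deltaInv p q

/-- `M = H⁺[X^{±1}] + H⁺[X^{±1}] Q δ⁻¹ ⊆ H[δ⁻¹]`. -/
def M : Submodule ℂ[T;T⁻¹] (HLoc p q) where
  carrier := {m | ∃ u ∈ HplusX p q, ∃ v ∈ HplusX p q,
    m = toLoc p q u + toLoc p q v * Qdelta p q Q}
  zero_mem' := ⟨0, Subalgebra.zero_mem _, 0, Subalgebra.zero_mem _, by simp⟩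
  add_mem' := by
    rintro _ _ ⟨u, hu, v, hv, rfl⟩ ⟨u', hu', v', hv', rfl⟩
    refine ⟨u + u', Subalgebra.add_mem _ hu hu', v + v', Subalgebra.add_mem _ hv hv', ?_⟩
    rw [map_add, map_add, add_mul]
    abel
  smul_mem' := by
    rintro f _ ⟨u, hu, v, hv, rfl⟩
    refine ⟨evalX p q f * u, Subalgebra.mul_mem _ (evalX_mem p q f) hu,
      evalX p q f * v, Subalgebra.mul_mem _ (evalX_mem p q f) hv, ?_⟩
    rw [smul_def', map_mul, map_mul, mul_add, mul_assoc]

theorem Qdelta_mem : Qdelta p q Q ∈ M p q Q :=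
  ⟨0, Subalgebra.zero_mem _, 1, Subalgebra.one_mem _, by simp⟩

/-- `M₀ = ℂ[X^{±1}] Q δ⁻¹`, as a submodule of `M`. -/
def M₀ : Submodule ℂ[T;T⁻¹] (M p q Q) :=
  Submodule.span ℂ[T;T⁻¹] {(⟨Qdelta p q Q, Qdelta_mem p q Q⟩ : M p q Q)}

/-- `M̄ = M / M₀`. -/
abbrev Mbar : Type := M p q Q ⧸ M₀ p q Q

end Knot

/-! ### The double affine Hecke algebra of type `C^∨ C₁` -/

/-- The four generators. -/
inductive DahaGen
  | T0 | T0v | T1 | T1v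

/-- The defining relations. -/
inductive DahaRel (q t₁ t₂ t₃ t₄ : ℂ) :
    FreeAlgebra ℂ DahaGen → FreeAlgebra ℂ DahaGen → Prop
  | T0 : DahaRel q t₁ t₂ t₃ t₄
      ((FreeAlgebra.ι ℂ DahaGen.T0 - algebraMap ℂ _ t₁) *
        (FreeAlgebra.ι ℂ DahaGen.T0 + algebraMap ℂ _ t₁⁻¹)) 0
  | T0v : DahaRel q t₁ t₂ t₃ t₄
      ((FreeAlgebra.ι ℂ DahaGen.T0v - algebraMap ℂ _ t₂) *
        (FreeAlgebra.ι ℂ DahaGen.T0v + algebraMap ℂ _ t₂⁻¹)) 0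
  | T1 : DahaRel q t₁ t₂ t₃ t₄
      ((FreeAlgebra.ι ℂ DahaGen.T1 - algebraMap ℂ _ t₃) *
        (FreeAlgebra.ι ℂ DahaGen.T1 + algebraMap ℂ _ t₃⁻¹)) 0
  | T1v : DahaRel q t₁ t₂ t₃ t₄
      ((FreeAlgebra.ι ℂ DahaGen.T1v - algebraMap ℂ _ t₄) *
        (FreeAlgebra.ι ℂ DahaGen.T1v + algebraMap ℂ _ t₄⁻¹)) 0
  | prod : DahaRel q t₁ t₂ t₃ t₄
      (FreeAlgebra.ι ℂ DahaGen.T1v * FreeAlgebra.ι ℂ DahaGen.T1 *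
        FreeAlgebra.ι ℂ DahaGen.T0 * FreeAlgebra.ι ℂ DahaGen.T0v) (algebraMap ℂ _ q)

/-- The algebra `H_{q, t₁, t₂, t₃, t₄}`. -/
abbrev Daha (q t₁ t₂ t₃ t₄ : ℂ) : Type := RingQuot (DahaRel q t₁ t₂ t₃ t₄)

/-- The generators of `H_{q, t₁, t₂, t₃, t₄}`. -/
def dahaGen (q t₁ t₂ t₃ t₄ : ℂ) (g : DahaGen) : Daha q t₁ t₂ t₃ t₄ :=
  RingQuot.mkAlgHom ℂ (DahaRel q t₁ t₂ t₃ t₄) (FreeAlgebra.ι ℂ g)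

/-! ### Modules over `ℂ[X^{±1}, Y^{±1}] ⋊ ℤ/2` and their localizations -/

/-- The involution `X ↦ X⁻¹` of `ℂ[X^{±1}]`. -/
abbrev inv : ℂ[T;T⁻¹] →+* ℂ[T;T⁻¹] :=
  (LaurentPolynomial.invert (R := ℂ)).toAlgHom.toRingHom

/-- The structure of a module over `ℂ[X^{±1}, Y^{±1}] ⋊ ℤ/2` on a `ℂ[X^{±1}]`-module: an
invertible operator `Y` commuting with `X` and an involution `s` with `s X s = X⁻¹` and
`s Y s = Y⁻¹`. -/
structure TorusModule (V : Type) [AddCommGroup V] [Module ℂ[T;T⁻¹] V] where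
  Y : V ≃ₗ[ℂ[T;T⁻¹]] V
  s : V →ₛₗ[inv] V
  s_s : ∀ v, s (s v) = v
  s_Y : ∀ v, s (Y v) = Y.symm (s v)

/-- The sign representation: `ℂ[X^{±1}]` with `Y · f = f` and `s · f = -f(X⁻¹)`. -/
def signRep : TorusModule ℂ[T;T⁻¹] where
  Y := LinearEquiv.refl _ _
  s :=
    { toFun := fun f => -inv f
      map_add' := fun f g => by rw [map_add, neg_add]
      map_smul' := fun f g => by simp }
  s_s f := by
    change -inv (-inv f) = f
    rw [map_neg, neg_neg]
    exact LaurentPolynomial.involutive_invert f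
  s_Y _ := rfl

/-- `V^loc`: the localization of a `ℂ[X^{±1}]`-module at all nonzero Laurent polynomials. -/
abbrev Loc (V : Type) [AddCommGroup V] [Module ℂ[T;T⁻¹] V] : Type :=
  LocalizedModule (nonZeroDivisors ℂ[T;T⁻¹]) V

/-- The canonical map `V → V^loc`. -/
def toVLoc (V : Type) [AddCommGroup V] [Module ℂ[T;T⁻¹] V] : V →ₗ[ℂ[T;T⁻¹]] Loc V :=
  LocalizedModule.mkLinearMap _ V

/-- The field `ℂ(X)` acting on the localizations. -/
abbrev RatX : Type := FractionRing ℂ[T;T⁻¹]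

/-- The rational function `f / (X - X⁻¹)`. -/
def overDelta (f : ℂ[T;T⁻¹]) : RatX :=
  algebraMap ℂ[T;T⁻¹] RatX f /
    algebraMap ℂ[T;T⁻¹] RatX (LaurentPolynomial.T 1 - LaurentPolynomial.T (-1))

theorem inv_mem_nonZeroDivisors (f : nonZeroDivisors ℂ[T;T⁻¹]) :
    inv (f : ℂ[T;T⁻¹]) ∈ nonZeroDivisors ℂ[T;T⁻¹] := by
  rw [mem_nonZeroDivisors_iff_ne_zero]
  have h := nonZeroDivisors.coe_ne_zero f
  intro h0
  exact h ((map_eq_zero_iff _ (LaurentPolynomial.invert (R := ℂ)).injective).1 h0)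

/-- The localization `v / f ↦ g v / σ f` of a `σ`-semilinear map `g`. -/
def locMap {V : Type} [AddCommGroup V] [Module ℂ[T;T⁻¹] V] (σ : ℂ[T;T⁻¹] →+* ℂ[T;T⁻¹])
    (hσ : ∀ f : nonZeroDivisors ℂ[T;T⁻¹], σ f ∈ nonZeroDivisors ℂ[T;T⁻¹]) (g : V →ₛₗ[σ] V) :
    Loc V →ₛₗ[σ] Loc V where
  toFun z := LocalizedModule.liftOn z
    (fun v => LocalizedModule.mk (g v.1) ⟨σ v.2, hσ v.2⟩) (by
      rintro ⟨v, f⟩ ⟨v', f'⟩ ⟨u, hu⟩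
      refine LocalizedModule.mk_eq.2 ⟨⟨σ u, hσ u⟩, ?_⟩
      have h := congrArg g hu
      simp only [Submonoid.smul_def, map_smulₛₗ] at h ⊢
      exact h)
  map_add' z z' := by
    induction z using LocalizedModule.induction_on with | _ v f
    induction z' using LocalizedModule.induction_on with | _ v' f'
    rw [LocalizedModule.mk_add_mk, LocalizedModule.liftOn_mk, LocalizedModule.liftOn_mk,
      LocalizedModule.liftOn_mk, LocalizedModule.mk_add_mk]
    refine LocalizedModule.mk_eq.2 ⟨1, ?_⟩
    simp only [Submonoid.smul_def, map_add, map_smulₛₗ, Submonoid.coe_mul, map_mul]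
  map_smul' r z := by
    induction z using LocalizedModule.induction_on with | _ v f
    rw [LocalizedModule.smul'_mk, LocalizedModule.liftOn_mk, LocalizedModule.liftOn_mk,
      LocalizedModule.smul'_mk, map_smulₛₗ]

theorem locMap_mk {V : Type} [AddCommGroup V] [Module ℂ[T;T⁻¹] V]
    (σ : ℂ[T;T⁻¹] →+* ℂ[T;T⁻¹])
    (hσ : ∀ f : nonZeroDivisors ℂ[T;T⁻¹], σ f ∈ nonZeroDivisors ℂ[T;T⁻¹]) (g : V →ₛₗ[σ] V)
    (v : V) (f : nonZeroDivisors ℂ[T;T⁻¹]) :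
    locMap σ hσ g (LocalizedModule.mk v f) = LocalizedModule.mk (g v) ⟨σ f, hσ f⟩ := by
  simp only [locMap, LinearMap.coe_mk, AddHom.coe_mk, LocalizedModule.liftOn_mk]

/-- The module structure induced on the localization:
`Y (v / f) = (Y v) / f` and `s (v / f) = (s v) / f(X⁻¹)`. -/
def TorusModule.loc {V : Type} [AddCommGroup V] [Module ℂ[T;T⁻¹] V] (𝓥 : TorusModule V) :
    TorusModule (Loc V) where
  Y := LinearEquiv.ofLinearMap
    (locMap (RingHom.id _) (fun f => f.2) 𝓥.Y.toLinearMap)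
    (locMap (RingHom.id _) (fun f => f.2) 𝓥.Y.symm.toLinearMap)
    (by
      ext z
      induction z using LocalizedModule.induction_on with | _ v f
      simp [locMap_mk])
    (by
      ext z
      induction z using LocalizedModule.induction_on with | _ v f
      simp [locMap_mk])
  s := locMap inv inv_mem_nonZeroDivisors 𝓥.s
  s_s z := by
    induction z using LocalizedModule.induction_on with | _ v f
    rw [locMap_mk, locMap_mk, 𝓥.s_s]
    congr 1
    exact Subtype.ext (LaurentPolynomial.involutive_invert (f : ℂ[T;T⁻¹]))
  s_Y z := by
    induction z using LocalizedModule.induction_on with | _ v f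
    change locMap inv inv_mem_nonZeroDivisors 𝓥.s
        (locMap (RingHom.id _) (fun f => f.2) 𝓥.Y.toLinearMap _) =
      locMap (RingHom.id _) (fun f => f.2) 𝓥.Y.symm.toLinearMap
        (locMap inv inv_mem_nonZeroDivisors 𝓥.s _)
    rw [locMap_mk, locMap_mk, locMap_mk, locMap_mk]
    congr 1
    exact 𝓥.s_Y v

/-! ### The Dunkl-type operators -/

/-- `t̄ = t - t⁻¹`. -/
def bar (t : ℂ) : ℂ := t - t⁻¹

/-- The Laurent polynomial `t̄ X + ū`. -/
def coeffX (t u : ℂ) : ℂ[T;T⁻¹] :=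
  LaurentPolynomial.C (bar t) * LaurentPolynomial.T 1 + LaurentPolynomial.C (bar u)

/-- The Laurent polynomial `ū - t̄ X⁻¹`. -/
def coeffXinv (t u : ℂ) : ℂ[T;T⁻¹] :=
  LaurentPolynomial.C (bar u) - LaurentPolynomial.C (bar t) * LaurentPolynomial.T (-1)

section Operators

variable {V : Type} [AddCommGroup V] [Module ℂ[T;T⁻¹] V] (𝓥 : TorusModule V)

/-- The operator `-t s Y + f δ⁻¹ (1 + s Y)` on `V^loc`, where `δ = X - X⁻¹`. -/
def opT0 (t : ℂ) (f : ℂ[T;T⁻¹]) (z : Loc V) : Loc V :=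
  -(LaurentPolynomial.C t • 𝓥.loc.s (𝓥.loc.Y z)) + overDelta f • (z + 𝓥.loc.s (𝓥.loc.Y z))

/-- The operator `t s + f δ⁻¹ (1 - s)` on `V^loc`, where `δ = X - X⁻¹`. -/
def opT1 (t : ℂ) (f : ℂ[T;T⁻¹]) (z : Loc V) : Loc V :=
  LaurentPolynomial.C t • 𝓥.loc.s z + overDelta f • (z - 𝓥.loc.s z)

end Operators

/-- The operator `-t s Y + f δ⁻¹ (1 + s Y)` on `H[δ⁻¹]`, where `s` is the canonical
anti-involution. -/
def opT0H (p : ℕ) (q : ℤ) (t : ℂ) (f : ℂ[T;T⁻¹]) (z : HLoc p q) : HLoc p q :=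
  -(t • conjLoc p q (toLoc p q (elY p q) * z)) +
    f • (deltaInv p q * (z + conjLoc p q (toLoc p q (elY p q) * z)))

end TwoBridge

end

/-! The structure of `H` is read off from a quaternion algebra. Put `J = 4 (x² - 1) - I` in `R =
ℂ[x][I]`, and let `Quat` be the quaternion algebra over `R` with `i² = I`, `j² = J`. Then `x + (j ±
i)/2` have norm 1 and serve as `a` and `b`. On unit quaternions inversion is conjugation, so `g +
g⁻¹` is always a scalar, and `H` is the quotient of `Quat` by the single relation `a w = w b`. The
anti-automorphism `i ↦ -i`, `j ↦ j` interchanges `a` and `b` and fixes `w = v v̄`, so `w = P + S x j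
+ T k` has no `i`-component (`freeToQuat_palindrome`). Hence `a w - w b = Q i` with `Q = P - J T`
(`genQuat_mul_sub`), and the two-sided ideal of `Q i` is `⟨IQ⟩ ⊕ ⟨Q⟩ i ⊕ ⟨IQ⟩ j ⊕ ⟨Q⟩ k`
(`quatToH_eq_zero_iff`). As a polynomial in `I`, `Q` has degree `d` with a nonzero constant as
leading coefficient (`defPoly_hasTop`).

Since `δ = i + j`, the subalgebra `H⁺[X^{±1}]` is `ℂ[X^{±1}][I] / (IQ)` (`evLI_eq_zero_iff`). As `I`
kills `Q δ⁻¹`, the elements of `M` are `g + c Q δ⁻¹` with `g` in this ring and `c ∈ ℂ[X^{±1}]`, and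
division by `Q` yields the bases.

The heart of the matter is that `1 + sY` maps `M` into `δ M` (`coord_dunkl`). An explicit
computation of the longitude gives `1 + Y = δ u + Q v` (`exists_longitude`). Differences `g(X) -
g(X⁻¹)` are multiples of `δ`, and so is `Q h = δ (h Q δ⁻¹)` once `Q δ⁻¹` is adjoined. Modulo `M₀`,
the operator `1 - s` becomes divisible by `δ` as well (`exists_sub_s`).

The rest is formal. Let `σ` be a semilinear involution for which `1 + σ` is divisible by `δ`, and
consider `-t σ + f δ⁻¹ (1 + σ)`. It satisfies the quadratic relation when `f - f(X⁻¹) = t̄ δ`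
(`op_op`), and it commutes with multiplications up to divided differences (`op_mul_smul`). These two
facts amount to the Hecke relations at `q' = -1` (`exists_dahaRep`), with `σ = sY` for `T₀` and `σ =
-s` for `T₁`. -/

namespace TwoBridge

/-! ### The divided difference on Laurent polynomials -/

section Laurent

open LaurentPolynomial

/-- The Laurent polynomial `X - X⁻¹`. -/
noncomputable def laurentDelta : ℂ[T;T⁻¹] := T 1 - T (-1)

theorem inv_T (n : ℤ) : inv (T n) = T (-n) := invert_T n

theorem inv_C (t : ℂ) : inv (C t) = C t := invert_C t

theorem inv_inv_apply (f : ℂ[T;T⁻¹]) : inv (inv f) = f := involutive_invert f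

theorem inv_laurentDelta : inv laurentDelta = -laurentDelta := by
  rw [laurentDelta, map_sub, inv_T, inv_T, neg_neg, neg_sub]

theorem laurentDelta_ne_zero : laurentDelta ≠ 0 := by
  intro h
  have h1 := congrArg (fun f : ℂ[T;T⁻¹] => f.coeff 1) h
  simp [laurentDelta] at h1

/-- By linearity only `X^n - X^{-n}` matters, and this is handled by an induction in steps of two.
-/
theorem exists_dividedDifference (f : ℂ[T;T⁻¹]) : ∃ g, laurentDelta * g = f - inv f := by
  have key : ∀ n : ℕ, ∃ g, laurentDelta * g = T (n : ℤ) - T (-(n : ℤ)) := by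
    intro n
    induction n using Nat.strong_induction_on with | _ n ih
    match n with
    | 0 => exact ⟨0, by simp⟩
    | 1 => exact ⟨1, by simp [laurentDelta]⟩
    | n + 2 =>
      obtain ⟨g, hg⟩ := ih n (by omega)
      -- `δ (X^{n+1} + X^{-(n+1)})` is the difference of `X^{n+2} - X^{-(n+2)}` and `X^n - X^{-n}`.
      refine ⟨g + T (n + 1) + T (-(n + 1)), ?_⟩
      rw [mul_add, mul_add, hg]
      simp only [laurentDelta, sub_mul, ← T_add]
      push_cast
      ring_nf
  induction f using LaurentPolynomial.induction_on' with
  | add f g hf hg =>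
    obtain ⟨f', hf⟩ := hf
    obtain ⟨g', hg⟩ := hg
    exact ⟨f' + g', by rw [mul_add, hf, hg, map_add]; ring⟩
  | C_mul_T n a =>
    obtain ⟨m, rfl | rfl⟩ := n.eq_nat_or_neg
    · obtain ⟨g, hg⟩ := key m
      exact ⟨C a * g, by rw [mul_left_comm, hg, map_mul, inv_T, inv_C]; ring⟩
    · obtain ⟨g, hg⟩ := key m
      exact ⟨-(C a * g), by rw [mul_neg, mul_left_comm, hg, map_mul, inv_T, inv_C, neg_neg]; ring⟩

/-- The divided difference `(f(X) - f(X⁻¹)) / (X - X⁻¹)`. -/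
noncomputable def divDiff (f : ℂ[T;T⁻¹]) : ℂ[T;T⁻¹] := (exists_dividedDifference f).choose

theorem laurentDelta_mul_divDiff (f : ℂ[T;T⁻¹]) : laurentDelta * divDiff f = f - inv f :=
  (exists_dividedDifference f).choose_spec

/-- Numerator and denominator both change sign under `X ↦ X⁻¹`. -/
theorem inv_divDiff (f : ℂ[T;T⁻¹]) : inv (divDiff f) = divDiff f := by
  apply mul_left_cancel₀ laurentDelta_ne_zero
  have h := congrArg inv (laurentDelta_mul_divDiff f)
  rw [map_mul, map_sub, inv_laurentDelta, inv_inv_apply] at h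
  linear_combination -h - laurentDelta_mul_divDiff f

/-- This is the hypothesis of `op_op`. It depends on `t` alone, which leaves `u` free as a further
Hecke parameter. -/
theorem coeffX_sub_inv (t u : ℂ) :
    coeffX t u - inv (coeffX t u) = C (bar t) * laurentDelta := by
  simp only [coeffX, map_add, map_mul, inv_T, inv_C, laurentDelta]
  ring

theorem coeffXinv_sub_inv (t u : ℂ) :
    coeffXinv t u - inv (coeffXinv t u) = C (bar t) * laurentDelta := by
  simp only [coeffXinv, map_sub, map_mul, inv_T, inv_C, laurentDelta, neg_neg]
  ring

end Laurent

/-! ### Dunkl-type operators on torsion-free modules -/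

section Dunkl

/-- An `X ↦ X⁻¹`-semilinear involution `σ` such that `1 + σ` is divisible by `X - X⁻¹` as an
operator. -/
structure DunklDatum (V : Type) [AddCommGroup V] [Module ℂ[T;T⁻¹] V] where
  σ : V →ₛₗ[inv] V
  D : V → V
  σ_σ : ∀ v, σ (σ v) = v
  delta_smul_D : ∀ v, laurentDelta • D v = v + σ v
  torsionFree : ∀ v : V, laurentDelta • v = 0 → v = 0

namespace DunklDatum

theorem smul_cancel {V : Type} [AddCommGroup V] [Module ℂ[T;T⁻¹] V] (𝓓 : DunklDatum V) {v w : V}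
    (h : laurentDelta • v = laurentDelta • w) : v = w :=
  sub_eq_zero.1 (𝓓.torsionFree _ (by rw [smul_sub, h, sub_self]))

theorem delta_smul_smul {V : Type} [AddCommGroup V] [Module ℂ[T;T⁻¹] V]
    (𝓓 : DunklDatum V) (f : ℂ[T;T⁻¹]) (v : V) :
    laurentDelta • f • 𝓓.D v = f • v + f • 𝓓.σ v := by
  rw [smul_comm, delta_smul_D, smul_add]

end DunklDatum

variable {V : Type} [AddCommGroup V] [Module ℂ[T;T⁻¹] V] [Module ℂ V] [IsScalarTower ℂ ℂ[T;T⁻¹] V]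

theorem C_smul (t : ℂ) (v : V) : (LaurentPolynomial.C t : ℂ[T;T⁻¹]) • v = t • v := by
  rw [LaurentPolynomial.C_eq_algebraMap, algebraMap_smul]

namespace DunklDatum

variable (𝓓 : DunklDatum V)

/-- The operator `-t σ + f (X - X⁻¹)⁻¹ (1 + σ)`. -/
noncomputable def op (t : ℂ) (f : ℂ[T;T⁻¹]) : Module.End ℂ V where
  toFun v := -(t • 𝓓.σ v) + f • 𝓓.D v
  map_add' v w := by
    have h : 𝓓.D (v + w) = 𝓓.D v + 𝓓.D w := by
      apply 𝓓.smul_cancel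
      rw [smul_add, delta_smul_D, delta_smul_D, delta_smul_D, map_add]
      abel
    rw [h, map_add, smul_add, smul_add]
    abel
  map_smul' r v := by
    have h : 𝓓.D (r • v) = r • 𝓓.D v := by
      apply 𝓓.smul_cancel
      rw [← C_smul r v, ← C_smul r (𝓓.D v), smul_comm, delta_smul_D, delta_smul_D, map_smulₛₗ,
        inv_C, smul_add]
    have h' : 𝓓.σ (r • v) = r • 𝓓.σ v := by rw [← C_smul, map_smulₛₗ, inv_C, C_smul]
    rw [h, h', RingHom.id_apply, smul_add, smul_neg, smul_comm t r, ← C_smul r (𝓓.D v),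
      smul_comm f, C_smul]

theorem op_apply (t : ℂ) (f : ℂ[T;T⁻¹]) (v : V) :
    𝓓.op t f v = -(t • 𝓓.σ v) + f • 𝓓.D v := rfl

/-- Multiplication by a Laurent polynomial. -/
noncomputable def mulOp (f : ℂ[T;T⁻¹]) : Module.End ℂ V := Algebra.lsmul ℂ ℂ V f

/-- Clearing the denominator turns identities between such operators into identities between Laurent
combinations of `v` and `σ v`; torsion-freeness allows the return. -/
theorem delta_smul_op (t : ℂ) (f : ℂ[T;T⁻¹]) (v : V) : laurentDelta • 𝓓.op t f v =
    f • v + (f - laurentDelta * LaurentPolynomial.C t) • 𝓓.σ v := by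
  rw [op_apply, smul_add, delta_smul_smul, ← C_smul]
  module

/-- The operator has the form `α + β σ` with `α = f/δ`. Moving `g` across `σ` replaces it by
`g(X⁻¹)`, and the part `α` leaves the error `α (g - g(X⁻¹))`, which is `f` times a divided
difference. -/
theorem op_mul_smul (t : ℂ) (f g : ℂ[T;T⁻¹]) (v : V) :
    𝓓.op t f (g • v) = inv g • 𝓓.op t f v + (f * divDiff g) • v := by
  apply 𝓓.smul_cancel
  rw [smul_add, smul_comm _ (inv g), delta_smul_op, delta_smul_op, map_smulₛₗ]
  have h := laurentDelta_mul_divDiff g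
  match_scalars
  · linear_combination -f * h
  · ring

/-- Write the operator as `α + (α - t) σ` with `α = f/δ`, and let a prime denote `X ↦ X⁻¹`. The
hypothesis `hf` says `α + α' = t - t⁻¹`. In the square, the coefficient of `σ` is therefore `(t -
t⁻¹)(α - t)`. The scalar part is `α² + (α - t)(α' - t) = α² - (α - t)(α + t⁻¹) = (t - t⁻¹) α + 1`.
-/
theorem op_op (t : ℂ) (f : ℂ[T;T⁻¹])
    (hf : f - inv f = LaurentPolynomial.C (bar t) * laurentDelta) (ht : t ≠ 0) (v : V) :
    𝓓.op t f (𝓓.op t f v) = bar t • 𝓓.op t f v + v := by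
  -- The square has denominator `δ²`, so `δ` is cancelled twice.
  apply 𝓓.smul_cancel
  apply 𝓓.smul_cancel
  have h1 : laurentDelta • 𝓓.σ (𝓓.op t f v) =
      (-inv f - laurentDelta * LaurentPolynomial.C t) • v - inv f • 𝓓.σ v := by
    have h := congrArg 𝓓.σ (𝓓.delta_smul_op t f v)
    rw [map_smulₛₗ, map_add, map_smulₛₗ, map_smulₛₗ, inv_laurentDelta, 𝓓.σ_σ, map_sub, map_mul,
      inv_laurentDelta, inv_C] at h
    rw [← neg_inj, ← neg_smul, h]
    module
  have h2 : inv f = f - LaurentPolynomial.C (bar t) * laurentDelta := by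
    rw [← hf]; ring
  have h3 : (LaurentPolynomial.C (bar t) : ℂ[T;T⁻¹]) * LaurentPolynomial.C t =
      LaurentPolynomial.C t * LaurentPolynomial.C t - 1 := by
    rw [← map_mul, ← map_mul, bar, sub_mul, inv_mul_cancel₀ ht, map_sub, map_one]
  rw [delta_smul_op, smul_add, smul_comm _ f, delta_smul_op, smul_comm laurentDelta, h1, h2,
    ← C_smul (bar t), smul_add laurentDelta, smul_comm _ (LaurentPolynomial.C (bar t)),
    delta_smul_op]
  match_scalars
  · linear_combination -(laurentDelta ^ 2) * h3
  · ring

end DunklDatum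

end Dunkl

/-! ### Representations of the double affine Hecke algebra -/

section Daha

/-- By the quadratic relations `E₀` and `E₁` are invertible with inverses `E - t̄`. Put `T₀^∨ = E₀⁻¹
Z₀` and `T₁^∨ = Z₁ E₁⁻¹`: then the product relation telescopes to `Z₁ Z₀ = -1`. Since `Z₁` and `-Z₀`
play the role of inverses, the quadratic relations for `T₀^∨` and `T₁^∨`, in the form `T - T⁻¹ =
t̄`, are the linear conditions `hc₀` and `hc₁`. -/
theorem exists_dahaRep {E : Type*} [Ring E] [Algebra ℂ E] {t₁ t₂ t₃ t₄ : ℂ}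
    (h₁ : t₁ ≠ 0) (h₂ : t₂ ≠ 0) (h₃ : t₃ ≠ 0) (h₄ : t₄ ≠ 0) {E₀ E₁ Z₀ Z₁ : E}
    (hZ : Z₁ * Z₀ = -1)
    (hE₀ : E₀ * E₀ = bar t₁ • E₀ + 1) (hE₁ : E₁ * E₁ = bar t₃ • E₁ + 1)
    (hc₀ : (E₀ - bar t₁ • 1) * Z₀ + Z₁ * E₀ = bar t₂ • 1)
    (hc₁ : Z₁ * (E₁ - bar t₃ • 1) + E₁ * Z₀ = bar t₄ • 1) :
    ∃ ρ : Daha (-1) t₁ t₂ t₃ t₄ →ₐ[ℂ] E,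
      ρ (dahaGen _ _ _ _ _ .T0) = E₀ ∧
      ρ (dahaGen _ _ _ _ _ .T0v) = (E₀ - bar t₁ • 1) * Z₀ ∧
      ρ (dahaGen _ _ _ _ _ .T1) = E₁ ∧
      ρ (dahaGen _ _ _ _ _ .T1v) = Z₁ * (E₁ - bar t₃ • 1) := by
  have quad : ∀ (t : ℂ), t ≠ 0 → ∀ e : E, e * e = bar t • e + 1 →
      (e - algebraMap ℂ E t) * (e + algebraMap ℂ E t⁻¹) = 0 := by
    intro t ht e he
    rw [sub_mul, mul_add, mul_add, he, ← map_mul, mul_inv_cancel₀ ht, map_one,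
      ← Algebra.commutes t⁻¹ e, ← Algebra.smul_def, ← Algebra.smul_def, bar]
    module
  have e0 : (E₀ - bar t₁ • 1) * E₀ = 1 := by rw [sub_mul, hE₀]; simp
  have e0' : E₀ * (E₀ - bar t₁ • 1) = 1 := by rw [mul_sub, hE₀]; simp
  have e1 : (E₁ - bar t₃ • 1) * E₁ = 1 := by rw [sub_mul, hE₁]; simp
  have e1' : E₁ * (E₁ - bar t₃ • 1) = 1 := by rw [mul_sub, hE₁]; simp
  let gen : DahaGen → E := fun
    | .T0 => E₀
    | .T0v => (E₀ - bar t₁ • 1) * Z₀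
    | .T1 => E₁
    | .T1v => Z₁ * (E₁ - bar t₃ • 1)
  have hT0v : gen .T0v * gen .T0v = bar t₂ • gen .T0v + 1 := by
    change (E₀ - bar t₁ • 1) * Z₀ * ((E₀ - bar t₁ • 1) * Z₀) = _
    rw [eq_sub_of_add_eq hc₀, sub_mul, smul_one_mul, sub_eq_add_neg,
      ← eq_sub_of_add_eq hc₀, mul_assoc, ← mul_assoc E₀, e0', one_mul, hZ, neg_neg]
  have hT1v : gen .T1v * gen .T1v = bar t₄ • gen .T1v + 1 := by
    change Z₁ * (E₁ - bar t₃ • 1) * (Z₁ * (E₁ - bar t₃ • 1)) = _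
    nth_rewrite 2 [eq_sub_of_add_eq hc₁]
    rw [mul_sub, mul_smul_one, sub_eq_add_neg, mul_assoc, ← mul_assoc _ E₁, e1, one_mul, hZ,
      neg_neg]
  have hprod : gen .T1v * gen .T1 * gen .T0 * gen .T0v = algebraMap ℂ E (-1) := by
    change Z₁ * (E₁ - bar t₃ • 1) * E₁ * E₀ * ((E₀ - bar t₁ • 1) * Z₀) = _
    rw [mul_assoc Z₁, e1, mul_one, mul_assoc, ← mul_assoc E₀, e0', one_mul, hZ, map_neg, map_one]
  refine ⟨RingQuot.liftAlgHom ℂ ⟨FreeAlgebra.lift ℂ gen, ?_⟩, ?_, ?_, ?_, ?_⟩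
  · rintro _ _ (_ | _ | _ | _ | _)
    · simpa using quad t₁ h₁ _ hE₀
    · simpa using quad t₂ h₂ _ hT0v
    · simpa using quad t₃ h₃ _ hE₁
    · simpa using quad t₄ h₄ _ hT1v
    · simpa using hprod
  all_goals
    rw [dahaGen, RingQuot.liftAlgHom_mkAlgHom_apply, FreeAlgebra.lift_ι_apply]

/-- Reduces invariance of a subspace under the whole Hecke algebra to the four generators. -/
theorem daha_induction {q t₁ t₂ t₃ t₄ : ℂ} {E : Type*} [Ring E] [Algebra ℂ E]
    (ρ : Daha q t₁ t₂ t₃ t₄ →ₐ[ℂ] E) (S : Subalgebra ℂ E)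
    (hS : ∀ g, ρ (dahaGen _ _ _ _ _ g) ∈ S) (h : Daha q t₁ t₂ t₃ t₄) : ρ h ∈ S := by
  obtain ⟨x, rfl⟩ := RingQuot.mkAlgHom_surjective ℂ (DahaRel q t₁ t₂ t₃ t₄) h
  induction x using FreeAlgebra.induction with
  | grade0 r => rw [AlgHom.commutes, AlgHom.commutes]; exact S.algebraMap_mem r
  | grade1 g => exact hS g
  | mul a b ha hb => rw [map_mul, map_mul]; exact S.mul_mem ha hb
  | add a b ha hb => rw [map_add, map_add]; exact S.add_mem ha hb

end Daha

/-! ### The generic quaternion algebra -/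

section Quaternion

open Polynomial

/-- The ring `ℂ[x][I]`. -/
abbrev XIRing : Type := Polynomial (Polynomial ℂ)

/-- The variable `x`. -/
noncomputable def xR : XIRing := C X

/-- The variable `I`. -/
noncomputable def iR : XIRing := X

/-- The element `J = 4 (x² - 1) - I`. -/
noncomputable def jR : XIRing := C (4 * (X ^ 2 - 1)) - X

/-- The constant `1 / 2`. -/
noncomputable def halfR : XIRing := algebraMap ℂ XIRing (1 / 2)

theorem two_mul_halfR : 2 * halfR = 1 := by
  rw [halfR, ← map_ofNat (algebraMap ℂ XIRing) 2, ← map_mul]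
  norm_num

theorem jR_eq : jR = 4 * (xR ^ 2 - 1) - iR := by
  simp only [jR, xR, iR, map_mul, map_sub, map_pow, map_one, map_ofNat]

/-- The quaternion algebra over `ℂ[x][I]` with `i² = I`, `j² = J`. -/
abbrev Quat : Type := QuaternionAlgebra XIRing iR 0 jR

/-- The homomorphism `ℂ[x, I, J] → ℂ[x][I]` with kernel generated by `I + J - 4 (x² - 1)`. -/
noncomputable def xijToR : MvPolynomial (Fin 3) ℂ →ₐ[ℂ] XIRing := MvPolynomial.aeval ![xR, iR, jR]

/-- The homomorphism `ℂ[I, J] → ℂ[x][I]`. -/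
noncomputable def ijToR : MvPolynomial (Fin 2) ℂ →ₐ[ℂ] XIRing := MvPolynomial.aeval ![iR, jR]

theorem xijToR_toXIJ (Q : MvPolynomial (Fin 2) ℂ) : xijToR (toXIJ Q) = ijToR Q := by
  rw [xijToR, toXIJ, MvPolynomial.aeval_rename, ijToR]
  congr 2

theorem xijToR_X0 : xijToR (MvPolynomial.X 0) = xR := by simp [xijToR]
theorem xijToR_X1 : xijToR (MvPolynomial.X 1) = iR := by simp [xijToR]
theorem xijToR_X2 : xijToR (MvPolynomial.X 2) = jR := by simp [xijToR]

theorem xijToR_rel : xijToR relXIJ = 0 := by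
  simp only [relXIJ, map_sub, map_add, map_mul, map_pow, xijToR_X0, xijToR_X1, xijToR_X2, map_one,
    map_ofNat, jR_eq]
  ring

/-- The section of `xijToR`. -/
noncomputable def rToXIJ : XIRing →+* MvPolynomial (Fin 3) ℂ :=
  eval₂RingHom (aeval (R := ℂ) (MvPolynomial.X 0 : MvPolynomial (Fin 3) ℂ)).toRingHom
    (MvPolynomial.X 1)

theorem xijToR_rToXIJ (f : XIRing) : xijToR (rToXIJ f) = f := by
  have h : xijToR.toRingHom.comp rToXIJ = RingHom.id _ := by
    ext <;> simp [rToXIJ, xijToR_X0, xijToR_X1, xR, iR]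
  exact RingHom.congr_fun h f

/-- Modulo the relation, the retraction onto polynomials in `x`, `I` agrees with the identity on the
three variables; only `J` needs the relation. -/
theorem rToXIJ_xijToR_sub_mem (f : MvPolynomial (Fin 3) ℂ) :
    f - rToXIJ (xijToR f) ∈ Ideal.span {relXIJ} := by
  rw [← Ideal.Quotient.eq]
  have hJ : Ideal.Quotient.mk (Ideal.span {relXIJ}) (MvPolynomial.X 2) =
      Ideal.Quotient.mk (Ideal.span {relXIJ})
        (4 * (MvPolynomial.X 0 ^ 2 - 1) - MvPolynomial.X 1) := by
    rw [Ideal.Quotient.eq]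
    convert Ideal.mem_span_singleton_self relXIJ using 1
    rw [relXIJ]; ring
  have h : (Ideal.Quotient.mkₐ ℂ (Ideal.span {relXIJ})).toRingHom =
      (Ideal.Quotient.mkₐ ℂ (Ideal.span {relXIJ})).toRingHom.comp
        (rToXIJ.comp xijToR.toRingHom) := by
    refine MvPolynomial.ringHom_ext ?_ ?_
    · intro r
      have h1 : xijToR (MvPolynomial.C r) = C (C r) := by
        simp [xijToR]
      change _ = Ideal.Quotient.mk _ (rToXIJ (xijToR (MvPolynomial.C r)))
      rw [h1]
      simp only [rToXIJ, coe_eval₂RingHom, eval₂_C]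
      change _ = Ideal.Quotient.mk _ (aeval (MvPolynomial.X 0 : MvPolynomial (Fin 3) ℂ) (C r))
      rw [aeval_C]
      rfl
    · intro n
      fin_cases n
      · simp [xijToR_X0, rToXIJ, xR]
      · simp [xijToR_X1, rToXIJ, iR]
      · simp only [Fin.reduceFinMk, RingHom.comp_apply]
        change _ = Ideal.Quotient.mk _ (rToXIJ (xijToR (MvPolynomial.X 2)))
        rw [xijToR_X2]
        refine hJ.trans ?_
        rw [jR_eq]
        simp only [map_mul, map_sub, map_pow, map_one, map_ofNat]
        simp [xR, iR, rToXIJ]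
  exact RingHom.congr_fun h f

/-- Eliminating `J` turns membership in both ideals of the theorem into divisibility in the domain
`ℂ[x][I]`. -/
theorem mem_span_pair_rel_iff (g f : MvPolynomial (Fin 3) ℂ) :
    f ∈ Ideal.span {g, relXIJ} ↔ xijToR g ∣ xijToR f := by
  constructor
  · intro h
    obtain ⟨a, b, rfl⟩ := Ideal.mem_span_pair.1 h
    rw [map_add, map_mul, map_mul, xijToR_rel, mul_zero, add_zero]
    exact Dvd.intro_left _ rfl
  · rintro ⟨c, hc⟩
    have hle : Ideal.span {relXIJ} ≤ Ideal.span {g, relXIJ} :=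
      Ideal.span_mono (by simp)
    have h1 := hle (rToXIJ_xijToR_sub_mem (f - g * rToXIJ c))
    rw [map_sub, map_mul, xijToR_rToXIJ, hc, sub_self, map_zero, sub_zero] at h1
    have h2 : g * rToXIJ c ∈ Ideal.span {g, relXIJ} :=
      Ideal.mul_mem_right _ _ (Ideal.subset_span (by simp))
    simpa using Ideal.add_mem _ h1 h2

theorem mem_idealQ_iff (Q : MvPolynomial (Fin 2) ℂ) (f : MvPolynomial (Fin 3) ℂ) :
    f ∈ idealQ Q ↔ ijToR Q ∣ xijToR f := by
  rw [idealQ, mem_span_pair_rel_iff, xijToR_toXIJ]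

theorem mem_idealIQ_iff (Q : MvPolynomial (Fin 2) ℂ) (f : MvPolynomial (Fin 3) ℂ) :
    f ∈ idealIQ Q ↔ iR * ijToR Q ∣ xijToR f := by
  rw [idealIQ, mem_span_pair_rel_iff, map_mul, xijToR_X1, xijToR_toXIJ]

/-- The quaternions spelled by the generators `a` and `b` of the free group. -/
noncomputable def genQuat (n : Fin 2) : unitary Quat :=
  ⟨if n = 0 then ⟨xR, halfR, halfR, 0⟩ else ⟨xR, -halfR, halfR, 0⟩, by
    have h := two_mul_halfR
    rw [Unitary.mem_iff]
    split_ifs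
    -- The norm of either element is `x² - (I + J)/4`, which is 1 by the definition of `J`.
    all_goals
      constructor <;> apply QuaternionAlgebra.ext <;> simp [jR_eq] <;> grind⟩

/-- The homomorphism from the free group to the unit quaternions. -/
noncomputable def freeToQuat : FreeGroup (Fin 2) →* unitary Quat := FreeGroup.lift genQuat

/-- The sign attached to a letter: `1` for `a` and `-1` for `b`. -/
def letterSign (n : Fin 2) : ℤ := if n = 0 then 1 else -1

/-- Inversion is conjugation and negates both `i` and `j`, while exchanging `a` and `b` negates only
`i`. A single formula then covers all four syllables. -/
theorem freeToQuat_syllable (n : Fin 2) (e : ℤ) (he : e = 1 ∨ e = -1) :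
    (freeToQuat (FreeGroup.of n ^ e) : Quat) =
      ⟨xR, (e * letterSign n : ℤ) * halfR, (e : XIRing) * halfR, 0⟩ := by
  rw [map_zpow, freeToQuat, FreeGroup.lift_apply_of]
  rcases he with rfl | rfl
  · rw [zpow_one]
    fin_cases n <;> simp [genQuat, letterSign] <;> ring
  · rw [zpow_neg_one, ← Unitary.star_eq_inv, Unitary.coe_star]
    fin_cases n <;> apply QuaternionAlgebra.ext <;> simp [genQuat, letterSign] <;> ring

end Quaternion

/-! ### The quaternion spelled by the word `w` -/

section Word

open MvPolynomial

/-- Coordinates of a quaternion `P + S x j + T k`. -/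
structure PalTriple where
  P : MvPolynomial (Fin 2) ℂ
  S : MvPolynomial (Fin 2) ℂ
  T : MvPolynomial (Fin 2) ℂ

/-- The quaternion `P + S x j + T k`. -/
noncomputable def PalTriple.toQuat (c : PalTriple) : Quat :=
  ⟨ijToR c.P, 0, xR * ijToR c.S, ijToR c.T⟩

/-- The coordinates of the palindromic word `l l̄`. -/
noncomputable def palTriple : List (Fin 2 × ℤ) → PalTriple
  | [] => ⟨1, 0, 0⟩
  | c :: l =>
    let ε : MvPolynomial (Fin 2) ℂ := (letterSign c.1 : ℤ)
    let e : MvPolynomial (Fin 2) ℂ := (c.2 : ℤ)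
    let h : MvPolynomial (Fin 2) ℂ := C (1 / 2)
    let t := palTriple l
    ⟨t.P * (1 + h * X 1) + e * (1 + h ^ 2 * (X 0 + X 1)) * X 1 * t.S + ε * h * X 0 * X 1 * t.T,
      e * t.P + (1 + h * (X 0 + X 1)) * t.S + e * ε * X 0 * t.T,
      ε * h * t.P + e * ε * (1 + h ^ 2 * (X 0 + X 1)) * t.S + (1 + h * X 0) * t.T⟩

/-- The words all of whose exponents are `±1`. -/
def IsSignWord (l : List (Fin 2 × ℤ)) : Prop := ∀ c ∈ l, c.2 = 1 ∨ c.2 = -1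

theorem spell_cons (c : Fin 2 × ℤ) (l : List (Fin 2 × ℤ)) :
    spell (c :: l) = FreeGroup.of c.1 ^ c.2 * spell l := by simp [spell]

theorem spell_palindrome_cons (c : Fin 2 × ℤ) (l : List (Fin 2 × ℤ)) :
    spell (c :: l ++ switchRev (c :: l)) = FreeGroup.of c.1 ^ c.2 * spell (l ++ switchRev l) *
      FreeGroup.of (1 - c.1) ^ c.2 := by
  simp [switchRev, spell, mul_assoc]

theorem ijToR_X0 : ijToR (X 0) = iR := by simp [ijToR]
theorem ijToR_X1 : ijToR (X 1) = jR := by simp [ijToR]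
theorem ijToR_half : ijToR (C (1 / 2)) = halfR := by
  rw [← MvPolynomial.algebraMap_eq, AlgHom.commutes, halfR]

/-- Passing from `l l̄` to a word with one more syllable `c` in front multiplies by `c` on the left
and by its mirror image, the syllable with the other letter, on the right. Elements without
`i`-component are those fixed by the anti-automorphism `i ↦ -i`, `j ↦ j`, which exchanges these two
factors. Hence the shape survives. -/
theorem quat_sandwich {R : Type*} [CommRing R] {x y z h ε e P S T : R} (hh : 2 * h = 1)
    (hε : ε ^ 2 = 1) (he : e ^ 2 = 1) (hx : x ^ 2 = 1 + h ^ 2 * (y + z)) :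
    (⟨x, e * ε * h, e * h, 0⟩ * ⟨P, 0, x * S, T⟩ * ⟨x, -(e * ε) * h, e * h, 0⟩ :
      QuaternionAlgebra R y 0 z) =
    ⟨P * (1 + h * z) + e * (1 + h ^ 2 * (y + z)) * z * S + ε * h * y * z * T, 0,
      x * (e * P + (1 + h * (y + z)) * S + e * ε * y * T),
      ε * h * P + e * ε * (1 + h ^ 2 * (y + z)) * S + (1 + h * y) * T⟩ := by
  simp only [QuaternionAlgebra.mk_mul_mk, QuaternionAlgebra.mk.injEq]
  refine ⟨?_, ?_, ?_, ?_⟩ <;> grind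

/-- Besides the missing `i`-component there is a parity statement. The automorphism negating `x`,
`i`, `j` sends `a`, `b` to `-a`, `-b` and fixes words of even length. So the coordinates at `1` and
`k` are even in `x`, the one at `j` is odd, and all are expressed through polynomials in `I` and `J`
alone. -/
theorem freeToQuat_palindrome (l : List (Fin 2 × ℤ)) (hl : IsSignWord l) :
    (freeToQuat (spell (l ++ switchRev l)) : Quat) = (palTriple l).toQuat := by
  induction l with
  | nil =>
    ext <;> simp [spell, switchRev, palTriple, PalTriple.toQuat]
  | cons c l ih =>
    have hc := hl c (by simp)
    have h := two_mul_halfR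
    rw [spell_palindrome_cons, map_mul, map_mul, Submonoid.coe_mul, Submonoid.coe_mul,
      freeToQuat_syllable _ _ hc, freeToQuat_syllable _ _ hc, ih fun c hc => hl c (by simp [hc])]
    obtain ⟨n, e⟩ := c
    have hn : letterSign (1 - n) = -letterSign n := by
      fin_cases n <;> simp [letterSign]
    have hs : ((letterSign n : ℤ) : XIRing) ^ 2 = 1 := by
      fin_cases n <;> simp [letterSign]
    have he : ((e : ℤ) : XIRing) ^ 2 = 1 := by
      rcases hc with hc | hc <;> simp only at hc <;> subst hc <;> simp
    have hN : xR ^ 2 = 1 + halfR ^ 2 * (iR + jR) := by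
      rw [jR_eq]
      linear_combination (-2 * halfR - 1) * (xR ^ 2 - 1) * h
    simp only [hn, Int.cast_mul, Int.cast_neg, mul_neg]
    rw [PalTriple.toQuat, quat_sandwich h hs he hN]
    simp only [palTriple, PalTriple.toQuat, map_add, map_mul, map_intCast, map_one, map_pow,
      ijToR_X0, ijToR_X1, ijToR_half]

end Word

/-! ### The defining polynomial -/

section DefPoly

open MvPolynomial

/-- A palindrome `l l̄` read backwards is the palindrome of `l` with its letters exchanged; this
makes `w̃` accessible to `freeToQuat_palindrome`. -/
theorem switchRev_map_switch (l : List (Fin 2 × ℤ)) :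
    (l ++ switchRev l).reverse = l.map (fun c => (1 - c.1, c.2)) ++
      switchRev (l.map fun c => (1 - c.1, c.2)) := by
  have h : (fun c : Fin 2 × ℤ => (1 - (1 - c.1), c.2)) = id := by
    funext c
    simp
  simp only [switchRev, List.reverse_append, List.map_reverse, List.reverse_reverse, List.map_map,
    Function.comp_def]
  rw [h, List.map_id]

/-- Exchanging `a` and `b` is the automorphism `i ↦ -i`, `j ↦ j`, hence `k ↦ -k`. -/
theorem palTriple_switch (l : List (Fin 2 × ℤ)) :
    palTriple (l.map fun c => (1 - c.1, c.2)) =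
      ⟨(palTriple l).P, (palTriple l).S, -(palTriple l).T⟩ := by
  induction l with
  | nil => simp [palTriple]
  | cons c l ih =>
    have hn : letterSign (1 - c.1) = -letterSign c.1 := by
      obtain ⟨n, e⟩ := c
      fin_cases n <;> simp [letterSign]
    rw [List.map_cons, palTriple, palTriple, ih]
    simp only [hn, PalTriple.mk.injEq, Int.cast_neg]
    refine ⟨?_, ?_, ?_⟩ <;> ring

/-- The polynomial `P - J T`. -/
noncomputable def PalTriple.poly (c : PalTriple) : MvPolynomial (Fin 2) ℂ := c.P - X 1 * c.T

/-- With `a = x + j/2 + i/2` and `b = x + j/2 - i/2`, the difference is `[j, w]/2 + (i w + w i)/2`.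
The commutator only sees `T k` and gives `-J T i`; the anticommutator only sees `P` and gives `P i`.
-/
theorem genQuat_mul_sub (c : PalTriple) :
    (genQuat 0 : Quat) * c.toQuat - c.toQuat * (genQuat 1 : Quat) = ⟨0, ijToR c.poly, 0, 0⟩ := by
  have h := two_mul_halfR
  simp only [genQuat, PalTriple.toQuat, PalTriple.poly, map_sub, map_mul, ijToR_X1,
    one_ne_zero, if_true, if_false, QuaternionAlgebra.mk_mul_mk, QuaternionAlgebra.mk_sub_mk,
    QuaternionAlgebra.mk.injEq]
  refine ⟨?_, ?_, ?_, ?_⟩ <;> grind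

/-- The real part of `w* w = 1`. -/
theorem palTriple_norm (l : List (Fin 2 × ℤ)) (hl : IsSignWord l) :
    ijToR (palTriple l).P ^ 2 - jR * xR ^ 2 * ijToR (palTriple l).S ^ 2 +
      iR * jR * ijToR (palTriple l).T ^ 2 = 1 := by
  have h := Unitary.coe_star_mul_self (freeToQuat (spell (l ++ switchRev l)))
  rw [freeToQuat_palindrome l hl] at h
  have h1 := congrArg QuaternionAlgebra.re h
  simp [PalTriple.toQuat] at h1
  linear_combination h1

/-! ### Degrees of `P`, `S`, `T` and of `Q` -/

theorem palTriple_totalDegree (c : Fin 2 × ℤ) (l : List (Fin 2 × ℤ)) :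
    (palTriple (c :: l)).P.totalDegree ≤ l.length + 1 ∧
    (palTriple (c :: l)).S.totalDegree ≤ l.length ∧
    (palTriple (c :: l)).T.totalDegree ≤ l.length := by
  have hX : ∀ n, (X n : MvPolynomial (Fin 2) ℂ).totalDegree ≤ 1 := fun n => by
    rw [totalDegree_X]
  have hC : ∀ r : ℂ, (C r : MvPolynomial (Fin 2) ℂ).totalDegree ≤ 0 := fun n => by
    rw [totalDegree_C]
  have hZ : ∀ n : ℤ, ((n : ℤ) : MvPolynomial (Fin 2) ℂ).totalDegree ≤ 0 := fun n => by
    rw [← map_intCast (C : ℂ →+* MvPolynomial (Fin 2) ℂ)]; exact hC _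
  have h1 : (1 : MvPolynomial (Fin 2) ℂ).totalDegree ≤ 0 := by rw [totalDegree_one]
  have hadd : ∀ {n} {f g : MvPolynomial (Fin 2) ℂ}, f.totalDegree ≤ n → g.totalDegree ≤ n →
      (f + g).totalDegree ≤ n := fun hf hg => (totalDegree_add _ _).trans (max_le hf hg)
  have hmul : ∀ {m n k} {f g : MvPolynomial (Fin 2) ℂ}, f.totalDegree ≤ m → g.totalDegree ≤ n →
      m + n ≤ k → (f * g).totalDegree ≤ k := fun hf hg h =>
    (totalDegree_mul _ _).trans ((add_le_add hf hg).trans h)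
  have hN : (1 + C (1 / 2) ^ 2 * (X 0 + X 1) : MvPolynomial (Fin 2) ℂ).totalDegree ≤ 1 := by
    rw [← map_pow]
    exact hadd (h1.trans (by simp)) (hmul (hC _) (hadd (hX _) (hX _)) le_rfl)
  have hL : ∀ n, (1 + C (1 / 2) * X n : MvPolynomial (Fin 2) ℂ).totalDegree ≤ 1 := fun n =>
    hadd (h1.trans (by simp)) (hmul (hC _) (hX _) le_rfl)
  have hM : (1 + C (1 / 2) * (X 0 + X 1) : MvPolynomial (Fin 2) ℂ).totalDegree ≤ 1 :=
    hadd (h1.trans (by simp)) (hmul (hC _) (hadd (hX _) (hX _)) le_rfl)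
  induction l generalizing c with
  | nil =>
    simp only [palTriple, mul_zero, add_zero, one_mul, mul_one]
    exact ⟨hL 1, hZ _, hmul (hZ _) (hC _) le_rfl⟩
  | cons c' l ih =>
    obtain ⟨hP, hS, hT⟩ := ih c'
    rw [palTriple]
    generalize palTriple (c' :: l) = t at *
    rw [List.length_cons]
    refine ⟨hadd (hadd (hmul hP (hL 1) (by omega))
      (hmul (hmul (hmul (hZ _) hN le_rfl) (hX 1) le_rfl) hS (by omega)))
      (hmul (hmul (hmul (hmul (hZ _) (hC _) le_rfl) (hX 0) le_rfl) (hX 1) le_rfl) hT (by omega)),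
      hadd (hadd (hmul (hZ _) hP (by omega)) (hmul hM hS (by omega)))
      (hmul (hmul (hmul (hZ _) (hZ _) le_rfl) (hX 0) le_rfl) hT (by omega)),
      hadd (hadd (hmul (hmul (hZ _) (hC _) le_rfl) hP (by omega))
      (hmul (hmul (hmul (hZ _) (hZ _) le_rfl) hN le_rfl) hS (by omega)))
      (hmul (hL 0) hT (by omega))⟩

/-- The polynomial `f` has degree at most `n`, with coefficient `c` of `X ^ n`. -/
def HasTop (f : XIRing) (n : ℕ) (c : Polynomial ℂ) : Prop := f.natDegree ≤ n ∧ f.coeff n = c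

namespace HasTop

variable {f g : XIRing} {m n : ℕ} {c c' : Polynomial ℂ}

theorem add (hf : HasTop f n c) (hg : HasTop g n c') : HasTop (f + g) n (c + c') :=
  ⟨Polynomial.natDegree_add_le_of_degree_le hf.1 hg.1, by
    rw [Polynomial.coeff_add, hf.2, hg.2]⟩

theorem mul (hf : HasTop f m c) (hg : HasTop g n c') : HasTop (f * g) (m + n) (c * c') :=
  ⟨Polynomial.natDegree_mul_le_of_le hf.1 hg.1, by
    rw [Polynomial.coeff_mul_add_eq_of_natDegree_le hf.1 hg.1, hf.2, hg.2]⟩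

theorem raise (hf : HasTop f n c) : HasTop f (n + 1) 0 :=
  ⟨hf.1.trans n.le_succ, Polynomial.coeff_eq_zero_of_natDegree_lt (Nat.lt_succ_of_le hf.1)⟩

theorem ofC (c : Polynomial ℂ) : HasTop (Polynomial.C c) 0 c :=
  ⟨by simp, Polynomial.coeff_C_zero⟩

theorem congr {n' : ℕ} (hf : HasTop f n c) (hn : n = n') (hc : c = c') : HasTop f n' c' :=
  hn ▸ hc ▸ hf

end HasTop

theorem hasTop_iR : HasTop iR 1 1 := ⟨Polynomial.natDegree_X_le, Polynomial.coeff_X_one⟩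

theorem hasTop_jR : HasTop jR 1 (-1) := by
  refine ⟨?_, ?_⟩
  · exact Polynomial.natDegree_sub_le_of_le ((Polynomial.natDegree_C _).le.trans zero_le_one)
      Polynomial.natDegree_X_le
  · rw [jR, Polynomial.coeff_sub, Polynomial.coeff_X_one, Polynomial.coeff_C_of_ne_zero one_ne_zero,
      zero_sub]

/-- After elimination of `J` the sum `I + J` has degree 0 in `I`, so `S` does not influence the top
coefficients of `P` and `T`. Each further letter feeds two contributions into the top of `P`, and
two into that of `T`. They are equal because the letters alternate; for a repeated letter they would
cancel. The sign attached to `T` records this as the induction invariant. -/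
theorem palTriple_hasTop (c : Fin 2 × ℤ) (l : List (Fin 2 × ℤ))
    (hl : (c :: l).IsChain fun c c' => c'.1 = 1 - c.1) :
    ∃ r : ℂ, r ≠ 0 ∧ HasTop (ijToR (palTriple (c :: l)).P) (l.length + 1) (Polynomial.C r) ∧
      (∃ s, HasTop (ijToR (palTriple (c :: l)).S) l.length s) ∧
      HasTop (ijToR (palTriple (c :: l)).T) l.length
        (-(letterSign c.1 : ℤ) * Polynomial.C r) := by
  have hZ : ∀ n : ℤ, HasTop ((n : ℤ) : XIRing) 0 (n : ℤ) := fun n => by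
    rw [← map_intCast (Polynomial.C : Polynomial ℂ →+* XIRing)]; exact HasTop.ofC _
  have h1 : HasTop 1 0 1 := by simpa using hZ 1
  have hh : HasTop halfR 0 (Polynomial.C (1 / 2)) := HasTop.ofC _
  have hx : HasTop (1 + halfR ^ 2 * (iR + jR)) 0 (Polynomial.X ^ 2) := by
    have h := two_mul_halfR
    have h2 : 1 + halfR ^ 2 * (iR + jR) = Polynomial.C (Polynomial.X ^ 2) := by
      rw [map_pow]
      change _ = xR ^ 2
      rw [jR_eq]
      linear_combination (2 * halfR + 1) * (xR ^ 2 - 1) * h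
    rw [h2]
    exact HasTop.ofC _
  have hm : HasTop (1 + halfR * (iR + jR)) 0
      (1 + Polynomial.C (1 / 2) * (4 * (Polynomial.X ^ 2 - 1))) := by
    have h2 : iR + jR = Polynomial.C (4 * (Polynomial.X ^ 2 - 1)) := by
      rw [jR, iR]; ring
    rw [h2]
    exact h1.add (hh.mul (HasTop.ofC _))
  induction l generalizing c with
  | nil =>
    refine ⟨-(1 / 2), by norm_num, ?_, ⟨(c.2 : ℤ), ?_⟩, ?_⟩ <;>
    simp only [palTriple, mul_zero, add_zero, one_mul, mul_one, map_add, map_mul, map_one,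
      ijToR_X1, ijToR_half, map_intCast]
    · exact (h1.raise.add (hh.mul hasTop_jR)).congr rfl (by simp)
    · exact hZ _
    · exact ((hZ _).mul hh).congr rfl (by simp)
  | cons c' l ih =>
    obtain ⟨r, hr, hP, ⟨s, hS⟩, hT⟩ := ih c' hl.tail
    have hc : c'.1 = 1 - c.1 := (List.isChain_cons_cons.1 hl).1
    have hs : letterSign c'.1 = -letterSign c.1 := by
      rw [hc]
      obtain ⟨n, e⟩ := c
      fin_cases n <;> simp [letterSign]
    have hsq : ((letterSign c.1 : ℤ) : Polynomial ℂ) ^ 2 = 1 := by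
      obtain ⟨n, e⟩ := c
      fin_cases n <;> simp [letterSign]
    have h2 : (2 : Polynomial ℂ) * Polynomial.C (1 / 2) = 1 := by
      rw [← map_ofNat Polynomial.C 2, ← map_mul]; norm_num
    rw [hs] at hT
    rw [palTriple, List.length_cons]
    generalize palTriple (c' :: l) = t at *
    simp only [map_add, map_mul, map_one, map_pow, ijToR_X0, ijToR_X1, ijToR_half, map_intCast]
    refine ⟨-r, neg_ne_zero.2 hr, ?_, ?_, ?_⟩
    · have hPa := hP.mul (h1.raise.add (hh.mul hasTop_jR))
      have hPb := ((((hZ c.2).mul hx).mul hasTop_jR).mul hS).raise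
      have hPc := (((((hZ (letterSign c.1)).mul hh).mul hasTop_iR).mul hasTop_jR).mul hT)
      refine ((hPa.add (hPb.congr (by omega) rfl)).add (hPc.congr (by omega) rfl)).congr
        rfl ?_
      push_cast
      rw [map_neg]
      linear_combination (-Polynomial.C r * Polynomial.C (1 / 2)) * hsq - Polynomial.C r * h2
    · have hSa := (hZ c.2).mul hP
      have hSb := (hm.mul hS).raise
      have hSc := (((hZ c.2).mul (hZ (letterSign c.1))).mul hasTop_iR).mul hT
      exact ⟨_, ((hSa.congr (by omega) rfl).add (hSb.congr (by omega) rfl)).add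
        (hSc.congr (by omega) rfl)⟩
    · have hTa := ((hZ (letterSign c.1)).mul hh).mul hP
      have hTb := ((((hZ c.2).mul (hZ (letterSign c.1))).mul hx).mul hS).raise
      have hTc := (h1.raise.add (hh.mul hasTop_iR)).mul hT
      refine (((hTa.congr (by omega) rfl).add (hTb.congr (by omega) rfl)).add
        (hTc.congr (by omega) rfl)).congr rfl ?_
      push_cast
      rw [map_neg]
      linear_combination (letterSign c.1 : Polynomial ℂ) * Polynomial.C r * h2

variable (p : ℕ) (q : ℤ)

/-- The polynomial `Q` of `K(p, q)`. -/
noncomputable def defPoly : MvPolynomial (Fin 2) ℂ := (palTriple (vWord p q)).poly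

variable {p q}

/-- A vanishing residue would give `p ∣ (n + 1) q`, so `p ∣ n + 1` by coprimality, although `0 < n +
1 < p`. -/
theorem expo_eq (hcop : IsCoprime (p : ℤ) q) {n : ℕ} (hn : n < (p - 1) / 2) :
    expo p q (n + 1) = 1 ∨ expo p q (n + 1) = -1 := by
  have h : Int.bmod (((n + 1 : ℕ) : ℤ) * q) (2 * p) ≠ 0 := by
    intro h
    have hd : ((2 * p : ℕ) : ℤ) ∣ ((n + 1 : ℕ) : ℤ) * q := Int.dvd_of_bmod_eq_zero h
    have hd' : (p : ℤ) ∣ ((n + 1 : ℕ) : ℤ) * q := Dvd.dvd.trans ⟨2, by push_cast; ring⟩ hd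
    have h1 : (p : ℤ) ∣ ((n + 1 : ℕ) : ℤ) := hcop.dvd_of_dvd_mul_right hd'
    have h2 := Nat.le_of_dvd n.succ_pos (Int.natCast_dvd_natCast.1 h1)
    omega
  rw [expo]
  rcases lt_or_gt_of_ne h with h | h
  · exact Or.inr (Int.sign_eq_neg_one_of_neg h)
  · exact Or.inl (Int.sign_eq_one_of_pos h)

theorem isSignWord_vWord (hcop : IsCoprime (p : ℤ) q) : IsSignWord (vWord p q) := by
  intro c hc
  obtain ⟨n, hn, rfl⟩ := List.mem_map.1 hc
  exact expo_eq hcop (List.mem_range.1 hn)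

theorem vWord_eq_cons (hp : 3 ≤ p) : ∃ e l, vWord p q = (1, e) :: l ∧ l.length + 1 = (p - 1) / 2 ∧
    (vWord p q).IsChain fun c c' => c'.1 = 1 - c.1 := by
  obtain ⟨d, hd⟩ : ∃ d, (p - 1) / 2 = d + 1 := ⟨(p - 1) / 2 - 1, by omega⟩
  refine ⟨expo p q 1, (List.map Nat.succ (List.range d)).map fun n =>
    (if n % 2 = 0 then 1 else 0, expo p q (n + 1)), ?_, ?_, ?_⟩
  · rw [vWord, hd, List.range_succ_eq_map, List.map_cons]
    rfl
  · rw [hd]; simp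
  · rw [List.isChain_iff_getElem]
    intro i hi
    simp only [vWord, List.getElem_map, List.getElem_range]
    split_ifs <;> omega

theorem defPoly_hasTop (hp : 3 ≤ p) :
    ∃ r : ℂ, r ≠ 0 ∧ HasTop (ijToR (defPoly p q)) ((p - 1) / 2) (Polynomial.C r) := by
  obtain ⟨e, l, h, hl, hc⟩ := vWord_eq_cons (q := q) hp
  rw [h] at hc
  obtain ⟨r, hr, hP, -, hT⟩ := palTriple_hasTop _ _ hc
  -- The word starts with `b`, so `T` has top coefficient `r`; since `-J` has top coefficient 1, the
  -- term `-J T` adds a second `r` to that of `P`.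
  refine ⟨2 * r, mul_ne_zero two_ne_zero hr, ?_⟩
  have hsub : ∀ a b c : XIRing, a - b * c = a + (-b) * c := fun a b c => by ring
  rw [defPoly, PalTriple.poly, h, map_sub, map_mul, ijToR_X1, hsub, ← hl]
  have hj : HasTop (-jR) 1 1 := ⟨by rw [Polynomial.natDegree_neg]; exact hasTop_jR.1, by
    rw [Polynomial.coeff_neg, hasTop_jR.2, neg_neg]⟩
  refine (hP.add ((hj.mul hT).congr (add_comm _ _) rfl)).congr rfl ?_
  simp [letterSign, two_mul]

theorem defPoly_totalDegree (hp : 3 ≤ p) : (defPoly p q).totalDegree = (p - 1) / 2 := by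
  obtain ⟨e, l, h, hl, hc⟩ := vWord_eq_cons (q := q) hp
  apply le_antisymm
  · obtain ⟨hP, -, hT⟩ := palTriple_totalDegree (1, e) l
    rw [defPoly, PalTriple.poly, h, ← hl]
    refine (totalDegree_sub _ _).trans (max_le hP ((totalDegree_mul _ _).trans ?_))
    rw [totalDegree_X]
    omega
  · obtain ⟨r, hr, ht⟩ := defPoly_hasTop (q := q) hp
    -- `I` and `J` are substituted by elements of degree at most 1 in `I`, so the degree cannot
    -- grow. The known degree after substitution bounds the total degree from below.
    have h1 : (ijToR (defPoly p q)).natDegree ≤ (defPoly p q).totalDegree := by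
      have h2 := aeval_natDegree_le (map Polynomial.C (defPoly p q)) 
        (Finset.sup_mono (support_map_subset _ _))
        ![iR, jR] (n := 1) (by
          intro i
          fin_cases i
          · exact hasTop_iR.1
          · exact hasTop_jR.1)
      rw [mul_one] at h2
      rwa [← Polynomial.algebraMap_eq, aeval_map_algebraMap] at h2
    refine le_trans (Polynomial.le_natDegree_of_ne_zero ?_) h1
    rw [ht.2]
    simpa using hr

end DefPoly

/-! ### Universal property of the Brumfiel-Hilden algebra -/

section Lift

variable {G : Type*} [Group G] {A : Type*} [Ring A] [Algebra ℂ A]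

/-- A monoid homomorphism for which all `φ h + φ h⁻¹` are central extends to `BH G`. -/
noncomputable def BH.lift (φ : G →* A) (hφ : ∀ g h, φ g * (φ h + φ h⁻¹) = (φ h + φ h⁻¹) * φ g) :
    BH G →ₐ[ℂ] A :=
  RingQuot.liftAlgHom ℂ ⟨MonoidAlgebra.lift ℂ A G φ, by
    rintro _ _ ⟨g, h⟩
    simpa using hφ g h⟩

theorem BH.lift_of (φ : G →* A) (hφ : ∀ g h, φ g * (φ h + φ h⁻¹) = (φ h + φ h⁻¹) * φ g) (g : G) :
    BH.lift φ hφ (BH.of g) = φ g := by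
  unfold BH.lift
  have : BH.of g = RingQuot.mkAlgHom ℂ (BHRel G) (MonoidAlgebra.of ℂ G g) := rfl
  rw [this]
  erw [RingQuot.liftAlgHom_mkAlgHom_apply]
  simp

theorem BH.induction {P : BH G → Prop} (of : ∀ g, P (BH.of g))
    (add : ∀ x y, P x → P y → P (x + y)) (smul : ∀ (r : ℂ) x, P x → P (r • x)) (h : BH G) :
    P h := by
  obtain ⟨y, rfl⟩ := RingQuot.mkAlgHom_surjective ℂ (BHRel G) h
  change P (BH.proj y)
  induction y using MonoidAlgebra.induction_on with
  | of g => exact of g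
  | add x y hx hy => rw [map_add]; exact add _ _ hx hy
  | smul r x hx => rw [map_smul]; exact smul _ _ hx

end Lift

/-! ### The generic quaternion algebra maps onto `H` -/

section ToH

variable (p : ℕ) (q : ℤ)

theorem qi_add_qj : qi p q + qj p q = delta p q := by
  rw [qi, qj, ← smul_add, sub_add_add_cancel, ← two_smul ℂ (delta p q), smul_smul]
  norm_num

theorem qj_sub_qi : qj p q - qi p q = deltaB p q := by
  rw [qi, qj, ← smul_sub, add_sub_sub_cancel, ← two_smul ℂ (deltaB p q), smul_smul]
  norm_num

/-- Expanding, `i j + j i` is a multiple of `δ² - (b - b⁻¹)²`, which vanishes because `a` and `b`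
have the same trace. -/
theorem qj_mul_qi : qj p q * qi p q = -(qi p q * qj p q) := by
  rw [qi, qj, smul_mul_smul_comm, smul_mul_smul_comm, ← smul_neg, add_mul, sub_mul, mul_sub,
    mul_sub, mul_add, mul_add, deltaB_sq]
  congr 1
  abel

theorem delta_sq_eq : delta p q * delta p q = 4 * (qx p q ^ 2 - 1) := by
  rw [delta_sq, qx, smul_pow, mul_sub, ← pow_two, nsmul_eq_mul, mul_one, Nat.cast_ofNat,
    mul_one]
  congr 1
  rw [← map_ofNat (algebraMap ℂ (H p q)) 4, ← Algebra.smul_def, smul_smul]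
  norm_num

theorem qi_sq_add_qj_sq : qi p q * qi p q + qj p q * qj p q = 4 * (qx p q ^ 2 - 1) := by
  rw [← delta_sq_eq, ← qi_add_qj, mul_add, add_mul, add_mul, qj_mul_qi]
  abel

/-- Evaluation `ℂ[x][I] → H` with values in the centre. -/
noncomputable def evR : XIRing →+* Subalgebra.center ℂ (H p q) :=
  Polynomial.eval₂RingHom
    (Polynomial.aeval (R := ℂ)
      (⟨qx p q, qx_mem_center p q⟩ : Subalgebra.center ℂ (H p q))).toRingHom
    ⟨qi p q * qi p q, qi_sq_mem_center p q⟩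

/-- Evaluation `ℂ[x][I] → H`. -/
noncomputable def evH : XIRing →+* H p q := (Subalgebra.center ℂ (H p q)).subtype.comp (evR p q)

theorem evH_comm (f : XIRing) (h : H p q) : evH p q f * h = h * evH p q f :=
  (Subalgebra.mem_center_iff.1 (evR p q f).2 h).symm

theorem evH_C (r : ℂ) : evH p q (Polynomial.C (Polynomial.C r)) = algebraMap ℂ _ r := by
  simp [evH, evR]
  rfl

theorem evH_algebraMap (r : ℂ) : evH p q (algebraMap ℂ _ r) = algebraMap ℂ _ r := evH_C p q r

theorem evH_xR : evH p q xR = qx p q := by simp [evH, evR, xR]; rfl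

theorem evH_iR : evH p q iR = qi p q * qi p q := by simp [evH, evR, iR]; rfl

theorem evH_jR : evH p q jR = qj p q * qj p q := by
  rw [jR_eq, map_sub, map_mul, map_sub, map_pow, map_one, map_ofNat, evH_xR, evH_iR,
    ← qi_sq_add_qj_sq, add_sub_cancel_left]

theorem evH_xijToR (f : MvPolynomial (Fin 3) ℂ) : evH p q (xijToR f) = evalXIJ p q f := by
  have h : (evR p q).comp xijToR.toRingHom = (evalXIJ p q).toRingHom := by
    refine MvPolynomial.ringHom_ext (fun r => ?_) (fun n => ?_)
    · apply Subtype.ext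
      change evH p q (xijToR (MvPolynomial.C r)) = evalXIJ p q (MvPolynomial.C r)
      rw [← MvPolynomial.algebraMap_eq, AlgHom.commutes, AlgHom.commutes, evH_algebraMap]
      rfl
    · apply Subtype.ext
      change evH p q (xijToR (MvPolynomial.X n)) = evalXIJ p q (MvPolynomial.X n)
      fin_cases n
      · exact (congrArg _ xijToR_X0).trans ((evH_xR p q).trans (by simp [evalXIJ]))
      · exact (congrArg _ xijToR_X1).trans ((evH_iR p q).trans (by simp [evalXIJ]))
      · exact (congrArg _ xijToR_X2).trans ((evH_jR p q).trans (by simp [evalXIJ]))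
  exact congrArg Subtype.val (RingHom.congr_fun h f)

theorem elQ_eq (Q : MvPolynomial (Fin 2) ℂ) : elQ p q Q = evH p q (ijToR Q) := by
  rw [elQ, ← evH_xijToR, xijToR_toXIJ]

/-- The surjection from the generic quaternion algebra to `H`. -/
noncomputable def quatToH : Quat →+* H p q :=
  letI : Algebra XIRing (H p q) := (evH p q).toAlgebra' (evH_comm p q)
  (QuaternionAlgebra.Basis.liftHom
    { i := qi p q
      j := qj p q
      k := qi p q * qj p q
      i_mul_i := by
        change _ = evH p q iR * 1 + evH p q 0 * _
        rw [map_zero, zero_mul, add_zero, mul_one, evH_iR]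
      j_mul_j := by
        change _ = evH p q jR * 1
        rw [mul_one, evH_jR]
      i_mul_j := rfl
      j_mul_i := by
        change _ = evH p q 0 * _ - _
        rw [map_zero, zero_mul, zero_sub, qj_mul_qi] }).toRingHom

theorem quatToH_apply (z : Quat) : quatToH p q z = evH p q z.re + evH p q z.imI * qi p q +
    evH p q z.imJ * qj p q + evH p q z.imK * (qi p q * qj p q) := rfl

theorem evH_halfR_mul (h : H p q) : evH p q halfR * h = (1 / 2 : ℂ) • h := by
  rw [halfR, evH_algebraMap, Algebra.smul_def]

theorem quatToH_freeToQuat (g : FreeGroup (Fin 2)) :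
    quatToH p q (freeToQuat g) = BH.of (toKnotGroup p q g) := by
  have hgen : ∀ n, quatToH p q (freeToQuat (FreeGroup.of n)) =
      BH.of (toKnotGroup p q (FreeGroup.of n)) := by
    intro n
    rw [freeToQuat, FreeGroup.lift_apply_of]
    fin_cases n
    · change quatToH p q ⟨xR, halfR, halfR, 0⟩ = elX p q
      rw [quatToH_apply]
      simp only
      rw [map_zero, zero_mul, add_zero, evH_halfR_mul, evH_halfR_mul, evH_xR, add_assoc, ← smul_add,
        qi_add_qj, qx, delta, ← smul_add, add_add_sub_cancel, ← two_smul ℂ (elX p q), smul_smul]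
      norm_num
    · change quatToH p q ⟨xR, -halfR, halfR, 0⟩ = BH.of (genB p q)
      rw [quatToH_apply]
      simp only
      rw [map_zero, zero_mul, add_zero, map_neg, neg_mul, evH_halfR_mul, evH_halfR_mul, evH_xR,
        add_assoc, neg_add_eq_sub, ← smul_sub, qj_sub_qi, qx, trace_eq, deltaB, ← smul_add,
        add_add_sub_cancel, ← two_smul ℂ (BH.of (genB p q)), smul_smul]
      norm_num
  induction g using FreeGroup.induction_on with
  | C1 => simp
  | of n => exact hgen n
  | inv_of n h =>
    have h1 : quatToH p q (freeToQuat (FreeGroup.of n)) *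
        quatToH p q (freeToQuat (FreeGroup.of n)⁻¹) = 1 := by
      rw [← map_mul, ← Submonoid.coe_mul, ← map_mul, mul_inv_cancel, map_one, Submonoid.coe_one,
        map_one]
    have h2 : BH.of (toKnotGroup p q (FreeGroup.of n)⁻¹) *
        quatToH p q (freeToQuat (FreeGroup.of n)) = 1 := by
      rw [h, ← map_mul, ← map_mul, inv_mul_cancel, map_one, map_one]
    exact (left_inv_eq_right_inv h2 h1).symm
  | mul x y hx hy => rw [map_mul, Submonoid.coe_mul, map_mul, hx, hy, map_mul, map_mul]

theorem quatToH_surjective : Function.Surjective (quatToH p q) := by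
  intro h
  induction h using BH.induction with
  | of g =>
    obtain ⟨g, rfl⟩ := PresentedGroup.mk_surjective _ g
    exact ⟨_, quatToH_freeToQuat p q g⟩
  | add x y hx hy =>
    obtain ⟨x, rfl⟩ := hx
    obtain ⟨y, rfl⟩ := hy
    exact ⟨x + y, map_add _ _ _⟩
  | smul r x hx =>
    obtain ⟨x, rfl⟩ := hx
    refine ⟨⟨algebraMap ℂ _ r, 0, 0, 0⟩ * x, ?_⟩
    rw [map_mul, quatToH_apply, Algebra.smul_def, evH_algebraMap]
    simp

/-! ### The two-sided ideal of relations of `H` -/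

variable {p q}

/-- The image in `H` of `genQuat_mul_sub`, whose left side becomes `a w - w b = 0`. -/
theorem evH_defPoly_mul_qi (hw : IsSignWord (vWord p q)) :
    evH p q (ijToR (defPoly p q)) * qi p q = 0 := by
  have h1 : BH.of (genA p q) * BH.of (toKnotGroup p q (spell (wWord p q))) =
      BH.of (toKnotGroup p q (spell (wWord p q))) * BH.of (genB p q) := by
    have h := PresentedGroup.one_of_mem (rels :=
      {FreeGroup.of (0 : Fin 2) * spell (wWord p q) * (spell (wWord p q) * FreeGroup.of 1)⁻¹})
      (Set.mem_singleton _)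
    change toKnotGroup p q _ = 1 at h
    rw [map_mul, map_inv, mul_inv_eq_one, map_mul, map_mul] at h
    rw [← map_mul, ← map_mul]
    exact congrArg _ h
  have h2 := congrArg (quatToH p q) (genQuat_mul_sub (palTriple (vWord p q)))
  have h3 : ∀ n, (genQuat n : Quat) = freeToQuat (FreeGroup.of n) := fun n => by
    rw [freeToQuat, FreeGroup.lift_apply_of]
  rw [← freeToQuat_palindrome _ hw, map_sub, map_mul, map_mul, h3, h3, quatToH_freeToQuat,
    quatToH_freeToQuat, quatToH_freeToQuat, quatToH_apply] at h2
  simp only [map_zero, zero_mul, add_zero, zero_add] at h2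
  exact h2.symm.trans (sub_eq_zero.2 h1)

/-- The ideal `⟨I r⟩ ⊕ ⟨r⟩ i ⊕ ⟨I r⟩ j ⊕ ⟨r⟩ k` of the generic quaternion algebra. -/
noncomputable def quatIdeal (r : XIRing) : TwoSidedIdeal Quat :=
  TwoSidedIdeal.mk' {z | iR * r ∣ z.re ∧ r ∣ z.imI ∧ iR * r ∣ z.imJ ∧ r ∣ z.imK}
    (by simp)
    (by
      rintro x y ⟨h1, h2, h3, h4⟩ ⟨h1', h2', h3', h4'⟩
      exact ⟨dvd_add h1 h1', dvd_add h2 h2', dvd_add h3 h3', dvd_add h4 h4'⟩)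
    (by
      rintro x ⟨h1, h2, h3, h4⟩
      exact ⟨h1.neg_right, h2.neg_right, h3.neg_right, h4.neg_right⟩)
    (by
      -- The witnesses come from the multiplication table: `1`, `i`, `j`, `k` times `r i` are `r i`,
      -- `I r`, `-r k`, `-I r j`, which is also where the extra factors `I` originate.
      rintro ⟨x0, x1, x2, x3⟩ ⟨y0, y1, y2, y3⟩ ⟨⟨a, rfl⟩, ⟨b, rfl⟩, ⟨c, rfl⟩, ⟨d, rfl⟩⟩
      simp only [QuaternionAlgebra.mk_mul_mk, Set.mem_ofPred_eq]
      exact ⟨⟨x0 * a + x1 * b + jR * x2 * c - jR * x3 * d, by ring⟩,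
        ⟨x0 * b + x1 * iR * a - jR * x2 * d + jR * x3 * iR * c, by ring⟩,
        ⟨x0 * c + x1 * d + x2 * a - x3 * b, by ring⟩,
        ⟨x0 * d + x1 * iR * c - x2 * b + x3 * iR * a, by ring⟩⟩)
    (by
      rintro ⟨x0, x1, x2, x3⟩ ⟨y0, y1, y2, y3⟩ ⟨⟨a, rfl⟩, ⟨b, rfl⟩, ⟨c, rfl⟩, ⟨d, rfl⟩⟩
      simp only [QuaternionAlgebra.mk_mul_mk, Set.mem_ofPred_eq]
      exact ⟨⟨a * y0 + b * y1 + jR * c * y2 - jR * d * y3, by ring⟩,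
        ⟨iR * a * y1 + b * y0 - jR * iR * c * y3 + jR * d * y2, by ring⟩,
        ⟨a * y2 + b * y3 + c * y0 - d * y1, by ring⟩,
        ⟨iR * a * y3 + b * y2 - iR * c * y1 + d * y0, by ring⟩⟩)

theorem mem_quatIdeal {r : XIRing} {z : Quat} : z ∈ quatIdeal r ↔
    iR * r ∣ z.re ∧ r ∣ z.imI ∧ iR * r ∣ z.imJ ∧ r ∣ z.imK :=
  TwoSidedIdeal.mem_mk' _ _ _ _ _ _ _

/-- The quotient map by `quatIdeal r`. -/
noncomputable def quatMk (r : XIRing) : Quat →ₐ[ℂ] (quatIdeal r).ringCon.Quotient :=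
  { (quatIdeal r).ringCon.mk' with commutes' := fun _ => rfl }

theorem quatMk_eq_zero {r : XIRing} {z : Quat} : quatMk r z = 0 ↔ z ∈ quatIdeal r := by
  rw [TwoSidedIdeal.mem_iff]
  exact RingCon.eq _

/-- The homomorphism from the knot group to the quotient of the generic quaternion algebra. -/
noncomputable def knotToQuot (hw : IsSignWord (vWord p q)) :
    KnotGroup p q →* (quatIdeal (ijToR (defPoly p q))).ringCon.Quotientˣ :=
  QuotientGroup.lift _ ((Units.map (quatMk (ijToR (defPoly p q))).toMonoidHom).comp
    (Unitary.toUnits.comp freeToQuat)) (by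
    refine Subgroup.normalClosure_le_normal (N := MonoidHom.ker _) ?_
    rintro _ rfl
    rw [SetLike.mem_coe, MonoidHom.mem_ker, map_mul, map_inv, mul_inv_eq_one]
    ext
    change quatMk _ (freeToQuat _ : Quat) = quatMk _ (freeToQuat _ : Quat)
    rw [← sub_eq_zero, ← map_sub, quatMk_eq_zero, map_mul, map_mul, Submonoid.coe_mul,
      Submonoid.coe_mul, wWord, freeToQuat_palindrome _ hw]
    have h3 : ∀ n, (freeToQuat (FreeGroup.of n) : Quat) = genQuat n := fun n => by
      rw [freeToQuat, FreeGroup.lift_apply_of]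
    -- The relator contributes `Q i`, whose only nonzero coordinate is the one at `i`.
    rw [h3, h3, genQuat_mul_sub, mem_quatIdeal]
    exact ⟨dvd_zero _, dvd_rfl, dvd_zero _, dvd_zero _⟩)

/-- `w + star w` is a scalar. For unitary `w` the conjugate is the inverse, so the Brumfiel–Hilden
relations hold automatically in `Quat`. -/
theorem quat_mul_add_star {R : Type*} [CommRing R] {a b c : R} (z w : QuaternionAlgebra R a b c) :
    z * (w + star w) = (w + star w) * z := by
  ext <;> simp <;> ring

theorem quatMk_comm (r : XIRing) (g h : FreeGroup (Fin 2)) :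
    quatMk r (freeToQuat g : Quat) * (quatMk r (freeToQuat h : Quat) +
      quatMk r (freeToQuat h⁻¹ : Quat)) = (quatMk r (freeToQuat h : Quat) +
      quatMk r (freeToQuat h⁻¹ : Quat)) * quatMk r (freeToQuat g : Quat) := by
  rw [← map_add, ← map_mul, ← map_mul, map_inv, ← Unitary.star_eq_inv, Unitary.coe_star,
    quat_mul_add_star]

/-- The homomorphism from `H` to the quotient of the generic quaternion algebra. -/
noncomputable def hToQuot (hw : IsSignWord (vWord p q)) :
    H p q →ₐ[ℂ] (quatIdeal (ijToR (defPoly p q))).ringCon.Quotient :=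
  BH.lift ((Units.coeHom _).comp (knotToQuot hw)) (by
    intro g h
    obtain ⟨g, rfl⟩ := PresentedGroup.mk_surjective _ g
    obtain ⟨h, rfl⟩ := PresentedGroup.mk_surjective _ h
    exact quatMk_comm _ g h)

theorem hToQuot_of (hw : IsSignWord (vWord p q)) (g : FreeGroup (Fin 2)) :
    hToQuot hw (BH.of (toKnotGroup p q g)) = quatMk _ (freeToQuat g : Quat) :=
  BH.lift_of _ _ _

end ToH

/-! ### The structure of `H` -/

section Conj

variable {G : Type*} [Group G]

theorem BH.conj_add (x y : BH G) : BH.conj (x + y) = BH.conj x + BH.conj y := by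
  simp [BH.conj]

theorem BH.conj_mul (x y : BH G) : BH.conj (x * y) = BH.conj y * BH.conj x := by
  simp [BH.conj]

theorem BH.conj_smul (r : ℂ) (x : BH G) : BH.conj (r • x) = r • BH.conj x := by
  simp [BH.conj]

theorem BH.conj_sub (x y : BH G) : BH.conj (x - y) = BH.conj x - BH.conj y := by
  simp [BH.conj]

end Conj

section Structure

variable {p : ℕ} {q : ℤ}

theorem conj_elX : BH.conj (elX p q) = elXinv p q := BH.conj_of _

theorem conj_elXinv : BH.conj (elXinv p q) = elX p q := by
  rw [elXinv, BH.conj_of, inv_inv, elX]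

theorem conj_delta_eq : BH.conj (delta p q) = -delta p q := by
  rw [delta, BH.conj_sub, conj_elX, conj_elXinv, neg_sub]

theorem conj_deltaB_eq : BH.conj (deltaB p q) = -deltaB p q := by
  rw [deltaB, BH.conj_sub, BH.conj_of, BH.conj_of, inv_inv, neg_sub]

theorem conj_qi : BH.conj (qi p q) = -qi p q := by
  rw [qi, BH.conj_smul, BH.conj_sub, conj_delta_eq, conj_deltaB_eq, ← smul_neg]
  congr 1
  abel

theorem conj_qj : BH.conj (qj p q) = -qj p q := by
  rw [qj, BH.conj_smul, BH.conj_add, conj_delta_eq, conj_deltaB_eq, ← smul_neg]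
  congr 1
  abel

theorem conj_qx : BH.conj (qx p q) = qx p q := by
  rw [qx, BH.conj_smul, BH.conj_add, conj_elX, conj_elXinv, add_comm]

theorem conj_evH (f : XIRing) : BH.conj (evH p q f) = evH p q f := by
  have h : (BH.starHom (G := KnotGroup p q)).toRingHom.comp (evH p q) =
      (evH p q).toOpposite fun x y => evH_comm p q x _ := by
    refine Polynomial.ringHom_ext' (Polynomial.ringHom_ext (fun r => ?_) ?_) ?_
    · change MulOpposite.op (BH.conj (evH p q (Polynomial.C (Polynomial.C r)))) =
        MulOpposite.op (evH p q (Polynomial.C (Polynomial.C r)))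
      rw [evH_C, Algebra.algebraMap_eq_smul_one, BH.conj_smul]
      congr 2
      simp [BH.conj]
    · change MulOpposite.op (BH.conj (evH p q xR)) = MulOpposite.op (evH p q xR)
      rw [evH_xR, conj_qx]
    · change MulOpposite.op (BH.conj (evH p q iR)) = MulOpposite.op (evH p q iR)
      rw [evH_iR, BH.conj_mul, conj_qi, neg_mul_neg]
  exact congrArg MulOpposite.unop (RingHom.congr_fun h f)

theorem conj_quatToH (z : Quat) :
    BH.conj (quatToH p q z) = quatToH p q ⟨z.re, -z.imI, -z.imJ, -z.imK⟩ := by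
  rw [quatToH_apply, quatToH_apply]
  simp only [BH.conj_add, BH.conj_mul, conj_evH, conj_qi, conj_qj, map_neg,
    ← evH_comm, neg_mul, mul_neg, qj_mul_qi, neg_neg]

theorem hToQuot_elX (hw : IsSignWord (vWord p q)) : hToQuot hw (elX p q) =
    quatMk _ ⟨xR, halfR, halfR, 0⟩ := by
  rw [elX, genA, hToQuot_of, freeToQuat, FreeGroup.lift_apply_of]
  rfl

theorem hToQuot_elXinv (hw : IsSignWord (vWord p q)) : hToQuot hw (elXinv p q) =
    quatMk _ ⟨xR, -halfR, -halfR, 0⟩ := by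
  rw [elXinv, genA, ← map_inv, hToQuot_of, map_inv, ← Unitary.star_eq_inv, Unitary.coe_star,
    freeToQuat, FreeGroup.lift_apply_of]
  congr 1
  apply QuaternionAlgebra.ext <;> simp [genQuat]

theorem hToQuot_deltaB (hw : IsSignWord (vWord p q)) : hToQuot hw (deltaB p q) =
    quatMk _ ⟨0, -1, 1, 0⟩ := by
  rw [deltaB, map_sub, genB, ← map_inv, hToQuot_of, hToQuot_of, map_inv, ← Unitary.star_eq_inv,
    Unitary.coe_star, freeToQuat, FreeGroup.lift_apply_of, ← map_sub]
  congr 1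
  have h := two_mul_halfR
  apply QuaternionAlgebra.ext <;> simp [genQuat] <;> grind

theorem hToQuot_delta (hw : IsSignWord (vWord p q)) : hToQuot hw (delta p q) =
    quatMk _ ⟨0, 1, 1, 0⟩ := by
  rw [delta, map_sub, hToQuot_elX, hToQuot_elXinv, ← map_sub]
  congr 1
  have h := two_mul_halfR
  apply QuaternionAlgebra.ext <;> simp <;> grind

theorem half_smul_eq (f : XIRing) : (1 / 2 : ℂ) • f = halfR * f := by
  rw [halfR, Algebra.smul_def]

theorem hToQuot_qi (hw : IsSignWord (vWord p q)) : hToQuot hw (qi p q) =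
    quatMk _ ⟨0, 1, 0, 0⟩ := by
  rw [qi, map_smul, map_sub, hToQuot_delta, hToQuot_deltaB, ← map_sub, ← map_smul,
    QuaternionAlgebra.mk_sub_mk, QuaternionAlgebra.smul_mk]
  have h := two_mul_halfR
  simp only [half_smul_eq]
  congr 2 <;> grind

theorem hToQuot_qj (hw : IsSignWord (vWord p q)) : hToQuot hw (qj p q) =
    quatMk _ ⟨0, 0, 1, 0⟩ := by
  rw [qj, map_smul, map_add, hToQuot_delta, hToQuot_deltaB, ← map_add, ← map_smul,
    QuaternionAlgebra.mk_add_mk, QuaternionAlgebra.smul_mk]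
  have h := two_mul_halfR
  simp only [half_smul_eq]
  congr 2 <;> grind

theorem hToQuot_qx (hw : IsSignWord (vWord p q)) : hToQuot hw (qx p q) =
    quatMk _ ⟨xR, 0, 0, 0⟩ := by
  rw [qx, map_smul, map_add, hToQuot_elX, hToQuot_elXinv, ← map_add, ← map_smul,
    QuaternionAlgebra.mk_add_mk, QuaternionAlgebra.smul_mk]
  have h := two_mul_halfR
  simp only [half_smul_eq]
  congr 2 <;> grind

theorem hToQuot_evH (hw : IsSignWord (vWord p q)) (f : XIRing) :
    hToQuot hw (evH p q f) = quatMk _ ⟨f, 0, 0, 0⟩ := by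
  have h : (hToQuot hw).toRingHom.comp (evH p q) =
      (quatMk (ijToR (defPoly p q))).toRingHom.comp (algebraMap XIRing Quat) := by
    refine Polynomial.ringHom_ext' (Polynomial.ringHom_ext (fun r => ?_) ?_) ?_
    · change hToQuot hw (evH p q (Polynomial.C (Polynomial.C r))) =
        quatMk _ (algebraMap ℂ Quat r)
      rw [evH_C, AlgHom.commutes, AlgHom.commutes]
    · change hToQuot hw (evH p q xR) = quatMk _ ⟨xR, 0, 0, 0⟩
      rw [evH_xR, hToQuot_qx]
    · change hToQuot hw (evH p q iR) = quatMk _ ⟨iR, 0, 0, 0⟩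
      rw [evH_iR, map_mul, hToQuot_qi, ← map_mul, QuaternionAlgebra.mk_mul_mk]
      congr 2 <;> ring
  exact RingHom.congr_fun h f

theorem hToQuot_quatToH (hw : IsSignWord (vWord p q)) (z : Quat) :
    hToQuot hw (quatToH p q z) = quatMk _ z := by
  rw [quatToH_apply]
  simp only [map_add, map_mul, hToQuot_evH, hToQuot_qi, hToQuot_qj]
  simp only [← map_add, ← map_mul]
  congr 1
  simp only [QuaternionAlgebra.mk_mul_mk, QuaternionAlgebra.mk_add_mk]
  apply QuaternionAlgebra.ext <;> simp

/-- The composite `Quat → H → Quat / ideal` is the quotient map, so the kernel of the first map lies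
in the ideal. Conversely every element of the ideal is a combination of multiples of `Q i`, which
vanishes in `H`. -/
theorem quatToH_eq_zero_iff (hw : IsSignWord (vWord p q)) (z : Quat) :
    quatToH p q z = 0 ↔ z ∈ quatIdeal (ijToR (defPoly p q)) := by
  constructor
  · intro h
    rw [← quatMk_eq_zero, ← hToQuot_quatToH hw, h, map_zero]
  · rw [mem_quatIdeal]
    obtain ⟨z0, z1, z2, z3⟩ := z
    rintro ⟨⟨a, rfl⟩, ⟨b, rfl⟩, ⟨c, rfl⟩, ⟨d, rfl⟩⟩
    have h := evH_defPoly_mul_qi hw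
    have h' : evH p q (iR * ijToR (defPoly p q)) = 0 := by
      rw [mul_comm, map_mul, evH_iR, ← mul_assoc, h, zero_mul]
    rw [quatToH_apply]
    simp only
    rw [map_mul _ (iR * _) a, map_mul _ (iR * _) c, h', map_mul, map_mul, ← map_mul, ← map_mul,
      mul_comm _ b, mul_comm _ d, map_mul, map_mul, mul_assoc, h,
      mul_assoc (evH p q d), ← mul_assoc _ (qi p q) (qj p q), h]
    simp

/-- Average a quaternion lift with its conjugate: only the scalar part remains. -/
theorem exists_evH_of_conj_eq {h : H p q} (hh : BH.conj h = h) : ∃ f, evH p q f = h := by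
  obtain ⟨z, rfl⟩ := quatToH_surjective p q h
  refine ⟨z.re, ?_⟩
  have h1 : (2 : ℂ) • quatToH p q z = (2 : ℂ) • evH p q z.re := by
    rw [two_smul]
    nth_rewrite 1 [← hh]
    rw [conj_quatToH, ← map_add, quatToH_apply, two_smul]
    simp
  have h2 := congrArg (fun z => (1 / 2 : ℂ) • z) h1
  simpa using h2.symm

theorem isBHPolynomial_defPoly (hp : 3 ≤ p) (hw : IsSignWord (vWord p q)) :
    IsBHPolynomial p q (defPoly p q) where
  totalDegree_eq := defPoly_totalDegree hp
  invariants h := by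
    constructor
    · intro hh
      obtain ⟨f, rfl⟩ := exists_evH_of_conj_eq hh
      exact ⟨rToXIJ f, by rw [← evH_xijToR, xijToR_rToXIJ]⟩
    · rintro ⟨f, rfl⟩
      rw [← evH_xijToR, conj_evH]
  span h := by
    obtain ⟨z, rfl⟩ := quatToH_surjective p q h
    refine ⟨rToXIJ z.re, rToXIJ z.imI, rToXIJ z.imJ, rToXIJ z.imK, ?_⟩
    simp only [← evH_xijToR, xijToR_rToXIJ]
    exact quatToH_apply p q z
  relations f₀ f₁ f₂ f₃ := by
    simp only [← evH_xijToR, mem_idealIQ_iff, mem_idealQ_iff]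
    exact (quatToH_eq_zero_iff hw ⟨_, _, _, _⟩).trans mem_quatIdeal

/-- The relations at `i` determine the principal ideal of `Q` in `ℂ[x][I]`, whose units are the
nonzero scalars. This transfers everything proved for `defPoly` to an arbitrary `Q`. -/
theorem IsBHPolynomial.exists_eq_mul {Q : MvPolynomial (Fin 2) ℂ} (hQ : IsBHPolynomial p q Q)
    (hp : 3 ≤ p) (hw : IsSignWord (vWord p q)) :
    ∃ c : ℂ, c ≠ 0 ∧ ijToR Q = Polynomial.C (Polynomial.C c) * ijToR (defPoly p q) := by
  have key : ∀ f, ijToR Q ∣ f ↔ ijToR (defPoly p q) ∣ f := by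
    intro f
    have h1 := hQ.relations 0 (rToXIJ f) 0 0
    have h2 := (isBHPolynomial_defPoly hp hw).relations 0 (rToXIJ f) 0 0
    simp only [mem_idealIQ_iff, mem_idealQ_iff, xijToR_rToXIJ, map_zero, dvd_zero, and_true,
      true_and] at h1 h2
    rw [← h1, h2]
  have ha : Associated (ijToR (defPoly p q)) (ijToR Q) :=
    associated_of_dvd_dvd ((key _).1 dvd_rfl) ((key _).2 dvd_rfl)
  obtain ⟨u, hu⟩ := ha
  obtain ⟨v, hv, hv'⟩ := Polynomial.isUnit_iff.1 u.isUnit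
  obtain ⟨c, hc, rfl⟩ := Polynomial.isUnit_iff.1 hv
  exact ⟨c, hc.ne_zero, by rw [hv', mul_comm, hu]⟩

end Structure

/-! ### The commutative subalgebra `H⁺[X^{±1}]` -/

section Commutative

open Polynomial

/-- The ring `ℂ[X^{±1}][I]`. -/
abbrev LIRing : Type := Polynomial ℂ[T;T⁻¹]

/-- The Laurent polynomial `x = (X + X⁻¹) / 2`. -/
noncomputable def laurentX : ℂ[T;T⁻¹] :=
  LaurentPolynomial.C (1 / 2) * (LaurentPolynomial.T 1 + LaurentPolynomial.T (-1))

/-- The homomorphism `ℂ[x] → ℂ[X^{±1}]`. -/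
noncomputable def xToLaurent : Polynomial ℂ →+* ℂ[T;T⁻¹] := (aeval (R := ℂ) laurentX).toRingHom

/-- The homomorphism `ℂ[x][I] → ℂ[X^{±1}][I]`. -/
noncomputable def toLI : XIRing →+* LIRing := mapRingHom xToLaurent

theorem xToLaurent_C (r : ℂ) : xToLaurent (C r) = LaurentPolynomial.C r := by
  change aeval laurentX (C r) = _
  rw [aeval_C, LaurentPolynomial.C_eq_algebraMap]

theorem xToLaurent_X : xToLaurent X = laurentX := aeval_X _

theorem toLI_C (f : Polynomial ℂ) : toLI (C f) = C (xToLaurent f) := by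
  rw [toLI, coe_mapRingHom, map_C]

theorem toLI_iR : toLI iR = X := by rw [toLI, coe_mapRingHom, iR, map_X]

theorem two_mul_half : 2 * (LaurentPolynomial.C (1 / 2) : ℂ[T;T⁻¹]) = 1 := by
  rw [← map_ofNat LaurentPolynomial.C 2, ← map_mul]
  norm_num

theorem T_mul_T_neg : (LaurentPolynomial.T 1 : ℂ[T;T⁻¹]) * LaurentPolynomial.T (-1) = 1 := by
  rw [← LaurentPolynomial.T_add, add_neg_cancel, LaurentPolynomial.T_zero]

theorem laurentDelta_sq : laurentDelta ^ 2 = 4 * (laurentX ^ 2 - 1) := by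
  have h := two_mul_half
  have h' := T_mul_T_neg
  rw [laurentDelta, laurentX]
  grind

theorem toLI_iR_add_jR : toLI (iR + jR) = C laurentDelta ^ 2 := by
  have h : iR + jR = C (4 * (X ^ 2 - 1)) := by rw [jR, iR]; ring
  rw [h, toLI_C, ← map_pow, laurentDelta_sq, map_mul, map_sub, map_pow, xToLaurent_X, map_one,
    map_ofNat]

/-- The decomposition into parts even and odd under `X ↦ X⁻¹`. It follows from `X^{±1} = x ± δ/2`
and `δ² = 4 (x² - 1)`. -/
theorem exists_eq_add_mul_delta (f : ℂ[T;T⁻¹]) :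
    ∃ a b, f = xToLaurent a + xToLaurent b * laurentDelta := by
  have h := two_mul_half
  have hd := laurentDelta_sq
  have h1 : (LaurentPolynomial.T 1 : ℂ[T;T⁻¹]) =
      laurentX + LaurentPolynomial.C (1 / 2) * laurentDelta := by
    rw [laurentDelta, laurentX]
    linear_combination -LaurentPolynomial.T 1 * h
  have h2 : (LaurentPolynomial.T (-1) : ℂ[T;T⁻¹]) =
      laurentX - LaurentPolynomial.C (1 / 2) * laurentDelta := by
    rw [laurentDelta, laurentX]
    linear_combination -LaurentPolynomial.T (-1) * h
  induction f using LaurentPolynomial.induction_on with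
  | h_C a => exact ⟨C a, 0, by rw [xToLaurent_C, map_zero, zero_mul, add_zero]⟩
  | h_add hf hg =>
    obtain ⟨a, b, rfl⟩ := hf
    obtain ⟨a', b', rfl⟩ := hg
    exact ⟨a + a', b + b', by rw [map_add, map_add]; ring⟩
  | h_C_mul_T n a ih =>
    obtain ⟨b, c, hb⟩ := ih
    -- The coefficients of `(b + c δ)(x + δ/2)`; the other case uses `x - δ/2`.
    refine ⟨b * X + 2 * c * (X ^ 2 - 1), b * C (1 / 2) + c * X, ?_⟩
    rw [LaurentPolynomial.T_add, ← mul_assoc, hb, h1]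
    simp only [map_add, map_mul, xToLaurent_C, xToLaurent_X, map_sub, map_pow, map_one, map_ofNat]
    grind
  | h_C_mul_T_Z n a ih =>
    obtain ⟨b, c, hb⟩ := ih
    refine ⟨b * X - 2 * c * (X ^ 2 - 1), c * X - b * C (1 / 2), ?_⟩
    rw [LaurentPolynomial.T_sub, ← mul_assoc, hb, h2]
    simp only [map_mul, xToLaurent_C, xToLaurent_X, map_sub, map_pow, map_one, map_ofNat]
    grind

theorem exists_eq_toLI_add (g : LIRing) : ∃ a b, g = toLI a + toLI b * C laurentDelta := by
  induction g using Polynomial.induction_on' with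
  | add f g hf hg =>
    obtain ⟨a, b, rfl⟩ := hf
    obtain ⟨a', b', rfl⟩ := hg
    exact ⟨a + a', b + b', by rw [map_add, map_add]; ring⟩
  | monomial n f =>
    obtain ⟨a, b, rfl⟩ := exists_eq_add_mul_delta f
    refine ⟨C a * iR ^ n, C b * iR ^ n, ?_⟩
    rw [← C_mul_X_pow_eq_monomial, map_mul, map_mul, map_pow, toLI_iR, toLI_C, toLI_C, map_add,
      map_mul]
    ring

/-- Coefficientwise `X ↦ X⁻¹` on `ℂ[X^{±1}][I]`. -/
noncomputable def invLI : LIRing →+* LIRing := mapRingHom inv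

theorem invLI_C (f : ℂ[T;T⁻¹]) : invLI (C f) = C (inv f) := by rw [invLI, coe_mapRingHom, map_C]

theorem invLI_X : invLI X = X := by rw [invLI, coe_mapRingHom, map_X]

theorem inv_xToLaurent (f : Polynomial ℂ) : inv (xToLaurent f) = xToLaurent f := by
  have h : inv.comp xToLaurent = xToLaurent := by
    refine Polynomial.ringHom_ext (fun r => ?_) ?_
    · rw [RingHom.comp_apply, xToLaurent_C, inv_C]
    · rw [RingHom.comp_apply, xToLaurent_X, laurentX, map_mul, map_add, inv_C, inv_T, inv_T,
        neg_neg, add_comm]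
  exact RingHom.congr_fun h f

theorem invLI_toLI (f : XIRing) : invLI (toLI f) = toLI f := by
  have h : inv.comp xToLaurent = xToLaurent := RingHom.ext inv_xToLaurent
  rw [invLI, toLI, ← RingHom.comp_apply, mapRingHom_comp, h]

theorem exists_divDiffLI (g : LIRing) : ∃ g', C laurentDelta * g' = g - invLI g := by
  induction g using Polynomial.induction_on' with
  | add f g hf hg =>
    obtain ⟨f', hf⟩ := hf
    obtain ⟨g', hg⟩ := hg
    exact ⟨f' + g', by rw [mul_add, hf, hg, map_add]; ring⟩
  | monomial n f =>
    refine ⟨C (divDiff f) * X ^ n, ?_⟩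
    rw [← C_mul_X_pow_eq_monomial, map_mul, map_pow, invLI_X, invLI_C, ← mul_assoc, ← map_mul,
      laurentDelta_mul_divDiff, map_sub, sub_mul]

/-! ### `H⁺[X^{±1}]` as a quotient of `ℂ[X^{±1}][I]` -/

variable (p : ℕ) (q : ℤ)

theorem evalX_T_one : evalX p q (LaurentPolynomial.T 1) = elX p q := by
  rw [evalX_T, zpow_one, elX]

theorem evalX_T_neg_one : evalX p q (LaurentPolynomial.T (-1)) = elXinv p q := by
  rw [evalX_T, zpow_neg_one, elXinv]

theorem evalX_laurentDelta : evalX p q laurentDelta = delta p q := by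
  rw [laurentDelta, map_sub, evalX_T_one, evalX_T_neg_one, delta]

theorem evalX_C (r : ℂ) : evalX p q (LaurentPolynomial.C r) = algebraMap ℂ _ r := by
  rw [LaurentPolynomial.C_eq_algebraMap, AlgHom.commutes]

theorem evalX_laurentX : evalX p q laurentX = qx p q := by
  rw [laurentX, map_mul, map_add, evalX_T_one, evalX_T_neg_one, evalX_C, qx, Algebra.smul_def]

/-- Evaluation `ℂ[X^{±1}][I] → H`. -/
noncomputable def evLI : LIRing →+* H p q :=
  eval₂RingHom' (evalX p q).toRingHom (qi p q * qi p q) fun _ =>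
    Subalgebra.mem_center_iff.1 (qi_sq_mem_center p q) _

theorem evLI_C (f : ℂ[T;T⁻¹]) : evLI p q (C f) = evalX p q f := by
  change eval₂ (evalX p q).toRingHom _ (C f) = _
  rw [eval₂_C]
  rfl

theorem evLI_X : evLI p q X = qi p q * qi p q := by
  change eval₂ (evalX p q).toRingHom _ X = _
  rw [eval₂_X]

theorem evLI_comm (f g : LIRing) : evLI p q f * evLI p q g = evLI p q g * evLI p q f := by
  rw [← map_mul, mul_comm, map_mul]

theorem evLI_toLI (f : XIRing) : evLI p q (toLI f) = evH p q f := by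
  have h : (evLI p q).comp toLI = evH p q := by
    refine Polynomial.ringHom_ext' (Polynomial.ringHom_ext (fun r => ?_) ?_) ?_
    · change evLI p q (toLI (C (C r))) = evH p q (C (C r))
      rw [toLI_C, evLI_C, xToLaurent_C, evalX_C, evH_C]
    · change evLI p q (toLI (C X)) = evH p q xR
      rw [toLI_C, evLI_C, xToLaurent_X, evalX_laurentX, evH_xR]
    · change evLI p q (toLI iR) = evH p q iR
      rw [toLI_iR, evLI_X, evH_iR]
  exact RingHom.congr_fun h f

variable {p q}

theorem evLI_eq_quatToH (a b : XIRing) :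
    evLI p q (toLI a + toLI b * C laurentDelta) = quatToH p q ⟨a, b, b, 0⟩ := by
  rw [map_add, map_mul, evLI_toLI, evLI_toLI, evLI_C, evalX_laurentDelta, ← qi_add_qj,
    quatToH_apply, mul_add]
  simp only
  rw [map_zero, zero_mul, add_zero, add_assoc]

/-- Because `δ = i + j`, the element `a + b δ` has coordinates `(a, b, b, 0)`. It vanishes when `IQ`
divides `a` and `b`, the condition at `j` being the stronger one for `b`. -/
theorem evLI_eq_zero_iff (hw : IsSignWord (vWord p q)) (g : LIRing) :
    evLI p q g = 0 ↔ X * toLI (ijToR (defPoly p q)) ∣ g := by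
  constructor
  · obtain ⟨a, b, rfl⟩ := exists_eq_toLI_add g
    rw [evLI_eq_quatToH, quatToH_eq_zero_iff hw, mem_quatIdeal]
    rintro ⟨h1, -, h2, -⟩
    rw [← toLI_iR, ← map_mul]
    exact dvd_add (_root_.map_dvd toLI h1) (dvd_mul_of_dvd_left (_root_.map_dvd toLI h2) _)
  · rintro ⟨c, rfl⟩
    have h : evLI p q (X * toLI (ijToR (defPoly p q))) = 0 := by
      rw [← toLI_iR, ← map_mul, evLI_toLI, mul_comm, map_mul, evH_iR, ← mul_assoc,
        evH_defPoly_mul_qi hw, zero_mul]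
    rw [map_mul, h, zero_mul]

theorem conj_evalX (f : ℂ[T;T⁻¹]) : BH.conj (evalX p q f) = evalX p q (inv f) := by
  induction f using LaurentPolynomial.induction_on' with
  | add f g hf hg => rw [map_add, BH.conj_add, hf, hg, map_add, map_add]
  | C_mul_T n a =>
    rw [map_mul, map_mul, inv_C, inv_T, map_mul, evalX_C, evalX_T, evalX_T, ← Algebra.smul_def,
      ← Algebra.smul_def, BH.conj_smul, BH.conj_of, zpow_neg]

theorem conj_evLI (g : LIRing) : BH.conj (evLI p q g) = evLI p q (invLI g) := by
  induction g using Polynomial.induction_on' with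
  | add f g hf hg => rw [map_add, BH.conj_add, hf, hg, map_add, map_add]
  | monomial n f =>
    have h : BH.conj (evLI p q (X ^ n)) = evLI p q (X ^ n) := by
      rw [← toLI_iR, ← map_pow, evLI_toLI, conj_evH]
    rw [← C_mul_X_pow_eq_monomial, map_mul, BH.conj_mul, h, map_mul, map_mul, map_pow invLI,
      invLI_X, invLI_C, evLI_C, conj_evalX, ← evLI_C, evLI_comm]

/-- The `*`-invariants are polynomials in `x` and `I`, and `x` is a Laurent polynomial in `X`. -/
theorem mem_HplusX_iff (h : H p q) : h ∈ HplusX p q ↔ ∃ g, evLI p q g = h := by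
  constructor
  · intro hh
    induction hh using Algebra.adjoin_induction with
    | mem x hx =>
      rcases hx with hx | rfl | rfl
      · obtain ⟨f, hf⟩ := exists_evH_of_conj_eq hx
        exact ⟨toLI f, by rw [evLI_toLI, hf]⟩
      · exact ⟨C (LaurentPolynomial.T 1), by rw [evLI_C, evalX_T_one]⟩
      · exact ⟨C (LaurentPolynomial.T (-1)), by rw [evLI_C, evalX_T_neg_one]⟩
    | algebraMap r => exact ⟨C (LaurentPolynomial.C r), by rw [evLI_C, evalX_C]⟩
    | add x y _ _ hx hy =>
      obtain ⟨f, rfl⟩ := hx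
      obtain ⟨g, rfl⟩ := hy
      exact ⟨f + g, map_add _ _ _⟩
    | mul x y _ _ hx hy =>
      obtain ⟨f, rfl⟩ := hx
      obtain ⟨g, rfl⟩ := hy
      exact ⟨f * g, map_mul _ _ _⟩
  · rintro ⟨g, rfl⟩
    have hI : evLI p q X ∈ HplusX p q := Algebra.subset_adjoin (Or.inl (by
      rw [← toLI_iR, evLI_toLI]
      exact conj_evH _))
    induction g using Polynomial.induction_on' with
    | add f g hf hg => rw [map_add]; exact Subalgebra.add_mem _ hf hg
    | monomial n f =>
      rw [← C_mul_X_pow_eq_monomial, map_mul, map_pow, evLI_C]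
      exact Subalgebra.mul_mem _ (evalX_mem p q f) (Subalgebra.pow_mem _ hI n)

end Commutative

/-! ### The longitude -/

section Longitude

open Polynomial

variable {p : ℕ} {q : ℤ}

/-- The pairs of group elements that agree after multiplication by the central element `r`. -/
def agreeSubgroup (r : H p q) (hr : ∀ x, r * x = x * r) :
    Subgroup (KnotGroup p q × KnotGroup p q) where
  carrier := {x | r * BH.of x.1 = r * BH.of x.2}
  one_mem' := rfl
  mul_mem' := by
    rintro ⟨x, y⟩ ⟨x', y'⟩ h h'
    change r * BH.of x = r * BH.of y at h
    change r * BH.of x' = r * BH.of y' at h'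
    change r * BH.of (x * x') = r * BH.of (y * y')
    rw [map_mul, map_mul, ← mul_assoc, h, hr, mul_assoc, h', ← mul_assoc, ← hr, mul_assoc]
  inv_mem' := by
    rintro ⟨x, y⟩ h
    change r * BH.of x = r * BH.of y at h
    change r * BH.of x⁻¹ = r * BH.of y⁻¹
    have h1 : BH.of x⁻¹ * (r * BH.of x) * BH.of y⁻¹ = r * BH.of y⁻¹ := by
      rw [hr, ← mul_assoc, ← map_mul, inv_mul_cancel, map_one, one_mul]
    rw [← h1, h, mul_assoc, mul_assoc, ← map_mul, mul_inv_cancel, map_one, mul_one, hr]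

/-- Since `a - b = i` and `Q i = 0`, the generators agree after multiplication by `Q`. A word then
only matters through its exponent sum. -/
theorem spell_mem_agreeSubgroup (hw : IsSignWord (vWord p q)) (l : List (Fin 2 × ℤ)) :
    (toKnotGroup p q (spell l), genA p q ^ (l.map Prod.snd).sum) ∈
      agreeSubgroup (evH p q (ijToR (defPoly p q))) (evH_comm p q _) := by
  have hgen : ∀ n, (toKnotGroup p q (FreeGroup.of n), genA p q) ∈
      agreeSubgroup (evH p q (ijToR (defPoly p q))) (evH_comm p q _) := by
    intro n
    fin_cases n
    · rfl
    · change evH p q _ * BH.of (genB p q) = evH p q _ * BH.of (genA p q)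
      have h1 : BH.of (genA p q) = BH.of (genB p q) + qi p q := by
        have h := quatToH_freeToQuat p q (FreeGroup.of 0)
        have h' := quatToH_freeToQuat p q (FreeGroup.of 1)
        rw [freeToQuat, FreeGroup.lift_apply_of] at h h'
        rw [genA, genB, ← h, ← h', ← sub_eq_iff_eq_add', ← map_sub, quatToH_apply]
        have h2 : halfR - -halfR = 1 := by rw [sub_neg_eq_add, ← two_mul, two_mul_halfR]
        simp [genQuat, h2]
      rw [h1, mul_add, evH_defPoly_mul_qi hw, add_zero]
  induction l with
  | nil =>
    rw [spell, List.map_nil, List.prod_nil, map_one, List.map_nil, List.sum_nil, zpow_zero]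
    exact Subgroup.one_mem _
  | cons c l ih =>
    have h := Subgroup.mul_mem _ (Subgroup.zpow_mem _ (hgen c.1) c.2) ih
    rw [spell_cons, List.map_cons, List.sum_cons, map_mul, map_zpow, zpow_add]
    exact h

theorem sum_snd_wWord : ((wWord p q).map Prod.snd).sum =
    2 * ∑ n ∈ Finset.range ((p - 1) / 2), expo p q (n + 1) := by
  have h : ((vWord p q).map Prod.snd).sum =
      ∑ n ∈ Finset.range ((p - 1) / 2), expo p q (n + 1) := by
    rw [vWord, List.map_map, Finset.sum_range, ← List.sum_ofFn, List.ofFn_eq_map]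
    rw [← List.map_coe_finRange_eq_range, List.map_map]
    rfl
  rw [wWord, switchRev, List.map_append, List.sum_append, List.map_map]
  have h' : (Prod.snd ∘ fun c : Fin 2 × ℤ => (1 - c.1, c.2)) = Prod.snd := rfl
  rw [h', List.map_reverse, List.sum_reverse, h, two_mul]

/-- The longitude has exponent sum 0: `w` and `w̃` contribute `2 ∑ e_n` each, which the framing
cancels. -/
theorem elY_mul_defPoly (hw : IsSignWord (vWord p q)) :
    elY p q * evH p q (ijToR (defPoly p q)) = evH p q (ijToR (defPoly p q)) := by
  have h := Subgroup.mul_mem _ (Subgroup.mul_mem _ (spell_mem_agreeSubgroup hw (wWord p q))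
    (spell_mem_agreeSubgroup hw (wWord p q).reverse))
    (Subgroup.zpow_mem _ (spell_mem_agreeSubgroup hw [(0, 1)]) (-framing p q))
  rw [Prod.mk_mul_mk] at h
  have h1 : evH p q _ * BH.of (_ * _) = evH p q _ * BH.of (_ * _) := h
  have h2 : (genA p q ^ ((wWord p q).map Prod.snd).sum *
      genA p q ^ ((wWord p q).reverse.map Prod.snd).sum) *
      (genA p q ^ (([(0, 1)] : List (Fin 2 × ℤ)).map Prod.snd).sum) ^ (-framing p q) = 1 := by
    rw [List.map_reverse, List.sum_reverse, sum_snd_wWord, ← zpow_add, List.map_singleton,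
      List.sum_singleton, zpow_one, ← zpow_add, framing]
    ring_nf
    exact zpow_zero _
  rw [← evH_comm, elY, longitude, map_mul (toKnotGroup p q)]
  have h3 : toKnotGroup p q (spell [(0, 1)]) = genA p q := by
    simp [spell, genA]
  rw [← h3]
  refine h1.trans ?_
  erw [h2]
  rw [map_one, mul_one]

/-- Modulo the relations `w w̃ = a + b δ`, with `a = P² + J x² S² + I J T²`. The norm equation
eliminates `S`, so `1 + a = 2 P² + 2 I J T² = 2 J T² (I + J) + 2 (P - J T)(P + J T)`, where `I + J =
δ²` and `P - J T` is the defining polynomial. -/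
theorem exists_longitude (hw : IsSignWord (vWord p q)) : ∃ y u v : LIRing,
    evLI p q y = elY p q ∧ 1 + y = C laurentDelta * u + toLI (ijToR (defPoly p q)) * v := by
  set t := palTriple (vWord p q) with ht
  set P := ijToR t.P with hP
  set S := ijToR t.S with hS
  set U := ijToR t.T with hU
  set a : XIRing := P ^ 2 + jR * xR ^ 2 * S ^ 2 + iR * jR * U ^ 2 with ha
  set b : XIRing := 2 * P * xR * S with hb
  have hN : P ^ 2 - jR * xR ^ 2 * S ^ 2 + iR * jR * U ^ 2 = 1 := palTriple_norm _ hw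
  have hQ : ijToR (defPoly p q) = P - jR * U := by
    rw [defPoly, PalTriple.poly, map_sub, map_mul, ijToR_X1]
  -- The framing `s` is even, so `1 - X^{-s} = X^{-s/2} (X^{s/2} - X^{-s/2})` is divisible by `δ`.
  obtain ⟨m, hm⟩ : ∃ m, framing p q = m + m :=
    ⟨2 * ∑ n ∈ Finset.range ((p - 1) / 2), expo p q (n + 1), by rw [framing]; ring⟩
  have hww : evLI p q (toLI a + toLI b * C laurentDelta) =
      BH.of (toKnotGroup p q (spell (wWord p q) * spell (wWord p q).reverse)) := by
    have hw' : IsSignWord ((vWord p q).map fun c => (1 - c.1, c.2)) := by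
      intro c hc
      obtain ⟨c', hc', rfl⟩ := List.mem_map.1 hc
      exact hw c' hc'
    rw [evLI_eq_quatToH, ← quatToH_freeToQuat, map_mul, Submonoid.coe_mul, wWord,
      freeToQuat_palindrome _ hw, switchRev_map_switch, freeToQuat_palindrome _ hw',
      palTriple_switch, ← ht, ← sub_eq_zero, ← map_sub, quatToH_eq_zero_iff hw, mem_quatIdeal]
    simp only [PalTriple.toQuat, ← hP, ← hS, ← hU, map_neg, QuaternionAlgebra.mk_mul_mk,
      QuaternionAlgebra.mk_sub_mk]
    refine ⟨?_, ?_, ?_, ?_⟩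
    · convert dvd_zero _ using 1
      rw [ha]; ring
    · refine ⟨2 * xR * S, ?_⟩
      rw [hb, hQ]; ring
    · convert dvd_zero _ using 1
      rw [hb]; ring
    · convert dvd_zero _ using 1
      ring
  clear_value a b
  -- The witnesses come from `1 + (a + b δ) X^{-s} = (1 + a) X^{-s} + b δ X^{-s} + (1 - X^{-s})`.
  refine ⟨(toLI a + toLI b * C laurentDelta) * C (LaurentPolynomial.T (-framing p q)),
    (C laurentDelta * toLI (2 * jR * U ^ 2) + toLI b) * C (LaurentPolynomial.T (-framing p q)) +
      C (divDiff (LaurentPolynomial.T m) * LaurentPolynomial.T (-m)),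
    toLI (2 * P + 2 * jR * U) * C (LaurentPolynomial.T (-framing p q)), ?_, ?_⟩
  · rw [map_mul, hww, evLI_C, evalX_T, ← map_mul, elY, longitude]
  · have h1 : 1 + a = (iR + jR) * (2 * jR * U ^ 2) +
        ijToR (defPoly p q) * (2 * P + 2 * jR * U) := by
      rw [ha, hQ]
      linear_combination -hN
    have h2 := congrArg toLI h1
    rw [map_add toLI 1 a, map_add toLI (_ * _), map_mul toLI (iR + jR), map_mul toLI (ijToR _),
      map_one, toLI_iR_add_jR] at h2
    have h3 : C laurentDelta * C (divDiff (LaurentPolynomial.T m) * LaurentPolynomial.T (-m)) =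
        1 - C (LaurentPolynomial.T (-framing p q)) := by
      rw [← map_mul, ← mul_assoc, laurentDelta_mul_divDiff, inv_T, sub_mul,
        ← LaurentPolynomial.T_add, ← LaurentPolynomial.T_add, hm, map_sub]
      simp
    linear_combination C (LaurentPolynomial.T (-framing p q)) * h2 - h3

end Longitude

/-! ### Coordinates on the fractional ideal `M` -/

section Coordinates

open Polynomial

variable (p : ℕ) (q : ℤ)

/-- What the module `M` depends on: the kernel of the evaluation `ℂ[X^{±1}][I] → H`, the leading
coefficient of `Q` and the position of the longitude. -/
structure LongitudeDatum (Q : MvPolynomial (Fin 2) ℂ) where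
  Q' : LIRing
  y : LIRing
  u : LIRing
  v : LIRing
  evLI_Q' : evLI p q Q' = elQ p q Q
  invLI_Q' : invLI Q' = Q'
  evLI_eq_zero : ∀ g, evLI p q g = 0 ↔ X * Q' ∣ g
  natDegree_Q' : Q'.natDegree = (p - 1) / 2
  isUnit_Q' : IsUnit Q'.leadingCoeff
  evLI_y : evLI p q y = elY p q
  one_add_y : 1 + y = C laurentDelta * u + Q' * v
  elY_mul : elY p q * elQ p q Q = elQ p q Q

variable {p q}

theorem IsBHPolynomial.nonempty_longitudeDatum {Q : MvPolynomial (Fin 2) ℂ}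
    (hQ : IsBHPolynomial p q Q) (hp : 3 ≤ p) (hw : IsSignWord (vWord p q)) :
    Nonempty (LongitudeDatum p q Q) := by
  obtain ⟨c, hc, h⟩ := hQ.exists_eq_mul hp hw
  obtain ⟨y, u, v, hy, hyuv⟩ := exists_longitude hw
  obtain ⟨r, hr, hd, hlc⟩ := defPoly_hasTop (q := q) hp
  have h' : toLI (ijToR Q) = C (LaurentPolynomial.C c) * toLI (ijToR (defPoly p q)) := by
    rw [h, map_mul, toLI_C, xToLaurent_C]
  have hcc : (LaurentPolynomial.C c : ℂ[T;T⁻¹]) * LaurentPolynomial.C c⁻¹ = 1 := by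
    rw [← map_mul, mul_inv_cancel₀ hc, map_one]
  have hu : IsUnit (C (LaurentPolynomial.C c) : LIRing) :=
    (IsUnit.of_mul_eq_one _ hcc).map C
  have hunit : IsUnit (LaurentPolynomial.C c * LaurentPolynomial.C r : ℂ[T;T⁻¹]) := by
    refine IsUnit.of_mul_eq_one (LaurentPolynomial.C (c⁻¹ * r⁻¹)) ?_
    rw [← map_mul, ← map_mul, mul_mul_mul_comm, mul_inv_cancel₀ hc, mul_inv_cancel₀ hr, one_mul,
      map_one]
  have hcoeff : (toLI (ijToR Q)).coeff ((p - 1) / 2) =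
      LaurentPolynomial.C c * LaurentPolynomial.C r := by
    rw [h', coeff_C_mul, toLI, coe_mapRingHom, coeff_map, hlc, xToLaurent_C]
  have hdeg : (toLI (ijToR Q)).natDegree = (p - 1) / 2 := by
    refine natDegree_eq_of_le_of_coeff_ne_zero ?_ (hcoeff ▸ hunit.ne_zero)
    rw [h']
    exact (natDegree_C_mul_le _ _).trans (natDegree_map_le.trans hd)
  exact ⟨{
    Q' := toLI (ijToR Q)
    y := y
    u := u
    -- The factor `c⁻¹` compensates for `Q` being `c` times the defining polynomial.
    v := C (LaurentPolynomial.C c⁻¹) * v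
    evLI_Q' := by rw [evLI_toLI, elQ_eq]
    invLI_Q' := invLI_toLI _
    evLI_eq_zero := fun g => by
      rw [evLI_eq_zero_iff hw, h', mul_left_comm, hu.mul_left_dvd]
    natDegree_Q' := hdeg
    isUnit_Q' := by rw [leadingCoeff, hdeg, hcoeff]; exact hunit
    evLI_y := hy
    one_add_y := by
      rw [hyuv, h']
      have h2 := congrArg (C : ℂ[T;T⁻¹] → LIRing) hcc
      rw [map_mul, map_one] at h2
      linear_combination -(toLI (ijToR (defPoly p q)) * v) * h2
    elY_mul := by
      rw [elQ_eq, h, map_mul, ← mul_assoc, ← evH_comm p q (C (C c)) (elY p q),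
        mul_assoc, elY_mul_defPoly hw] }⟩

/-- The remainder modulo a monic polynomial is linear over the coefficients. Applied to powers of
`δ`, this shows that localization loses nothing on `H⁺[X^{±1}]`. -/
theorem dvd_of_dvd_C_mul {R : Type*} [CommRing R] [IsDomain R] {m g : Polynomial R} {c : R}
    (hm : IsUnit m.leadingCoeff) (hc : c ≠ 0) (h : m ∣ C c * g) : m ∣ g := by
  obtain ⟨w, hw⟩ := hm.exists_left_inv
  have hmon : (C w * m).Monic := by
    rw [Monic, leadingCoeff_mul, leadingCoeff_C, hw]
  have hu : IsUnit (C w : Polynomial R) := (IsUnit.of_mul_eq_one _ hw).map C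
  rw [← hu.mul_left_dvd] at h ⊢
  rw [← modByMonic_eq_zero_iff_dvd hmon] at h ⊢
  rw [← smul_eq_C_mul, smul_modByMonic, smul_eq_zero] at h
  exact h.resolve_left hc

/-! The localization. -/

theorem toLoc_eq_zero {h : H p q} (hh : toLoc p q h = 0) : ∃ n : ℕ, delta p q ^ n * h = 0 := by
  have h1 : (h /ₒ (1 : Submonoid.powers (delta p q)) :
      OreLocalization (Submonoid.powers (delta p q)) (H p q)) = 0 := hh
  rw [OreLocalization.zero_def, eq_comm, OreLocalization.oreDiv_eq_iff] at h1
  obtain ⟨u, v, h1, h2⟩ := h1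
  obtain ⟨n, hn⟩ := u.2
  refine ⟨n, ?_⟩
  have hv : (u : H p q) = v := by simpa using h2
  have h3 : (u : H p q) * h = 0 := by simpa [hv, Submonoid.smul_def] using h1
  rw [← h3, ← hn]

theorem conjLoc_add (z w : HLoc p q) : conjLoc p q (z + w) = conjLoc p q z + conjLoc p q w := by
  simp [conjLoc]

theorem conjLoc_mul (z w : HLoc p q) : conjLoc p q (z * w) = conjLoc p q w * conjLoc p q z := by
  simp [conjLoc]

theorem conjLoc_deltaInv : conjLoc p q (deltaInv p q) = -deltaInv p q := by
  have h : conjLoc p q (deltaInv p q) * -toLoc p q (delta p q) = 1 := by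
    have h1 := congrArg (conjLoc p q) (mul_deltaInv p q)
    rw [conjLoc_mul, conjLoc_toLoc, conj_delta_eq, map_neg] at h1
    rw [h1, ← map_one (toLoc p q), conjLoc_toLoc]
    simp [BH.conj]
  have h2 : -toLoc p q (delta p q) * -deltaInv p q = 1 := by
    rw [neg_mul_neg, mul_deltaInv]
  exact left_inv_eq_right_inv h h2

/-! ### The elements `g + c Q δ⁻¹` of `H[δ⁻¹]` -/

variable (p q)

/-- Evaluation `ℂ[X^{±1}][I] → H[δ⁻¹]`. -/
noncomputable def evLoc : LIRing →+* HLoc p q := (toLoc p q).toRingHom.comp (evLI p q)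

variable {p q}

theorem evLoc_apply (g : LIRing) : evLoc p q g = toLoc p q (evLI p q g) := rfl

theorem evLoc_comm (f g : LIRing) : evLoc p q f * evLoc p q g = evLoc p q g * evLoc p q f := by
  rw [← map_mul, mul_comm, map_mul]

theorem evLoc_C_mul (f : ℂ[T;T⁻¹]) (z : HLoc p q) : evLoc p q (C f) * z = f • z := by
  rw [smul_def', evLoc_apply, evLI_C]

theorem evLoc_delta : evLoc p q (C laurentDelta) = toLoc p q (delta p q) := by
  rw [evLoc_apply, evLI_C, evalX_laurentDelta]

theorem evLoc_mul_deltaInv (g : LIRing) :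
    evLoc p q g * deltaInv p q = deltaInv p q * evLoc p q g := by
  have h1 : evLoc p q (C laurentDelta) * deltaInv p q = 1 := by rw [evLoc_delta, mul_deltaInv]
  have h2 : deltaInv p q * evLoc p q (C laurentDelta) = 1 := by rw [evLoc_delta, deltaInv_mul]
  calc evLoc p q g * deltaInv p q
      = deltaInv p q * evLoc p q (C laurentDelta) * (evLoc p q g * deltaInv p q) := by
        rw [h2, one_mul]
    _ = deltaInv p q * (evLoc p q (C laurentDelta) * evLoc p q g) * deltaInv p q := by
        simp only [mul_assoc]
    _ = _ := by rw [evLoc_comm, mul_assoc, mul_assoc, h1, mul_one]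

theorem laurentDelta_smul (z : HLoc p q) : laurentDelta • z = toLoc p q (delta p q) * z := by
  rw [← evLoc_C_mul, evLoc_delta]

theorem laurentDelta_smul_deltaInv_mul (z : HLoc p q) :
    laurentDelta • (deltaInv p q * z) = z := by
  rw [laurentDelta_smul, ← mul_assoc, mul_deltaInv, one_mul]

theorem laurentDelta_smul_cancel {z w : HLoc p q} (h : laurentDelta • z = laurentDelta • w) :
    z = w := by
  rw [laurentDelta_smul, laurentDelta_smul] at h
  have h' := congrArg (fun z => deltaInv p q * z) h
  simpa only [← mul_assoc, deltaInv_mul, one_mul] using h'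

theorem conjLoc_evLoc (g : LIRing) : conjLoc p q (evLoc p q g) = evLoc p q (invLI g) := by
  rw [evLoc_apply, conjLoc_toLoc, conj_evLI, evLoc_apply]

/-- The element `g + c Q δ⁻¹` of `H[δ⁻¹]`. -/
noncomputable def coord (Q : MvPolynomial (Fin 2) ℂ) (g : LIRing) (c : ℂ[T;T⁻¹]) : HLoc p q :=
  evLoc p q g + c • Qdelta p q Q

theorem coord_add (Q : MvPolynomial (Fin 2) ℂ) (g g' : LIRing) (c c' : ℂ[T;T⁻¹]) :
    (coord Q g c + coord Q g' c' : HLoc p q) = coord Q (g + g') (c + c') := by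
  rw [coord, coord, coord, map_add, add_smul]
  abel

theorem smul_coord (Q : MvPolynomial (Fin 2) ℂ) (f : ℂ[T;T⁻¹]) (g : LIRing) (c : ℂ[T;T⁻¹]) :
    (f • coord Q g c : HLoc p q) = coord Q (C f * g) (f * c) := by
  rw [coord, coord, smul_add, smul_smul, map_mul, evLoc_C_mul]

namespace LongitudeDatum

variable {Q : MvPolynomial (Fin 2) ℂ}

theorem Qdelta_eq (𝓛 : LongitudeDatum p q Q) : Qdelta p q Q = evLoc p q 𝓛.Q' * deltaInv p q := by
  rw [Qdelta, evLoc_apply, 𝓛.evLI_Q']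

theorem delta_smul_Qdelta (𝓛 : LongitudeDatum p q Q) :
    laurentDelta • Qdelta p q Q = evLoc p q 𝓛.Q' := by
  rw [𝓛.Qdelta_eq, evLoc_mul_deltaInv, laurentDelta_smul_deltaInv_mul]

/-- `I Q = 0`, so only the constant term of `g` in `I` acts on `Q δ⁻¹`. -/
theorem evLoc_mul_Qdelta (𝓛 : LongitudeDatum p q Q) (g : LIRing) :
    evLoc p q g * Qdelta p q Q = g.coeff 0 • Qdelta p q Q := by
  have h : evLoc p q (X * 𝓛.Q') = 0 := by
    rw [evLoc_apply, (𝓛.evLI_eq_zero _).2 dvd_rfl, map_zero]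
  have h' : evLoc p q X * Qdelta p q Q = 0 := by
    rw [𝓛.Qdelta_eq, ← mul_assoc, ← map_mul, h, zero_mul]
  conv_lhs => rw [← divX_mul_X_add g]
  rw [map_add, add_mul, map_mul, mul_assoc, h', mul_zero, zero_add, evLoc_C_mul]

/-- `Q h = δ h (Q δ⁻¹)`, and `h` acts on `Q δ⁻¹` by its constant term. This trades multiples of `Q`
for multiples of `Q δ⁻¹`. -/
theorem coord_Q_mul (𝓛 : LongitudeDatum p q Q) (h : LIRing) (c : ℂ[T;T⁻¹]) :
    (coord Q (𝓛.Q' * h) c : HLoc p q) = coord Q 0 (c + laurentDelta * h.coeff 0) := by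
  rw [coord, coord, mul_comm, map_mul, ← 𝓛.delta_smul_Qdelta, ← evLoc_C_mul laurentDelta,
    ← mul_assoc, evLoc_comm, mul_assoc, 𝓛.evLoc_mul_Qdelta, evLoc_C_mul, smul_smul, map_zero,
    zero_add, add_smul, add_comm]

theorem coord_eq_zero_iff (𝓛 : LongitudeDatum p q Q) (g : LIRing) (c : ℂ[T;T⁻¹]) :
    (coord Q g c : HLoc p q) = 0 ↔
    X * 𝓛.Q' ∣ C laurentDelta * g + C c * 𝓛.Q' := by
  have h : laurentDelta • (coord Q g c : HLoc p q) =
      evLoc p q (C laurentDelta * g + C c * 𝓛.Q') := by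
    rw [coord, smul_add, smul_comm, 𝓛.delta_smul_Qdelta, map_add, map_mul, map_mul, evLoc_C_mul,
      evLoc_C_mul]
  constructor
  · intro h0
    rw [h0, smul_zero, evLoc_apply] at h
    obtain ⟨n, hn⟩ := toLoc_eq_zero h.symm
    rw [← evalX_laurentDelta, ← evLI_C, ← map_pow, ← map_mul, 𝓛.evLI_eq_zero, ← map_pow] at hn
    refine dvd_of_dvd_C_mul ?_ (pow_ne_zero n laurentDelta_ne_zero) hn
    rw [leadingCoeff_mul, leadingCoeff_X, one_mul]
    exact 𝓛.isUnit_Q'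
  · intro hd
    apply laurentDelta_smul_cancel
    rw [h, smul_zero, evLoc_apply, (𝓛.evLI_eq_zero _).2 hd, map_zero]

theorem mem_M_iff (𝓛 : LongitudeDatum p q Q) (z : HLoc p q) :
    z ∈ M p q Q ↔ ∃ g c, z = coord Q g c := by
  constructor
  · rintro ⟨u, hu, v, hv, rfl⟩
    obtain ⟨g, rfl⟩ := (mem_HplusX_iff _).1 hu
    obtain ⟨g', rfl⟩ := (mem_HplusX_iff _).1 hv
    refine ⟨g, g'.coeff 0, ?_⟩
    rw [coord, ← 𝓛.evLoc_mul_Qdelta]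
    rfl
  · rintro ⟨g, c, rfl⟩
    exact ⟨_, (mem_HplusX_iff _).2 ⟨g, rfl⟩, _, evalX_mem p q c, rfl⟩

theorem conjLoc_coord (𝓛 : LongitudeDatum p q Q) (g : LIRing) (c : ℂ[T;T⁻¹]) :
    conjLoc p q (coord Q g c) = coord Q (invLI g) (-inv c) := by
  have h : conjLoc p q (c • Qdelta p q Q) = -(inv c • Qdelta p q Q) := by
    rw [← evLoc_C_mul, ← evLoc_C_mul, conjLoc_mul, conjLoc_evLoc, 𝓛.Qdelta_eq, conjLoc_mul,
      conjLoc_deltaInv, conjLoc_evLoc, 𝓛.invLI_Q', invLI_C, neg_mul, neg_mul, ← evLoc_mul_deltaInv,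
      mul_assoc, ← evLoc_mul_deltaInv, ← mul_assoc, evLoc_comm, mul_assoc]
  rw [coord, coord, conjLoc_add, conjLoc_evLoc, h, neg_smul]

theorem Y_mul_coord (𝓛 : LongitudeDatum p q Q) (g : LIRing) (c : ℂ[T;T⁻¹]) :
    toLoc p q (elY p q) * coord Q g c = coord Q (𝓛.y * g) c := by
  have h1 : toLoc p q (elY p q) = evLoc p q 𝓛.y := by rw [evLoc_apply, 𝓛.evLI_y]
  have h2 : toLoc p q (elY p q) * Qdelta p q Q = Qdelta p q Q := by
    rw [Qdelta, ← mul_assoc, ← map_mul, 𝓛.elY_mul]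
  rw [coord, coord, mul_add, h1, ← map_mul, ← evLoc_C_mul, ← mul_assoc, evLoc_comm, mul_assoc,
    ← h1, h2]

theorem Yinv_mul_Y (𝓛 : LongitudeDatum p q Q) : evLI p q (invLI 𝓛.y * 𝓛.y) = 1 := by
  rw [map_mul, ← conj_evLI, 𝓛.evLI_y, elY, BH.conj_of, ← map_mul, inv_mul_cancel, map_one]

theorem coord_Yinv_Y_mul (𝓛 : LongitudeDatum p q Q) (g : LIRing) (c : ℂ[T;T⁻¹]) :
    (coord Q (invLI 𝓛.y * (𝓛.y * g)) c : HLoc p q) = coord Q g c := by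
  rw [coord, coord, ← mul_assoc, map_mul, evLoc_apply _, 𝓛.Yinv_mul_Y, map_one, one_mul]

/-- Writing `ḡ` for `g` with `X ↦ X⁻¹`, the right-hand side is `(g - ḡ) + (1 + ȳ) ḡ + (c - c̄) Q
δ⁻¹`. The outer terms are divisible by `δ` through divided differences. In the middle, `1 + ȳ = -δ ū
+ Q v̄`, and the part containing `Q` is a multiple of `δ` by `coord_Q_mul`. -/
theorem coord_dunkl (𝓛 : LongitudeDatum p q Q) (g : LIRing) (c : ℂ[T;T⁻¹]) :
    ∃ g' c', laurentDelta • (coord Q g' c') =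
    (coord Q g c + conjLoc p q (toLoc p q (elY p q) * coord Q g c) : HLoc p q) := by
  obtain ⟨e, he⟩ := exists_divDiffLI g
  refine ⟨e - invLI 𝓛.u * invLI g, divDiff c + (invLI 𝓛.v * invLI g).coeff 0, ?_⟩
  have h := congrArg invLI 𝓛.one_add_y
  rw [map_add, map_add, map_mul, map_mul, map_one, invLI_C, inv_laurentDelta, map_neg,
    𝓛.invLI_Q'] at h
  have h1 : g + invLI 𝓛.y * invLI g = C laurentDelta * (e - invLI 𝓛.u * invLI g) +
      𝓛.Q' * (invLI 𝓛.v * invLI g) := by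
    linear_combination invLI g * h - he
  rw [𝓛.Y_mul_coord, 𝓛.conjLoc_coord, coord_add, map_mul, h1, smul_coord, mul_add,
    laurentDelta_mul_divDiff, ← sub_eq_add_neg c, ← add_zero (c - inv c), ← coord_add,
    𝓛.coord_Q_mul, coord_add, add_zero, add_zero, zero_add]

end LongitudeDatum

end Coordinates

/-! ### The module `M` and its quotient -/

namespace LongitudeDatum

open Polynomial

variable {p : ℕ} {q : ℤ} {Q : MvPolynomial (Fin 2) ℂ}

theorem exists_coord (𝓛 : LongitudeDatum p q Q) (m : M p q Q) :
    ∃ g c, (m : HLoc p q) = coord Q g c :=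
  (𝓛.mem_M_iff _).1 m.2

theorem coord_mem (𝓛 : LongitudeDatum p q Q) (g : LIRing) (c : ℂ[T;T⁻¹]) :
    (coord Q g c : HLoc p q) ∈ M p q Q :=
  (𝓛.mem_M_iff _).2 ⟨g, c, rfl⟩

theorem Yinv_mul_coord (𝓛 : LongitudeDatum p q Q) (g : LIRing) (c : ℂ[T;T⁻¹]) :
    toLoc p q (BH.of (longitude p q)⁻¹) * coord Q g c = coord Q (invLI 𝓛.y * g) c := by
  have h1 : toLoc p q (BH.of (longitude p q)⁻¹) * toLoc p q (elY p q) = 1 := by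
    rw [elY, ← map_mul, ← map_mul, inv_mul_cancel, map_one, map_one]
  have h2 : (coord Q g c : HLoc p q) = toLoc p q (elY p q) * coord Q (invLI 𝓛.y * g) c := by
    rw [𝓛.Y_mul_coord, mul_left_comm, 𝓛.coord_Yinv_Y_mul]
  rw [h2, ← mul_assoc, h1, one_mul]

/-- The action of `ℂ[X^{±1}, Y^{±1}] ⋊ ℤ/2` on `M`. -/
noncomputable def torusModule (𝓛 : LongitudeDatum p q Q) : TorusModule (M p q Q) where
  Y :=
    { toFun := fun m => ⟨toLoc p q (elY p q) * m, by
        obtain ⟨g, c, h⟩ := 𝓛.exists_coord m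
        rw [h, 𝓛.Y_mul_coord]
        exact 𝓛.coord_mem _ _⟩
      invFun := fun m => ⟨toLoc p q (BH.of (longitude p q)⁻¹) * m, by
        obtain ⟨g, c, h⟩ := 𝓛.exists_coord m
        rw [h, 𝓛.Yinv_mul_coord]
        exact 𝓛.coord_mem _ _⟩
      map_add' := fun m m' => Subtype.ext (mul_add _ _ _)
      map_smul' := fun f m => by
        obtain ⟨g, c, h⟩ := 𝓛.exists_coord m
        apply Subtype.ext
        change toLoc p q (elY p q) * (f • (m : HLoc p q)) = f • (toLoc p q (elY p q) * m)
        rw [h, smul_coord, 𝓛.Y_mul_coord, 𝓛.Y_mul_coord, smul_coord, mul_left_comm]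
      left_inv := fun m => by
        apply Subtype.ext
        change toLoc p q (BH.of (longitude p q)⁻¹) * (toLoc p q (elY p q) * m) = m
        rw [← mul_assoc, elY, ← map_mul, ← map_mul, inv_mul_cancel, map_one, map_one, one_mul]
      right_inv := fun m => by
        apply Subtype.ext
        change toLoc p q (elY p q) * (toLoc p q (BH.of (longitude p q)⁻¹) * m) = m
        rw [← mul_assoc, elY, ← map_mul, ← map_mul, mul_inv_cancel, map_one, map_one, one_mul] }
  s :=
    { toFun := fun m => ⟨conjLoc p q m, by
        obtain ⟨g, c, h⟩ := 𝓛.exists_coord m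
        rw [h, 𝓛.conjLoc_coord]
        exact 𝓛.coord_mem _ _⟩
      map_add' := fun m m' => Subtype.ext (conjLoc_add _ _)
      map_smul' := fun f m => by
        obtain ⟨g, c, h⟩ := 𝓛.exists_coord m
        apply Subtype.ext
        change conjLoc p q (f • (m : HLoc p q)) = inv f • conjLoc p q m
        rw [h, smul_coord, 𝓛.conjLoc_coord, 𝓛.conjLoc_coord, smul_coord, map_mul, map_mul, invLI_C,
          mul_neg] }
  s_s m := by
    obtain ⟨g, c, h⟩ := 𝓛.exists_coord m
    apply Subtype.ext
    change conjLoc p q (conjLoc p q m) = m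
    have h1 : invLI (invLI g) = g := by
      have h2 : inv.comp inv = RingHom.id ℂ[T;T⁻¹] := RingHom.ext inv_inv_apply
      rw [invLI, ← RingHom.comp_apply, mapRingHom_comp, h2, mapRingHom_id, RingHom.id_apply]
    rw [h, 𝓛.conjLoc_coord, 𝓛.conjLoc_coord, map_neg, neg_neg, inv_inv_apply, h1]
  s_Y m := by
    obtain ⟨g, c, h⟩ := 𝓛.exists_coord m
    apply Subtype.ext
    change conjLoc p q (toLoc p q (elY p q) * m) =
      toLoc p q (BH.of (longitude p q)⁻¹) * conjLoc p q m
    rw [h, 𝓛.Y_mul_coord, 𝓛.conjLoc_coord, 𝓛.conjLoc_coord, 𝓛.Yinv_mul_coord, map_mul]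

theorem coe_Y (𝓛 : LongitudeDatum p q Q) (m : M p q Q) :
    (𝓛.torusModule.Y m : HLoc p q) = toLoc p q (elY p q) * m := rfl

theorem coe_s (𝓛 : LongitudeDatum p q Q) (m : M p q Q) :
    (𝓛.torusModule.s m : HLoc p q) = conjLoc p q m := rfl

theorem M_cancel {m m' : M p q Q} (h : laurentDelta • m = laurentDelta • m') : m = m' :=
  Subtype.ext (laurentDelta_smul_cancel (congrArg Subtype.val h))

theorem exists_dunkl (𝓛 : LongitudeDatum p q Q) (m : M p q Q) :
    ∃ m', laurentDelta • m' = m + 𝓛.torusModule.s (𝓛.torusModule.Y m) := by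
  obtain ⟨g, c, h⟩ := 𝓛.exists_coord m
  obtain ⟨g', c', h'⟩ := 𝓛.coord_dunkl g c
  refine ⟨⟨coord Q g' c', 𝓛.coord_mem _ _⟩, Subtype.ext ?_⟩
  rw [← h] at h'
  exact h'

/-- For `z = g + c Q δ⁻¹` one has `z + s z = g + ḡ + (c - c̄) Q δ⁻¹`. As `c - c̄` is divisible by
`δ`, the denominator disappears and an invariant `z` lies in the image of `H⁺`. -/
theorem invariant_iff (𝓛 : LongitudeDatum p q Q) (z : HLoc p q) :
    (z ∈ M p q Q ∧ conjLoc p q z = z) ↔ ∃ h, BH.conj h = h ∧ z = toLoc p q h := by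
  constructor
  · rintro ⟨hz, hs⟩
    obtain ⟨g, c, h⟩ := (𝓛.mem_M_iff _).1 hz
    have h1 : (2 : ℂ) • z = evLoc p q (g + invLI g + C (divDiff c) * 𝓛.Q') := by
      have h2 : (2 : ℂ) • z = coord Q (g + invLI g) (laurentDelta * divDiff c) := by
        rw [two_smul]
        nth_rewrite 2 [← hs]
        rw [h, 𝓛.conjLoc_coord, coord_add, laurentDelta_mul_divDiff, sub_eq_add_neg]
      rw [h2, coord, mul_comm, mul_smul, 𝓛.delta_smul_Qdelta, map_add _ (g + _), map_mul,
        evLoc_C_mul]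
    have h3 : invLI (invLI g) = g := by
      have h2 : inv.comp inv = RingHom.id ℂ[T;T⁻¹] := RingHom.ext inv_inv_apply
      rw [invLI, ← RingHom.comp_apply, mapRingHom_comp, h2, mapRingHom_id, RingHom.id_apply]
    refine ⟨(1 / 2 : ℂ) • evLI p q (g + invLI g + C (divDiff c) * 𝓛.Q'), ?_, ?_⟩
    · have h4 : invLI (g + invLI g + C (divDiff c) * 𝓛.Q') =
          g + invLI g + C (divDiff c) * 𝓛.Q' := by
        rw [map_add invLI, map_add invLI, map_mul invLI, invLI_C, inv_divDiff, 𝓛.invLI_Q', h3,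
          add_comm (invLI g)]
      rw [BH.conj_smul, conj_evLI, h4]
    · rw [map_smul, ← evLoc_apply, ← h1, smul_smul]
      norm_num
  · rintro ⟨h, hh, rfl⟩
    obtain ⟨f, rfl⟩ := exists_evH_of_conj_eq hh
    refine ⟨?_, by rw [conjLoc_toLoc, hh]⟩
    have h1 : toLoc p q (evH p q f) = coord Q (toLI f) 0 := by
      rw [coord, zero_smul, add_zero, evLoc_apply, evLI_toLI]
    rw [h1]
    exact 𝓛.coord_mem _ _

/-- The basis vectors `1, I, …, I^{d-1}, Q δ⁻¹` of `M`. -/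
noncomputable def basisVector (𝓛 : LongitudeDatum p q Q) :
    Option (Fin ((p - 1) / 2)) → M p q Q
  | none => ⟨Qdelta p q Q, Qdelta_mem p q Q⟩
  | some n => ⟨coord Q (X ^ (n : ℕ)) 0, 𝓛.coord_mem _ _⟩

theorem sum_basisVector (𝓛 : LongitudeDatum p q Q)
    (f : Option (Fin ((p - 1) / 2)) → ℂ[T;T⁻¹]) :
    ((∑ i, f i • 𝓛.basisVector i : M p q Q) : HLoc p q) =
      coord Q (∑ n : Fin ((p - 1) / 2), C (f (some n)) * X ^ (n : ℕ)) (f none) := by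
  rw [Fintype.sum_option, coord, map_sum, add_comm]
  simp only [Submodule.coe_add, AddSubmonoidClass.coe_finsetSum, Submodule.coe_smul, map_mul,
    evLoc_C_mul]
  simp [basisVector, coord]

/-- A relation makes `I Q`, of degree `d + 1` in `I`, divide `δ s + c Q`, of degree at most `d`; so
the latter is zero. Its coefficient at `I^d` is `c` times the leading coefficient of `Q`, a unit, so
`c = 0` and then `s = 0`. -/
theorem linearIndependent_basisVector (𝓛 : LongitudeDatum p q Q) :
    LinearIndependent ℂ[T;T⁻¹] 𝓛.basisVector := by
  rw [Fintype.linearIndependent_iff]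
  intro f hf
  have h1 := congrArg Subtype.val hf
  rw [𝓛.sum_basisVector, Submodule.coe_zero, 𝓛.coord_eq_zero_iff] at h1
  set s : LIRing := ∑ n : Fin ((p - 1) / 2), C (f (some n)) * X ^ (n : ℕ) with hs
  have hdeg : s.degree < ((p - 1) / 2 : ℕ) := by
    refine (degree_sum_le _ _).trans_lt ((Finset.sup_lt_iff (WithBot.bot_lt_coe _)).2 fun n _ => ?_)
    exact (degree_C_mul_X_pow_le _ _).trans_lt (by exact_mod_cast n.2)
  have hcoeff : ∀ n : Fin ((p - 1) / 2), s.coeff n = f (some n) := by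
    intro n
    rw [hs, finsetSum_coeff]
    simp only [coeff_C_mul, coeff_X_pow]
    rw [Finset.sum_eq_single n]
    · simp
    · intro m _ hm
      rw [if_neg (by rw [Fin.val_inj]; exact Ne.symm hm), mul_zero]
    · simp
  have hX : (X * 𝓛.Q').natDegree = (p - 1) / 2 + 1 := by
    have h0 : 𝓛.Q' ≠ 0 := by
      intro h0
      have := 𝓛.isUnit_Q'
      rw [h0, leadingCoeff_zero] at this
      exact not_isUnit_zero this
    rw [natDegree_X_mul h0, 𝓛.natDegree_Q']
  have h2 : C laurentDelta * s + C (f none) * 𝓛.Q' = 0 := by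
    by_contra hne
    have h3 := natDegree_le_of_dvd h1 hne
    rw [hX] at h3
    have h4 : (C laurentDelta * s + C (f none) * 𝓛.Q').natDegree ≤ (p - 1) / 2 := by
      refine natDegree_add_le_of_degree_le ?_ ?_
      · exact (natDegree_C_mul_le _ _).trans (natDegree_le_of_degree_le hdeg.le)
      · exact (natDegree_C_mul_le _ _).trans 𝓛.natDegree_Q'.le
    omega
  have h3 : f none = 0 := by
    have h4 := congrArg (fun g => g.coeff ((p - 1) / 2)) h2
    simp only [coeff_add, coeff_C_mul, coeff_zero] at h4
    have h5 := 𝓛.isUnit_Q'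
    rw [leadingCoeff, 𝓛.natDegree_Q'] at h5
    rwa [coeff_eq_zero_of_degree_lt hdeg, mul_zero, zero_add, h5.mul_left_eq_zero] at h4
  rintro (_ | n)
  · exact h3
  · rw [h3, map_zero, zero_mul, add_zero] at h2
    have h4 := congrArg (fun g => g.coeff n) h2
    simp only [coeff_C_mul, coeff_zero, hcoeff] at h4
    exact (mul_eq_zero.1 h4).resolve_left laurentDelta_ne_zero

theorem exists_lt_degree (𝓛 : LongitudeDatum p q Q) (g : LIRing) :
    ∃ r h, g = r + 𝓛.Q' * h ∧ r.degree < ((p - 1) / 2 : ℕ) := by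
  obtain ⟨w, hw⟩ := 𝓛.isUnit_Q'.exists_left_inv
  have hmon : (C w * 𝓛.Q').Monic := by
    rw [Monic, leadingCoeff_mul, leadingCoeff_C, hw]
  refine ⟨g %ₘ (C w * 𝓛.Q'), C w * (g /ₘ (C w * 𝓛.Q')), ?_, ?_⟩
  · conv_lhs => rw [← modByMonic_add_div g (C w * 𝓛.Q')]
    ring
  · refine (degree_modByMonic_lt g hmon).trans_le (degree_le_of_natDegree_le ?_)
    exact (natDegree_C_mul_le _ _).trans 𝓛.natDegree_Q'.le

/-- Divide `g` by `Q`: the remainder involves `1, …, I^{d-1}`, and by `coord_Q_mul` the multiple of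
`Q` is absorbed into the coefficient of `Q δ⁻¹`. -/
theorem span_basisVector (𝓛 : LongitudeDatum p q Q) :
    ⊤ ≤ Submodule.span ℂ[T;T⁻¹] (Set.range 𝓛.basisVector) := by
  intro m _
  obtain ⟨g, c, h⟩ := 𝓛.exists_coord m
  obtain ⟨r, k, rfl, hr⟩ := 𝓛.exists_lt_degree g
  rw [Submodule.mem_span_range_iff_exists_fun]
  refine ⟨fun i => i.elim (c + laurentDelta * k.coeff 0) (fun n => r.coeff n), Subtype.ext ?_⟩
  rw [𝓛.sum_basisVector, h]
  simp only [Option.elim_some, Option.elim_none]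
  have h1 : ∑ n : Fin ((p - 1) / 2), C (r.coeff n) * X ^ (n : ℕ) = r := by
    rw [Fin.sum_univ_eq_sum_range (fun n => C (r.coeff n) * X ^ n)]
    simp only [C_mul_X_pow_eq_monomial]
    rcases eq_or_ne r 0 with rfl | h0
    · simp
    · exact (as_sum_range' r _ ((natDegree_lt_iff_degree_lt h0).2 hr)).symm
  rw [h1, ← zero_add c, ← coord_add, 𝓛.coord_Q_mul, coord_add]
  simp

/-- The basis `1, I, …, I^{d-1}, Q δ⁻¹` of `M`. -/
noncomputable def basis (𝓛 : LongitudeDatum p q Q) :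
    Module.Basis (Option (Fin ((p - 1) / 2))) ℂ[T;T⁻¹] (M p q Q) :=
  Module.Basis.mk 𝓛.linearIndependent_basisVector 𝓛.span_basisVector

theorem basis_none (𝓛 : LongitudeDatum p q Q) :
    𝓛.basis none = ⟨Qdelta p q Q, Qdelta_mem p q Q⟩ := by
  rw [basis, Module.Basis.mk_apply, basisVector]

theorem coe_basis_some (𝓛 : LongitudeDatum p q Q) (n : Fin ((p - 1) / 2)) :
    (𝓛.basis (some n) : HLoc p q) = toLoc p q ((qi p q * qi p q) ^ (n : ℕ)) := by
  rw [basis, Module.Basis.mk_apply]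
  change coord Q (X ^ (n : ℕ)) 0 = _
  rw [coord, zero_smul, add_zero, map_pow, map_pow, evLoc_apply, evLI_X]

theorem mem_M₀_iff (𝓛 : LongitudeDatum p q Q) (m : M p q Q) :
    m ∈ M₀ p q Q ↔ ∃ f : ℂ[T;T⁻¹], f • 𝓛.basis none = m := by
  rw [M₀, Submodule.mem_span_singleton, basis_none]

/-- The basis `1, I, …, I^{d-1}` of `M / M₀`. -/
noncomputable def basisBar (𝓛 : LongitudeDatum p q Q) :
    Module.Basis (Fin ((p - 1) / 2)) ℂ[T;T⁻¹] (Mbar p q Q) :=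
  Module.Basis.mk (v := fun n => (M₀ p q Q).mkQ (𝓛.basis (some n)))
    (by
      rw [Fintype.linearIndependent_iff]
      intro f hf n
      simp only [← map_smul, ← map_sum] at hf
      rw [Submodule.mkQ_apply, Submodule.Quotient.mk_eq_zero, 𝓛.mem_M₀_iff] at hf
      obtain ⟨c, hc⟩ := hf
      have h := Fintype.linearIndependent_iff.1 𝓛.basis.linearIndependent
        (fun i => i.elim (-c) f) (by
          rw [Fintype.sum_option]
          simp only [Option.elim_none, Option.elim_some]
          rw [← hc, neg_smul, neg_add_cancel])
      exact h (some n))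
    (by
      intro z _
      obtain ⟨m, rfl⟩ := (M₀ p q Q).mkQ_surjective z
      rw [Submodule.mem_span_range_iff_exists_fun]
      refine ⟨fun n => 𝓛.basis.repr m (some n), ?_⟩
      have h0 : (M₀ p q Q).mkQ (𝓛.basis none) = 0 := by
        rw [Submodule.mkQ_apply, Submodule.Quotient.mk_eq_zero, 𝓛.mem_M₀_iff]
        exact ⟨1, one_smul _ _⟩
      conv_rhs => rw [← 𝓛.basis.sum_repr m]
      rw [Fintype.sum_option, map_add, map_smul, h0, smul_zero, zero_add, map_sum]
      simp only [map_smul])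

theorem basisBar_apply (𝓛 : LongitudeDatum p q Q) (n : Fin ((p - 1) / 2)) :
    𝓛.basisBar n = (M₀ p q Q).mkQ (𝓛.basis (some n)) := by
  rw [basisBar, Module.Basis.mk_apply]

theorem Y_basis_none (𝓛 : LongitudeDatum p q Q) :
    𝓛.torusModule.Y (𝓛.basis none) = 𝓛.basis none := by
  apply Subtype.ext
  rw [coe_Y, basis_none]
  change toLoc p q (elY p q) * Qdelta p q Q = Qdelta p q Q
  rw [Qdelta, ← mul_assoc, ← map_mul, 𝓛.elY_mul]

theorem s_basis_none (𝓛 : LongitudeDatum p q Q) :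
    𝓛.torusModule.s (𝓛.basis none) = -𝓛.basis none := by
  apply Subtype.ext
  have h : (𝓛.basis none : HLoc p q) = coord Q 0 1 := by
    rw [basis_none, coord, map_zero, zero_add, one_smul]
  rw [coe_s, Submodule.coe_neg, h, 𝓛.conjLoc_coord, coord, coord, map_zero, map_zero, map_one,
    zero_add, zero_add, neg_smul]

theorem map_Y_M₀ (𝓛 : LongitudeDatum p q Q) :
    (M₀ p q Q).map (𝓛.torusModule.Y : M p q Q →ₗ[ℂ[T;T⁻¹]] M p q Q) = M₀ p q Q := by
  have h := 𝓛.Y_basis_none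
  rw [basis_none] at h
  rw [M₀, Submodule.map_span, Set.image_singleton, LinearEquiv.coe_coe, h]

theorem M₀_le_comap_s (𝓛 : LongitudeDatum p q Q) :
    M₀ p q Q ≤ (M₀ p q Q).comap 𝓛.torusModule.s := by
  intro m hm
  obtain ⟨f, rfl⟩ := (𝓛.mem_M₀_iff m).1 hm
  rw [Submodule.mem_comap, map_smulₛₗ, s_basis_none, 𝓛.mem_M₀_iff]
  exact ⟨-inv f, (neg_smul (inv f) (𝓛.basis none)).trans (smul_neg (inv f) (𝓛.basis none)).symm⟩

/-- The identification of `M₀` with the sign representation. -/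
noncomputable def signEquiv (𝓛 : LongitudeDatum p q Q) : ℂ[T;T⁻¹] ≃ₗ[ℂ[T;T⁻¹]] M₀ p q Q :=
  LinearEquiv.ofBijective
    ((LinearMap.toSpanSingleton ℂ[T;T⁻¹] (M p q Q) (𝓛.basis none)).codRestrict (M₀ p q Q)
      fun f => (𝓛.mem_M₀_iff _).2 ⟨f, rfl⟩) (by
    constructor
    · intro f g h
      have h1 : f • 𝓛.basis none = g • 𝓛.basis none := congrArg Subtype.val h
      have h2 := congrArg (fun m => 𝓛.basis.repr m none) h1
      simpa using h2
    · rintro ⟨m, hm⟩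
      obtain ⟨f, rfl⟩ := (𝓛.mem_M₀_iff m).1 hm
      exact ⟨f, rfl⟩)

theorem coe_signEquiv (𝓛 : LongitudeDatum p q Q) (f : ℂ[T;T⁻¹]) :
    (𝓛.signEquiv f : M p q Q) = f • 𝓛.basis none := rfl

/-- The action of `ℂ[X^{±1}, Y^{±1}] ⋊ ℤ/2` on `M / M₀`. -/
noncomputable def torusModuleBar (𝓛 : LongitudeDatum p q Q) : TorusModule (Mbar p q Q) where
  Y := Submodule.Quotient.equiv _ _ 𝓛.torusModule.Y 𝓛.map_Y_M₀
  s := Submodule.mapQ _ _ 𝓛.torusModule.s 𝓛.M₀_le_comap_s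
  s_s z := by
    obtain ⟨m, rfl⟩ := (M₀ p q Q).mkQ_surjective z
    exact congrArg (M₀ p q Q).mkQ (𝓛.torusModule.s_s m)
  s_Y z := by
    obtain ⟨m, rfl⟩ := (M₀ p q Q).mkQ_surjective z
    exact congrArg (M₀ p q Q).mkQ (𝓛.torusModule.s_Y m)

theorem torusModuleBar_Y (𝓛 : LongitudeDatum p q Q) (m : M p q Q) :
    𝓛.torusModuleBar.Y ((M₀ p q Q).mkQ m) = (M₀ p q Q).mkQ (𝓛.torusModule.Y m) := rfl

theorem torusModuleBar_s (𝓛 : LongitudeDatum p q Q) (m : M p q Q) :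
    𝓛.torusModuleBar.s ((M₀ p q Q).mkQ m) = (M₀ p q Q).mkQ (𝓛.torusModule.s m) := rfl

end LongitudeDatum

/-! ### Dunkl-type operators and Hecke algebra actions -/

section HeckeAction

open LaurentPolynomial

theorem divDiff_T_one : divDiff (T 1) = 1 := by
  apply mul_left_cancel₀ laurentDelta_ne_zero
  rw [laurentDelta_mul_divDiff, inv_T, mul_one, laurentDelta]

theorem divDiff_T_neg_one : divDiff (T (-1)) = -1 := by
  apply mul_left_cancel₀ laurentDelta_ne_zero
  rw [laurentDelta_mul_divDiff, inv_T, neg_neg, mul_neg, mul_one, laurentDelta, neg_sub]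

theorem bar_one : bar 1 = 0 := by rw [bar, inv_one, sub_self]

namespace DunklDatum

variable {V : Type} [AddCommGroup V] [Module ℂ[T;T⁻¹] V]

/-- A semilinear involution `σ` such that `1 + σ` takes values in the multiples of `X - X⁻¹`. -/
noncomputable def ofExists (σ : V →ₛₗ[inv] V) (hσ : ∀ v, σ (σ v) = v)
    (hD : ∀ v, ∃ w, laurentDelta • w = v + σ v) (h : ∀ v : V, laurentDelta • v = 0 → v = 0) :
    DunklDatum V where
  σ := σ
  D v := (hD v).choose
  σ_σ := hσ
  delta_smul_D v := (hD v).choose_spec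
  torsionFree := h

variable [Module ℂ V] [IsScalarTower ℂ ℂ[T;T⁻¹] V]

theorem mulOp_apply (f : ℂ[T;T⁻¹]) (v : V) : mulOp f v = f • v := rfl

/-- The choice `Z₁ = X`, `Z₀ = -X⁻¹` in `exists_dahaRep`. The divided difference of `X⁻¹` is `-1`,
so the condition on `T₀` reads `f + t̄₁ X⁻¹ = t̄₂`, which dictates `f = coeffXinv t₁ t₂`. The
operator `E₁` is left abstract to cover both `s` on `M` and the Dunkl operator of `-s`. -/
theorem exists_dahaRep_neg (𝓓 : DunklDatum V) {t₁ t₂ t₃ t₄ : ℂ}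
    (h₁ : t₁ ≠ 0) (h₂ : t₂ ≠ 0) (h₃ : t₃ ≠ 0) (h₄ : t₄ ≠ 0) (E₁ : Module.End ℂ V)
    (hE : ∀ v, E₁ (E₁ v) = bar t₃ • E₁ v + v)
    (hX : ∀ v, E₁ ((T (-1) : ℂ[T;T⁻¹]) • v) =
      (T 1 : ℂ[T;T⁻¹]) • E₁ v - coeffX t₃ t₄ • v) :
    ∃ ρ : Daha (-1) t₁ t₂ t₃ t₄ →ₐ[ℂ] Module.End ℂ V,
      ρ (dahaGen _ _ _ _ _ .T0) = 𝓓.op t₁ (coeffXinv t₁ t₂) ∧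
      ρ (dahaGen _ _ _ _ _ .T0v) =
        (𝓓.op t₁ (coeffXinv t₁ t₂) - bar t₁ • 1) * mulOp (-T (-1)) ∧
      ρ (dahaGen _ _ _ _ _ .T1) = E₁ ∧
      ρ (dahaGen _ _ _ _ _ .T1v) = mulOp (T 1) * (E₁ - bar t₃ • 1) := by
  refine exists_dahaRep h₁ h₂ h₃ h₄ ?_ ?_ ?_ ?_ ?_
  · ext v
    change (T 1 : ℂ[T;T⁻¹]) • (-T (-1) : ℂ[T;T⁻¹]) • v = -v
    rw [smul_smul, mul_neg, ← T_add, add_neg_cancel, T_zero, neg_smul, one_smul]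
  · ext v
    exact 𝓓.op_op t₁ _ (coeffXinv_sub_inv t₁ t₂) h₁ v
  · ext v
    exact hE v
  · ext v
    change 𝓓.op t₁ _ ((-T (-1) : ℂ[T;T⁻¹]) • v) - bar t₁ • (-T (-1) : ℂ[T;T⁻¹]) • v +
      (T 1 : ℂ[T;T⁻¹]) • 𝓓.op t₁ _ v = bar t₂ • v
    rw [neg_smul, map_neg, op_mul_smul, inv_T, neg_neg, divDiff_T_neg_one, coeffXinv,
      ← C_smul, ← C_smul]
    module
  · ext v
    change (T 1 : ℂ[T;T⁻¹]) • (E₁ v - bar t₃ • v) + E₁ ((-T (-1) : ℂ[T;T⁻¹]) • v) = bar t₄ • v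
    rw [neg_smul, map_neg, hX, coeffX, ← C_smul, ← C_smul]
    module

/-- The choice `Z₁ = -X⁻¹`, `Z₀ = X`. The divided difference of `X` is 1, so the condition on `T₀`
reads `f - t̄₁ X = t̄₂`. -/
theorem exists_dahaRep_pos (𝓓 : DunklDatum V) {t₁ t₂ t₃ t₄ : ℂ}
    (h₁ : t₁ ≠ 0) (h₂ : t₂ ≠ 0) (h₃ : t₃ ≠ 0) (h₄ : t₄ ≠ 0) (E₁ : Module.End ℂ V)
    (hE : ∀ v, E₁ (E₁ v) = bar t₃ • E₁ v + v)
    (hX : ∀ v, E₁ ((T 1 : ℂ[T;T⁻¹]) • v) =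
      (T (-1) : ℂ[T;T⁻¹]) • E₁ v + coeffXinv t₃ t₄ • v) :
    ∃ ρ : Daha (-1) t₁ t₂ t₃ t₄ →ₐ[ℂ] Module.End ℂ V,
      ρ (dahaGen _ _ _ _ _ .T0) = 𝓓.op t₁ (coeffX t₁ t₂) ∧
      ρ (dahaGen _ _ _ _ _ .T0v) = (𝓓.op t₁ (coeffX t₁ t₂) - bar t₁ • 1) * mulOp (T 1) ∧
      ρ (dahaGen _ _ _ _ _ .T1) = E₁ ∧
      ρ (dahaGen _ _ _ _ _ .T1v) = mulOp (-T (-1)) * (E₁ - bar t₃ • 1) := by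
  refine exists_dahaRep h₁ h₂ h₃ h₄ ?_ ?_ ?_ ?_ ?_
  · ext v
    change (-T (-1) : ℂ[T;T⁻¹]) • (T 1 : ℂ[T;T⁻¹]) • v = -v
    rw [smul_smul, neg_mul, ← T_add, neg_add_cancel, T_zero, neg_smul, one_smul]
  · ext v
    exact 𝓓.op_op t₁ _ (coeffX_sub_inv t₁ t₂) h₁ v
  · ext v
    exact hE v
  · ext v
    change 𝓓.op t₁ _ ((T 1 : ℂ[T;T⁻¹]) • v) - bar t₁ • (T 1 : ℂ[T;T⁻¹]) • v +
      (-T (-1) : ℂ[T;T⁻¹]) • 𝓓.op t₁ _ v = bar t₂ • v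
    rw [op_mul_smul, inv_T, divDiff_T_one, coeffX, ← C_smul, ← C_smul]
    module
  · ext v
    change (-T (-1) : ℂ[T;T⁻¹]) • (E₁ v - bar t₃ • v) + E₁ ((T 1 : ℂ[T;T⁻¹]) • v) = bar t₄ • v
    rw [hX, coeffXinv, ← C_smul, ← C_smul]
    module

end DunklDatum

end HeckeAction

/-! ### Localized modules -/

section Localized

variable {V : Type} [AddCommGroup V] [Module ℂ[T;T⁻¹] V]

theorem toVLoc_injective [Module.IsTorsionFree ℂ[T;T⁻¹] V] : Function.Injective (toVLoc V) := by
  intro v w h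
  obtain ⟨u, hu⟩ := LocalizedModule.mk_eq.1 h
  simp only [one_smul] at hu
  exact smul_right_injective V (nonZeroDivisors.coe_ne_zero u) hu

theorem algebraMap_laurentDelta_ne_zero : algebraMap ℂ[T;T⁻¹] RatX laurentDelta ≠ 0 := by
  rw [Ne, FaithfulSMul.algebraMap_eq_zero_iff]
  exact laurentDelta_ne_zero

theorem overDelta_smul (f : ℂ[T;T⁻¹]) (z : Loc V) : overDelta f • z = f • overDelta 1 • z := by
  rw [← algebraMap_smul RatX f, smul_smul]
  simp only [overDelta, map_one, mul_one_div]

theorem laurentDelta_smul_overDelta (z : Loc V) : laurentDelta • overDelta 1 • z = z := by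
  rw [← overDelta_smul]
  have h : overDelta laurentDelta = 1 := div_self algebraMap_laurentDelta_ne_zero
  rw [h, one_smul]

/-- A semilinear involution of a localized module defines a Dunkl datum. -/
noncomputable def locDatum (τ : Loc V →ₛₗ[inv] Loc V) (hτ : ∀ z, τ (τ z) = z) :
    DunklDatum (Loc V) where
  σ := τ
  D z := overDelta 1 • (z + τ z)
  σ_σ := hτ
  delta_smul_D _ := laurentDelta_smul_overDelta _
  torsionFree z hz := by rw [← laurentDelta_smul_overDelta z, smul_comm, hz, smul_zero]

namespace TorusModule

variable (𝓥 : TorusModule V)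

/-- The involution `s Y`. -/
noncomputable def sY : V →ₛₗ[inv] V := 𝓥.s.comp (𝓥.Y : V →ₗ[ℂ[T;T⁻¹]] V)

theorem sY_apply (v : V) : 𝓥.sY v = 𝓥.s (𝓥.Y v) := rfl

theorem sY_sY (v : V) : 𝓥.sY (𝓥.sY v) = v := by
  rw [sY_apply, sY_apply, s_Y, s_s, LinearEquiv.symm_apply_apply]

theorem neg_s_neg_s (v : V) : (-𝓥.s) ((-𝓥.s) v) = v := by
  rw [LinearMap.neg_apply, LinearMap.neg_apply, map_neg, neg_neg, s_s]

theorem loc_Y_toVLoc (v : V) : 𝓥.loc.Y (toVLoc V v) = toVLoc V (𝓥.Y v) :=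
  locMap_mk (RingHom.id _) (fun f => f.2) 𝓥.Y.toLinearMap v 1

theorem loc_s_toVLoc (v : V) : 𝓥.loc.s (toVLoc V v) = toVLoc V (𝓥.s v) := by
  refine (locMap_mk inv inv_mem_nonZeroDivisors 𝓥.s v 1).trans ?_
  change _ = LocalizedModule.mk (𝓥.s v) 1
  congr 1
  exact Subtype.ext (map_one inv)

variable [Module ℂ V] [IsScalarTower ℂ ℂ[T;T⁻¹] V]

theorem opT0_eq (t : ℂ) (f : ℂ[T;T⁻¹]) (z : Loc V) :
    opT0 𝓥 t f z = (locDatum 𝓥.loc.sY 𝓥.loc.sY_sY).op t f z := by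
  rw [opT0, overDelta_smul, C_smul]
  rfl

/-- The operator `T₁` is the Dunkl operator of the involution `-s`, so no separate theory is needed
for it. -/
theorem opT1_eq (t : ℂ) (f : ℂ[T;T⁻¹]) (z : Loc V) :
    opT1 𝓥 t f z = (locDatum (-𝓥.loc.s) 𝓥.loc.neg_s_neg_s).op t f z := by
  rw [opT1, overDelta_smul, C_smul, DunklDatum.op_apply, sub_eq_add_neg]
  change _ = -(t • -𝓥.loc.s z) + f • overDelta 1 • (z + -𝓥.loc.s z)
  rw [smul_neg, neg_neg]

end TorusModule

variable [Module ℂ V] [IsScalarTower ℂ ℂ[T;T⁻¹] V]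

/-- After multiplication by `δ` both sides are the same combination of `v` and `σ v`. Thus
divisibility of `1 + σ` on `V` itself is what makes the localized operator preserve `V`. -/
theorem locDatum_op_toVLoc {τ : Loc V →ₛₗ[inv] Loc V} (hτ : ∀ z, τ (τ z) = z)
    (𝓓 : DunklDatum V) (h : ∀ v, τ (toVLoc V v) = toVLoc V (𝓓.σ v)) (t : ℂ) (f : ℂ[T;T⁻¹])
    (v : V) : (locDatum τ hτ).op t f (toVLoc V v) = toVLoc V (𝓓.op t f v) := by
  apply (locDatum τ hτ).smul_cancel
  rw [DunklDatum.delta_smul_op, ← map_smul (toVLoc V) laurentDelta, DunklDatum.delta_smul_op,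
    map_add, map_smul, map_smul, ← h]
  rfl

/-- The operators on the localization which preserve the image of the module. -/
noncomputable def preserving (V : Type) [AddCommGroup V] [Module ℂ[T;T⁻¹] V] [Module ℂ V]
    [IsScalarTower ℂ ℂ[T;T⁻¹] V] : Subalgebra ℂ (Module.End ℂ (Loc V)) where
  carrier := {g | ∀ v, ∃ v', g (toVLoc V v) = toVLoc V v'}
  mul_mem' := fun {g g'} hg hg' v => by
    obtain ⟨v', h'⟩ := hg' v
    obtain ⟨w, h⟩ := hg v'
    exact ⟨w, by rw [Module.End.mul_apply, h', h]⟩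
  add_mem' := fun {g g'} hg hg' v => by
    obtain ⟨w, h⟩ := hg v
    obtain ⟨w', h'⟩ := hg' v
    exact ⟨w + w', by rw [LinearMap.add_apply, h, h', map_add]⟩
  algebraMap_mem' r v := by
    refine ⟨r • v, ?_⟩
    rw [Module.algebraMap_end_apply, ← C_smul, ← C_smul, map_smul]

theorem mem_preserving {g : Module.End ℂ (Loc V)} :
    g ∈ preserving V ↔ ∀ v, ∃ v', g (toVLoc V v) = toVLoc V v' := Iff.rfl

theorem mulOp_mem_preserving (f : ℂ[T;T⁻¹]) :
    (DunklDatum.mulOp f : Module.End ℂ (Loc V)) ∈ preserving V :=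
  fun v => ⟨f • v, by rw [DunklDatum.mulOp_apply, map_smul]⟩

theorem bar_smul_one_mem_preserving (t : ℂ) :
    (bar t • 1 : Module.End ℂ (Loc V)) ∈ preserving V :=
  Subalgebra.smul_mem _ (Subalgebra.one_mem _) _

/-- The action of the Hecke algebra on a localized module. -/
theorem TorusModule.exists_dahaRep_loc (𝓥 : TorusModule V) (𝓓₀ 𝓓₁ : DunklDatum V)
    (h𝓓₀ : 𝓓₀.σ = 𝓥.sY) (h𝓓₁ : 𝓓₁.σ = -𝓥.s) {t₁ t₂ t₃ t₄ : ℂ}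
    (h₁ : t₁ ≠ 0) (h₂ : t₂ ≠ 0) (h₃ : t₃ ≠ 0) (h₄ : t₄ ≠ 0) :
    (∃ ρ : Daha (-1) t₁ t₂ t₃ t₄ →ₐ[ℂ] Module.End ℂ (Loc V),
      (∀ z, ρ (dahaGen _ _ _ _ _ .T0) z = opT0 𝓥 t₁ (coeffXinv t₁ t₂) z) ∧
      (∀ z, ρ (dahaGen _ _ _ _ _ .T0) (ρ (dahaGen _ _ _ _ _ .T0v) z) =
        -((LaurentPolynomial.T (-1) : ℂ[T;T⁻¹]) • z)) ∧
      (∀ z, ρ (dahaGen _ _ _ _ _ .T1) z = opT1 𝓥 t₃ (coeffX t₃ t₄) z) ∧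
      (∀ z, ρ (dahaGen _ _ _ _ _ .T1v) (ρ (dahaGen _ _ _ _ _ .T1) z) =
        (LaurentPolynomial.T 1 : ℂ[T;T⁻¹]) • z) ∧
      ∀ (h : Daha (-1) t₁ t₂ t₃ t₄) (v : V), ∃ v', ρ h (toVLoc _ v) = toVLoc _ v') ∧
    ∀ v : V, ∃ v', opT0 𝓥 t₁ (coeffX t₁ t₂) (toVLoc _ v) = toVLoc _ v' := by
  set 𝓛₀ := locDatum 𝓥.loc.sY 𝓥.loc.sY_sY with h𝓛₀
  set 𝓛₁ := locDatum (-𝓥.loc.s) 𝓥.loc.neg_s_neg_s with h𝓛₁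
  have hp₀ : ∀ t f, 𝓛₀.op t f ∈ preserving V := fun t f v =>
    ⟨_, locDatum_op_toVLoc _ 𝓓₀ (fun v => by
      rw [h𝓓₀, sY_apply, sY_apply, loc_Y_toVLoc, loc_s_toVLoc]) t f v⟩
  have hp₁ : ∀ t f, 𝓛₁.op t f ∈ preserving V := fun t f v =>
    ⟨_, locDatum_op_toVLoc _ 𝓓₁ (fun v => by
      rw [h𝓓₁, LinearMap.neg_apply, LinearMap.neg_apply, loc_s_toVLoc, map_neg]) t f v⟩
  have hquad := 𝓛₁.op_op t₃ _ (coeffX_sub_inv t₃ t₄) h₃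
  obtain ⟨ρ, r0, r0v, r1, r1v⟩ := 𝓛₀.exists_dahaRep_neg h₁ h₂ h₃ h₄
    (𝓛₁.op t₃ (coeffX t₃ t₄)) hquad (fun v => by
      rw [𝓛₁.op_mul_smul, inv_T, neg_neg, divDiff_T_neg_one, mul_neg, mul_one, neg_smul,
        sub_eq_add_neg])
  refine ⟨⟨ρ, fun z => by rw [r0, 𝓥.opT0_eq], fun z => ?_, fun z => by rw [r1, 𝓥.opT1_eq],
    fun z => ?_, fun h => mem_preserving.1 (daha_induction ρ _ ?_ h)⟩, fun v => ?_⟩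
  · rw [r0, r0v, Module.End.mul_apply, LinearMap.sub_apply, map_sub, LinearMap.smul_apply,
      map_smul, Module.End.one_apply, 𝓛₀.op_op _ _ (coeffXinv_sub_inv t₁ t₂) h₁,
      DunklDatum.mulOp_apply, neg_smul]
    abel
  · rw [r1, r1v, Module.End.mul_apply, LinearMap.sub_apply, LinearMap.smul_apply,
      Module.End.one_apply, hquad, DunklDatum.mulOp_apply]
    congr 1
    abel
  · rintro (_ | _ | _ | _)
    · rw [r0]
      exact hp₀ _ _
    · rw [r0v]
      exact Subalgebra.mul_mem _ (Subalgebra.sub_mem _ (hp₀ _ _) (bar_smul_one_mem_preserving _))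
        (mulOp_mem_preserving _)
    · rw [r1]
      exact hp₁ _ _
    · rw [r1v]
      exact Subalgebra.mul_mem _ (mulOp_mem_preserving _)
        (Subalgebra.sub_mem _ (hp₁ _ _) (bar_smul_one_mem_preserving _))
  · rw [𝓥.opT0_eq]
    exact hp₀ _ _ v

end Localized

/-! ### Hecke algebra actions on `M` and its quotient -/

section ModuleActions

open LaurentPolynomial

/-- The involution `s` as a `ℂ`-linear operator. -/
noncomputable def TorusModule.sEnd {V : Type} [AddCommGroup V] [Module ℂ[T;T⁻¹] V] [Module ℂ V]
    [IsScalarTower ℂ ℂ[T;T⁻¹] V] (𝓥 : TorusModule V) : Module.End ℂ V where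
  toFun := 𝓥.s
  map_add' := map_add 𝓥.s
  map_smul' r v := by rw [← C_smul, map_smulₛₗ, inv_C, C_smul, RingHom.id_apply]

theorem TorusModule.sEnd_apply {V : Type} [AddCommGroup V] [Module ℂ[T;T⁻¹] V] [Module ℂ V]
    [IsScalarTower ℂ ℂ[T;T⁻¹] V] (𝓥 : TorusModule V) (v : V) : 𝓥.sEnd v = 𝓥.s v := rfl

namespace LongitudeDatum

variable {p : ℕ} {q : ℤ} {Q : MvPolynomial (Fin 2) ℂ}

/-- The Dunkl datum of the involution `s Y` of `M`. -/
noncomputable def dunkl (𝓛 : LongitudeDatum p q Q) : DunklDatum (M p q Q) :=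
  .ofExists 𝓛.torusModule.sY 𝓛.torusModule.sY_sY 𝓛.exists_dunkl
    fun _ h => M_cancel (h.trans (smul_zero _).symm)

theorem coe_dunkl_op (𝓛 : LongitudeDatum p q Q) (t : ℂ) (f : ℂ[T;T⁻¹]) (m : M p q Q) :
    (𝓛.dunkl.op t f m : HLoc p q) = opT0H p q t f m := by
  have h : (𝓛.dunkl.D m : HLoc p q) =
      deltaInv p q * (m + conjLoc p q (toLoc p q (elY p q) * m)) := by
    apply laurentDelta_smul_cancel
    rw [laurentDelta_smul_deltaInv_mul]
    exact congrArg Subtype.val (𝓛.dunkl.delta_smul_D m)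
  rw [opT0H, ← h]
  rfl

/-- For `t₃ = t₄ = 1` the Dunkl term of `T₁` has coefficient 0 and `T₁` is simply `s`; no
divisibility of `1 - s` is required on `M`. -/
theorem exists_dahaRep_M (𝓛 : LongitudeDatum p q Q) {t₁ t₂ : ℂ} (h₁ : t₁ ≠ 0) (h₂ : t₂ ≠ 0) :
    ∃ ρ : Daha (-1) t₁ t₂ 1 1 →ₐ[ℂ] Module.End ℂ (M p q Q),
      (∀ m, (ρ (dahaGen _ _ _ _ _ .T0) m : HLoc p q) = opT0H p q t₁ (coeffXinv t₁ t₂) m) ∧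
      (∀ m, ρ (dahaGen _ _ _ _ _ .T0) (ρ (dahaGen _ _ _ _ _ .T0v) m) =
        -((T (-1) : ℂ[T;T⁻¹]) • m)) ∧
      (∀ m, ρ (dahaGen _ _ _ _ _ .T1) m = 𝓛.torusModule.s m) ∧
      (∀ m, ρ (dahaGen _ _ _ _ _ .T1v) m = (T 1 : ℂ[T;T⁻¹]) • 𝓛.torusModule.s m) := by
  obtain ⟨ρ, r0, r0v, r1, r1v⟩ := 𝓛.dunkl.exists_dahaRep_neg h₁ h₂ one_ne_zero one_ne_zero
    𝓛.torusModule.sEnd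
    (fun v => by
      rw [bar_one, zero_smul, zero_add]
      exact 𝓛.torusModule.s_s v)
    (fun v => by
      rw [coeffX, bar_one, map_zero, zero_mul, add_zero, zero_smul, sub_zero,
        TorusModule.sEnd_apply, map_smulₛₗ, inv_T, neg_neg, TorusModule.sEnd_apply])
  refine ⟨ρ, fun m => by rw [r0, coe_dunkl_op], fun m => ?_, fun m => by rw [r1]; rfl,
    fun m => ?_⟩
  · rw [r0, r0v, Module.End.mul_apply, LinearMap.sub_apply, map_sub, LinearMap.smul_apply,
      map_smul, Module.End.one_apply, DunklDatum.op_op _ _ _ (coeffXinv_sub_inv t₁ t₂) h₁,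
      DunklDatum.mulOp_apply, neg_smul, add_sub_cancel_left]
  · rw [r1v, Module.End.mul_apply, LinearMap.sub_apply, LinearMap.smul_apply, bar_one, zero_smul,
      sub_zero]
    rfl

theorem exists_dahaRep_M' (𝓛 : LongitudeDatum p q Q) {t₁ t₂ : ℂ} (h₁ : t₁ ≠ 0) (h₂ : t₂ ≠ 0) :
    ∃ ρ : Daha (-1) t₁ t₂ 1 1 →ₐ[ℂ] Module.End ℂ (M p q Q),
      (∀ m, (ρ (dahaGen _ _ _ _ _ .T0) m : HLoc p q) = opT0H p q t₁ (coeffX t₁ t₂) m) ∧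
      (∀ m, ρ (dahaGen _ _ _ _ _ .T0) (ρ (dahaGen _ _ _ _ _ .T0v) m) =
        (T 1 : ℂ[T;T⁻¹]) • m) ∧
      (∀ m, ρ (dahaGen _ _ _ _ _ .T1) m = 𝓛.torusModule.s m) ∧
      (∀ m, ρ (dahaGen _ _ _ _ _ .T1v) m = -((T (-1) : ℂ[T;T⁻¹]) • 𝓛.torusModule.s m)) := by
  obtain ⟨ρ, r0, r0v, r1, r1v⟩ := 𝓛.dunkl.exists_dahaRep_pos h₁ h₂ one_ne_zero one_ne_zero
    𝓛.torusModule.sEnd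
    (fun v => by
      rw [bar_one, zero_smul, zero_add]
      exact 𝓛.torusModule.s_s v)
    (fun v => by
      rw [coeffXinv, bar_one, map_zero, zero_mul, sub_zero, zero_smul, add_zero,
        TorusModule.sEnd_apply, map_smulₛₗ, inv_T, TorusModule.sEnd_apply])
  refine ⟨ρ, fun m => by rw [r0, coe_dunkl_op], fun m => ?_, fun m => by rw [r1]; rfl,
    fun m => ?_⟩
  · rw [r0, r0v, Module.End.mul_apply, LinearMap.sub_apply, map_sub, LinearMap.smul_apply,
      map_smul, Module.End.one_apply, DunklDatum.op_op _ _ _ (coeffX_sub_inv t₁ t₂) h₁,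
      DunklDatum.mulOp_apply, add_sub_cancel_left]
  · rw [r1v, Module.End.mul_apply, LinearMap.sub_apply, LinearMap.smul_apply, bar_one, zero_smul,
      sub_zero, DunklDatum.mulOp_apply, neg_smul]
    rfl

theorem isTorsionFree_Mbar (𝓛 : LongitudeDatum p q Q) :
    Module.IsTorsionFree ℂ[T;T⁻¹] (Mbar p q Q) := 𝓛.basisBar.isTorsionFree

theorem Mbar_torsionFree (𝓛 : LongitudeDatum p q Q) (v : Mbar p q Q) (h : laurentDelta • v = 0) :
    v = 0 := by
  have := 𝓛.isTorsionFree_Mbar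
  exact (smul_eq_zero_iff_right laurentDelta_ne_zero).1 h

/-- The Dunkl datum of the involution `s Y` of `M / M₀`. -/
noncomputable def dunklBar (𝓛 : LongitudeDatum p q Q) : DunklDatum (Mbar p q Q) :=
  .ofExists 𝓛.torusModuleBar.sY 𝓛.torusModuleBar.sY_sY
    (fun v => by
      obtain ⟨m, rfl⟩ := (M₀ p q Q).mkQ_surjective v
      obtain ⟨m', h⟩ := 𝓛.exists_dunkl m
      exact ⟨(M₀ p q Q).mkQ m', congrArg (M₀ p q Q).mkQ h⟩)
    𝓛.Mbar_torsionFree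

/-- For `m = g + c Q δ⁻¹` one has `m - s m = (g - ḡ) + (c + c̄) Q δ⁻¹`. The first part is divisible
by `δ` and the second lies in `M₀`. On `M` the statement fails, since `Q δ⁻¹ - s (Q δ⁻¹) = 2 Q δ⁻¹`
is twice a basis vector; this is why the five-parameter action lives on `M̄`. -/
theorem exists_sub_s (𝓛 : LongitudeDatum p q Q) (v : Mbar p q Q) :
    ∃ w, laurentDelta • w = v + (-𝓛.torusModuleBar.s) v := by
  obtain ⟨m, rfl⟩ := (M₀ p q Q).mkQ_surjective v
  obtain ⟨g, c, h⟩ := 𝓛.exists_coord m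
  obtain ⟨e, he⟩ := exists_divDiffLI g
  refine ⟨(M₀ p q Q).mkQ ⟨coord Q e 0, 𝓛.coord_mem _ _⟩, ?_⟩
  rw [LinearMap.neg_apply, 𝓛.torusModuleBar_s, ← sub_eq_add_neg, ← map_smul, ← map_sub,
    ← sub_eq_zero, ← map_sub, Submodule.mkQ_apply, Submodule.Quotient.mk_eq_zero, 𝓛.mem_M₀_iff]
  -- The coefficient of `Q δ⁻¹` in `δ e - (m - s m)`.
  refine ⟨-c - inv c, Subtype.ext ?_⟩
  rw [Submodule.coe_smul, basis_none, AddSubgroupClass.coe_sub, AddSubgroupClass.coe_sub,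
    Submodule.coe_smul, coe_s, h, 𝓛.conjLoc_coord, smul_coord, he, coord, coord, coord, map_sub]
  module

/-- The Dunkl datum of the involution `-s` of `M / M₀`. -/
noncomputable def dunklBarNeg (𝓛 : LongitudeDatum p q Q) : DunklDatum (Mbar p q Q) :=
  .ofExists (-𝓛.torusModuleBar.s) 𝓛.torusModuleBar.neg_s_neg_s 𝓛.exists_sub_s 𝓛.Mbar_torsionFree

theorem Y_signEquiv (𝓛 : LongitudeDatum p q Q) (f : ℂ[T;T⁻¹]) :
    𝓛.torusModule.Y (𝓛.signEquiv f) = 𝓛.signEquiv (signRep.Y f) := by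
  rw [coe_signEquiv, map_smul, Y_basis_none]
  rfl

theorem s_signEquiv (𝓛 : LongitudeDatum p q Q) (f : ℂ[T;T⁻¹]) :
    𝓛.torusModule.s (𝓛.signEquiv f) = 𝓛.signEquiv (signRep.s f) := by
  rw [coe_signEquiv, map_smulₛₗ, s_basis_none, coe_signEquiv]
  exact (smul_neg (inv f) (𝓛.basis none)).trans (neg_smul (inv f) (𝓛.basis none)).symm

end LongitudeDatum

end ModuleActions

end TwoBridge

/-! ### The theorem -/

open TwoBridge LaurentPolynomial in
theorem mainTheorem3 (p : ℕ) (q : ℤ) (hp : Odd p) (hq : Odd q) (hlt : |q| < p)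
    (hcop : IsCoprime (p : ℤ) q) :
    (∃ Q : MvPolynomial (Fin 2) ℂ, IsBHPolynomial p q Q) ∧
    ∀ Q : MvPolynomial (Fin 2) ℂ, IsBHPolynomial p q Q →
      -- `Y Q = Q`
      elY p q * elQ p q Q = elQ p q Q ∧
      -- `M` is stable under `Y^{±1}` and `s`, hence a `ℂ[X^{±1}, Y^{±1}] ⋊ ℤ/2`-module
      ∃ 𝓜 : TorusModule (M p q Q),
        (∀ m, (𝓜.Y m : HLoc p q) = toLoc p q (elY p q) * m) ∧
        (∀ m, (𝓜.s m : HLoc p q) = conjLoc p q m) ∧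
        -- the symmetric part of `M` is `H⁺`
        (∀ z : HLoc p q, (z ∈ M p q Q ∧ conjLoc p q z = z) ↔
          ∃ h, BH.conj h = h ∧ z = toLoc p q h) ∧
        -- the three-parameter action on `M`
        (∀ t₁ t₂ : ℂ, t₁ ≠ 0 → t₂ ≠ 0 →
          ∃ ρ : Daha (-1) t₁ t₂ 1 1 →ₐ[ℂ] Module.End ℂ (M p q Q),
            (∀ m, (ρ (dahaGen _ _ _ _ _ .T0) m : HLoc p q) =
              opT0H p q t₁ (coeffXinv t₁ t₂) m) ∧
            (∀ m, ρ (dahaGen _ _ _ _ _ .T0) (ρ (dahaGen _ _ _ _ _ .T0v) m) =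
              -((T (-1) : ℂ[T;T⁻¹]) • m)) ∧
            (∀ m, ρ (dahaGen _ _ _ _ _ .T1) m = 𝓜.s m) ∧
            (∀ m, ρ (dahaGen _ _ _ _ _ .T1v) m = (T 1 : ℂ[T;T⁻¹]) • 𝓜.s m)) ∧
        -- the variant with the coefficient `t̄₁ X + t̄₂`
        (∀ t₁ t₂ : ℂ, t₁ ≠ 0 → t₂ ≠ 0 →
          ∃ ρ : Daha (-1) t₁ t₂ 1 1 →ₐ[ℂ] Module.End ℂ (M p q Q),
            (∀ m, (ρ (dahaGen _ _ _ _ _ .T0) m : HLoc p q) =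
              opT0H p q t₁ (coeffX t₁ t₂) m) ∧
            (∀ m, ρ (dahaGen _ _ _ _ _ .T0) (ρ (dahaGen _ _ _ _ _ .T0v) m) =
              (T 1 : ℂ[T;T⁻¹]) • m) ∧
            (∀ m, ρ (dahaGen _ _ _ _ _ .T1) m = 𝓜.s m) ∧
            (∀ m, ρ (dahaGen _ _ _ _ _ .T1v) m = -((T (-1) : ℂ[T;T⁻¹]) • 𝓜.s m))) ∧
        -- `M` is free with basis `1, I, …, I^{d-1}, Q δ⁻¹`, and `M̄` with basis `1, …, I^{d-1}`
        (∃ B : Module.Basis (Option (Fin ((p - 1) / 2))) ℂ[T;T⁻¹] (M p q Q),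
          (B none : HLoc p q) = Qdelta p q Q ∧
          (∀ n : Fin ((p - 1) / 2), (B (some n) : HLoc p q) =
            toLoc p q ((qi p q * qi p q) ^ (n : ℕ))) ∧
          ∃ B' : Module.Basis (Fin ((p - 1) / 2)) ℂ[T;T⁻¹] (Mbar p q Q),
            ∀ n, B' n = (M₀ p q Q).mkQ (B (some n))) ∧
        -- `M₀` is a submodule isomorphic to the sign representation
        (∃ φ : ℂ[T;T⁻¹] ≃ₗ[ℂ[T;T⁻¹]] M₀ p q Q,
          (∀ f, 𝓜.Y (φ f) = φ (signRep.Y f)) ∧ (∀ f, 𝓜.s (φ f) = φ (signRep.s f))) ∧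
        -- the five-parameter action on `M̄^loc` preserves `M̄`
        ∃ 𝓑 : TorusModule (Mbar p q Q),
          (∀ m, 𝓑.Y ((M₀ p q Q).mkQ m) = (M₀ p q Q).mkQ (𝓜.Y m)) ∧
          (∀ m, 𝓑.s ((M₀ p q Q).mkQ m) = (M₀ p q Q).mkQ (𝓜.s m)) ∧
          Function.Injective (toVLoc (Mbar p q Q)) ∧
          ∀ t₁ t₂ t₃ t₄ : ℂ, t₁ ≠ 0 → t₂ ≠ 0 → t₃ ≠ 0 → t₄ ≠ 0 →
            (∃ ρ : Daha (-1) t₁ t₂ t₃ t₄ →ₐ[ℂ] Module.End ℂ (Loc (Mbar p q Q)),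
              (∀ z, ρ (dahaGen _ _ _ _ _ .T0) z = opT0 𝓑 t₁ (coeffXinv t₁ t₂) z) ∧
              (∀ z, ρ (dahaGen _ _ _ _ _ .T0) (ρ (dahaGen _ _ _ _ _ .T0v) z) =
                -((T (-1) : ℂ[T;T⁻¹]) • z)) ∧
              (∀ z, ρ (dahaGen _ _ _ _ _ .T1) z = opT1 𝓑 t₃ (coeffX t₃ t₄) z) ∧
              (∀ z, ρ (dahaGen _ _ _ _ _ .T1v) (ρ (dahaGen _ _ _ _ _ .T1) z) =
                (T 1 : ℂ[T;T⁻¹]) • z) ∧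
              ∀ (h : Daha (-1) t₁ t₂ t₃ t₄) (v : Mbar p q Q),
                ∃ v', ρ h (toVLoc _ v) = toVLoc _ v') ∧
            ∀ v : Mbar p q Q, ∃ v', opT0 𝓑 t₁ (coeffX t₁ t₂) (toVLoc _ v) = toVLoc _ v' := by
  -- An odd `q` is nonzero, so `|q| < p` excludes `p = 1`; thus `d ≥ 1` and the word `v` is not
  -- empty.
  have hp3 : 3 ≤ p := by
    have h1 : q ≠ 0 := by
      rintro rfl
      exact absurd hq (by decide)
    have h2 := Int.one_le_abs h1
    obtain ⟨k, rfl⟩ := hp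
    omega
  have hw : IsSignWord (vWord p q) := isSignWord_vWord hcop
  refine ⟨⟨_, isBHPolynomial_defPoly hp3 hw⟩, fun Q hQ => ?_⟩
  obtain ⟨𝓛⟩ := hQ.nonempty_longitudeDatum hp3 hw
  have := 𝓛.isTorsionFree_Mbar
  exact ⟨𝓛.elY_mul, 𝓛.torusModule, 𝓛.coe_Y, 𝓛.coe_s, 𝓛.invariant_iff,
    fun _ _ => 𝓛.exists_dahaRep_M, fun _ _ => 𝓛.exists_dahaRep_M',
    ⟨𝓛.basis, congrArg Subtype.val 𝓛.basis_none, 𝓛.coe_basis_some, 𝓛.basisBar,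
      𝓛.basisBar_apply⟩,
    ⟨𝓛.signEquiv, 𝓛.Y_signEquiv, 𝓛.s_signEquiv⟩,
    𝓛.torusModuleBar, 𝓛.torusModuleBar_Y, 𝓛.torusModuleBar_s, toVLoc_injective,
    fun _ _ _ _ => 𝓛.torusModuleBar.exists_dahaRep_loc 𝓛.dunklBar 𝓛.dunklBarNeg rfl rfl⟩
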